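/- All systems are finite-dimensional. A system $S$ carries a Hamiltonian (Hermitian matrix) $H_S$; a joint system $SC$ has Hamiltonian $H_S\otimes I_C+I_S\otimes H_C$. A covariant operation $\Lambda$ from a system with Hamiltonian $H$ to one with Hamiltonian $H'$ is a completely positive trace-preserving map with $e^{-iH't}\Lambda(X)e^{iH't}=\Lambda(e^{-iHt}Xe^{iHt})$ for all $t\in\mathbb R$ and all $X$. Write $\|M\|_1=\mathrm{Tr}\sqrt{M^\dagger M}$ and $\|\cdot\|_\infty$ for the operator norm. For a state (density matrix) $\rho$ with eigenvalues $\lambda_k$ and orthonormal eigenvectors $|\psi_k\rangle$, the quantum Fisher information is $$F_Q(\rho,H)=2\sum_{k,l}\frac{(\lambda_k-\lambda_l)^2}{\lambda_k+\lambda_l}\,|\langle\psi_k|H|\psi_l\rangle|^2,$$ where terms with $\lambda_k=\lambda_l=0$ are omitted. A state $\rho$ of $S$ is converted into a state $\sigma$ of $S'$ with error less than $\varepsilon$ by a catalyst $C$ with Hamiltonian $H_C$ and state $\tau_C$ if there is a covariant operation $\Lambda:SC\to S'C$ such that $\mu_{S'C}=\Lambda(\rho\otimes\tau_C)$ satisfies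 $\mu_C=\tau_C$ and $\|\mu_{S'C}-\sigma\otimes\tau_C\|_1<\varepsilon$. The state $\rho$ can be transformed into $\sigma$ by approximate catalysis if such a catalyst exists for every $\varepsilon>0$; it can be so transformed with a bounded catalyst Hamiltonian if, in addition, there is a real $M$, independent of $\varepsilon$, such that the catalysts can be chosen with $\|H_C\|_\infty<M$. 1. If $\rho$ can be transformed into $\sigma$ by approximate catalysis with a bounded catalyst Hamiltonian, then $F_Q(\rho,H_S)\ge F_Q(\sigma,H_{S'})$. 2. Consequently, if $F_Q(\rho,H_S)<F_Q(\sigma,H_{S'})$, then transforming $\rho$ into $\sigma$ requires catalyst Hamiltonians of unbounded norm: for every real $M$ there is $\varepsilon_0>0$ such that every catalyst converting $\rho$ into $\sigma$ with error less than some $\varepsilon\le\varepsilon_0$ has $\|H_C\|_\infty\ge M$. 3. Let $E_0\ne E_1$ be real, let a qubit have Hamiltonian $H=E_0|0\rangle\langle0|+E_1|1\rangle\langle1|$, let $|+\rangle=(|0\rangle+|1\rangle)/\sqrt2$, and let $n\ge2$; give $n$ qubits the sum $H^{(n)}$ of their local Hamiltonians. Then $|+\rangle\langle+|$ can be transformed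 into $|+\rangle\langle+|^{\otimes n}$ by approximate catalysis, $F_Q(|+\rangle\langle+|,H)<F_Q(|+\rangle\langle+|^{\otimes n},H^{(n)})$, and this transformation requires catalyst Hamiltonians of unbounded norm in the sense of 2. -/

import Mathlib

noncomputable section

namespace Asymmetry

open scoped Kronecker MatrixOrder ComplexOrder

variable {S S' C : Type*} [Fintype S] [DecidableEq S] [Fintype S'] [DecidableEq S']
  [Fintype C] [DecidableEq C]

/-- Density matrices: positive semidefinite with unit trace. -/
def IsState (ρ : Matrix S S ℂ) : Prop :=
  ρ.PosSemidef ∧ ρ.trace = 1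

/-- The trace norm `Tr √(Mᴴ M)`. -/
def traceNorm (M : Matrix S S ℂ) : ℝ :=
  (CFC.sqrt (M.conjTranspose * M)).trace.re

/-- The operator norm, i.e. the largest singular value. -/
def opNorm (M : Matrix S S ℂ) : ℝ :=
  ‖Matrix.toEuclideanCLM (n := S) (𝕜 := ℂ) M‖

/-- The Hamiltonian `H ⊗ 1 + 1 ⊗ K` of a joint system. -/
def jointHamiltonian (H : Matrix S S ℂ) (K : Matrix C C ℂ) : Matrix (S × C) (S × C) ℂ :=
  H ⊗ₖ (1 : Matrix C C ℂ) + (1 : Matrix S S ℂ) ⊗ₖ K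

/-- The reduced state of the second tensor factor (partial trace over the first one). -/
def reducedSnd (X : Matrix (S × C) (S × C) ℂ) : Matrix C C ℂ :=
  Matrix.of fun c c' => ∑ s, X (s, c) (s, c')

/-- The map `Φ ⊗ id` on matrices with an auxiliary system of dimension `k`. -/
def ampliation (Φ : Matrix S S ℂ →ₗ[ℂ] Matrix S' S' ℂ) (k : ℕ)
    (X : Matrix (S × Fin k) (S × Fin k) ℂ) : Matrix (S' × Fin k) (S' × Fin k) ℂ :=
  Matrix.of fun p q => Φ (Matrix.of fun i j => X (i, p.2) (j, q.2)) p.1 q.1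

/-- Quantum channels: completely positive trace-preserving linear maps. -/
def IsChannel (Φ : Matrix S S ℂ →ₗ[ℂ] Matrix S' S' ℂ) : Prop :=
  (∀ (k : ℕ) (X : Matrix (S × Fin k) (S × Fin k) ℂ),
      X.PosSemidef → (ampliation Φ k X).PosSemidef) ∧
    ∀ X, (Φ X).trace = X.trace

/-- The time evolution operator `exp (-i H t)`. -/
def evolution (H : Matrix S S ℂ) (t : ℝ) : Matrix S S ℂ :=
  NormedSpace.exp ((-(Complex.I * (t : ℂ))) • H)

/-- Covariant operations from a system with Hamiltonian `H` to one with Hamiltonian `H'`: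
channels that commute with time translations. -/
def IsCovariant (H : Matrix S S ℂ) (H' : Matrix S' S' ℂ)
    (Φ : Matrix S S ℂ →ₗ[ℂ] Matrix S' S' ℂ) : Prop :=
  IsChannel Φ ∧ ∀ (X : Matrix S S ℂ) (t : ℝ),
    evolution H' t * Φ X * evolution H' (-t) = Φ (evolution H t * X * evolution H (-t))

/-- The catalyst with Hamiltonian `K` and state `τ` converts `ρ` into `σ` through the covariant
operation `Φ`: with `μ = Φ (ρ ⊗ τ)`, the catalyst is returned exactly in its state `τ`, and
`μ` has trace-norm distance less than `ε` from `σ ⊗ τ`. -/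
def CatalyticConversion (H : Matrix S S ℂ) (H' : Matrix S' S' ℂ) (ρ : Matrix S S ℂ)
    (σ : Matrix S' S' ℂ) (ε : ℝ) (K τ : Matrix C C ℂ)
    (Φ : Matrix (S × C) (S × C) ℂ →ₗ[ℂ] Matrix (S' × C) (S' × C) ℂ) : Prop :=
  K.IsHermitian ∧ IsState τ ∧
    IsCovariant (jointHamiltonian H K) (jointHamiltonian H' K) Φ ∧
    reducedSnd (Φ (ρ ⊗ₖ τ)) = τ ∧
    traceNorm (Φ (ρ ⊗ₖ τ) - σ ⊗ₖ τ) < ε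

/-- `ρ` can be transformed into `σ` by covariant operations and approximate catalysis, with
finite-dimensional catalysts that may depend on the accuracy `ε`. -/
def ApproxCatalytic (H : Matrix S S ℂ) (H' : Matrix S' S' ℂ) (ρ : Matrix S S ℂ)
    (σ : Matrix S' S' ℂ) : Prop :=
  ∀ ε : ℝ, 0 < ε → ∃ (d : ℕ) (K τ : Matrix (Fin d) (Fin d) ℂ)
    (Φ : Matrix (S × Fin d) (S × Fin d) ℂ →ₗ[ℂ] Matrix (S' × Fin d) (S' × Fin d) ℂ),
    CatalyticConversion H H' ρ σ ε K τ Φ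

/-- The same, with catalyst Hamiltonians whose operator norms are bounded uniformly in `ε`. -/
def BoundedApproxCatalytic (H : Matrix S S ℂ) (H' : Matrix S' S' ℂ) (ρ : Matrix S S ℂ)
    (σ : Matrix S' S' ℂ) : Prop :=
  ∃ M : ℝ, ∀ ε : ℝ, 0 < ε → ∃ (d : ℕ) (K τ : Matrix (Fin d) (Fin d) ℂ)
    (Φ : Matrix (S × Fin d) (S × Fin d) ℂ →ₗ[ℂ] Matrix (S' × Fin d) (S' × Fin d) ℂ),
    CatalyticConversion H H' ρ σ ε K τ Φ ∧ opNorm K < M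

/-- Every way to transform `ρ` into `σ` by approximate catalysis needs catalyst Hamiltonians of
unbounded operator norm: for each `M`, every catalyst that achieves a sufficiently
small error has a Hamiltonian of norm at least `M`. -/
def RequiresUnboundedCatalyst (H : Matrix S S ℂ) (H' : Matrix S' S' ℂ) (ρ : Matrix S S ℂ)
    (σ : Matrix S' S' ℂ) : Prop :=
  ∀ M : ℝ, ∃ ε₀ : ℝ, 0 < ε₀ ∧ ∀ ε : ℝ, ε ≤ ε₀ →
    ∀ (d : ℕ) (K τ : Matrix (Fin d) (Fin d) ℂ)
      (Φ : Matrix (S × Fin d) (S × Fin d) ℂ →ₗ[ℂ] Matrix (S' × Fin d) (S' × Fin d) ℂ),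
      CatalyticConversion H H' ρ σ ε K τ Φ → M ≤ opNorm K

/-- The quantum Fisher information
`2 ∑ₖₗ (λₖ - λₗ)² / (λₖ + λₗ) |⟨ψₖ|H|ψₗ⟩|²` of a Hermitian matrix `ρ` with orthonormal eigenbasis
`ψ` and eigenvalues `λ`. Terms with `λₖ = λₗ = 0` contribute zero
(and the value is set to `0` if `ρ` is not Hermitian). -/
def qfi (ρ H : Matrix S S ℂ) : ℝ :=
  open scoped Classical in
  if hρ : ρ.IsHermitian then
    2 * ∑ k, ∑ l, (hρ.eigenvalues k - hρ.eigenvalues l) ^ 2 /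
        (hρ.eigenvalues k + hρ.eigenvalues l) *
      ‖star (WithLp.ofLp (hρ.eigenvectorBasis k)) ⬝ᵥ
        (H.mulVec (WithLp.ofLp (hρ.eigenvectorBasis l)))‖ ^ 2
  else 0

/-- The state `ρ ⊗ ⋯ ⊗ ρ` of `n` copies. -/
def copies (n : ℕ) (ρ : Matrix S S ℂ) : Matrix (Fin n → S) (Fin n → S) ℂ :=
  Matrix.of fun f g => ∏ k, ρ (f k) (g k)

/-- The Hamiltonian `∑ₖ 1 ⊗ ⋯ ⊗ H ⊗ ⋯ ⊗ 1` (`H` at position `k`) of `n` copies. -/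
def copiesHamiltonian (n : ℕ) (H : Matrix S S ℂ) : Matrix (Fin n → S) (Fin n → S) ℂ :=
  Matrix.of fun f g => ∑ k, if ∀ j, j ≠ k → f j = g j then H (f k) (g k) else 0

/-- The qubit Hamiltonian `E₀ |0⟩⟨0| + E₁ |1⟩⟨1|`. -/
def qubitHamiltonian (E₀ E₁ : ℝ) : Matrix (Fin 2) (Fin 2) ℂ :=
  Matrix.diagonal ![(E₀ : ℂ), (E₁ : ℂ)]

/-- The vector `|+⟩ = (|0⟩ + |1⟩) / √2`. -/
def plusVec : Fin 2 → ℂ :=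
  ![((1 / Real.sqrt 2 : ℝ) : ℂ), ((1 / Real.sqrt 2 : ℝ) : ℂ)]

/-- The state `|+⟩⟨+|`. -/
def plusState : Matrix (Fin 2) (Fin 2) ℂ :=
  Matrix.vecMulVec plusVec (star plusVec)

end Asymmetry

end

noncomputable section

namespace Asymmetry

open scoped Kronecker MatrixOrder ComplexOrder
open Matrix

set_option linter.unusedSectionVars false

/-! ### Symmetric logarithmic derivatives and the quantum Fisher information. -/

section Fisher

variable {S S' C : Type*} [Fintype S] [DecidableEq S] [Fintype S'] [DecidableEq S']
  [Fintype C] [DecidableEq C]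

/-! Write F for the quantum Fisher information. It is additive on product states (`qfi_kronecker`)
and does not increase under covariant operations (`IsCovariant.qfi_le`), so F(μ) ≤ F(ρ) + F(τ) for
the output μ of a catalytic conversion. If μ were exactly σ ⊗ τ, then F(σ) + F(τ) ≤ F(ρ) + F(τ), and
the finite F(τ) would cancel. For approximate conversions the point is continuity: the estimate must
not depend on the dimension of the catalyst, which is not bounded, but only on the norms of the
Hamiltonians. It comes from F(ρ) = min 4‖H√ρ - √ρ h‖² over Hermitian h (`qfi_le_frobenius`,
`exists_optimal_purification`). The optimal h has norm at most ‖H‖, so the h of one state is a good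
trial for a nearby one, and by Powers-Størmer nearby states have nearby square roots
(`qfi_le_of_traceNorm`). With bounded catalyst Hamiltonians the error vanishes in the limit, which
is claim 1; claim 2 is its contrapositive.

For the amplification of |+⟩, a closed chain of states τ₀ → τ₁ → ⋯ → τ₀ is turned into a catalyst:
the uniform mixture of the τᵢ with a label of zero energy returns exactly after one controlled step,
and the error is the mean error of the chain (`exists_catalyticConversion_of_cycle`). The chain
stores N incoming copies of |+⟩ (`collectStep`), uses them as a phase reference to prepare M groups
of n qubits (`prepareStep`), and hands these out one by one (`emitStep`), ending in the empty
memory. The first N + 1 steps may be useless. A handed-out group is close to n perfect copies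
because the binomial amplitudes of the reference hardly change under a shift by at most n, with an
error that depends on N and n but not on M. Hence N is taken large for accuracy, and then M large to
dilute the useless steps. The Fisher information of n copies is n(E₁ - E₀)², so claim 2 applies to n
≥ 2. -/

/-- Spectral data of a positive semidefinite matrix, with the quantum Fisher information. -/
theorem exists_spectral_qfi {ρ : Matrix S S ℂ} (hρ : ρ.PosSemidef) :
    ∃ (U : Matrix S S ℂ) (l : S → ℝ), Uᴴ * U = 1 ∧ U * Uᴴ = 1 ∧ (∀ k, 0 ≤ l k) ∧
      ρ = U * diagonal (fun k => (l k : ℂ)) * Uᴴ ∧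
      ∀ H : Matrix S S ℂ, qfi ρ H = 2 * ∑ i, ∑ j, (l i - l j) ^ 2 / (l i + l j) *
        ‖(Uᴴ * H * U) i j‖ ^ 2 := by
  classical
  refine ⟨hρ.1.eigenvectorUnitary, hρ.1.eigenvalues, ?_, ?_, hρ.eigenvalues_nonneg, ?_, ?_⟩
  · exact Unitary.coe_star_mul_self hρ.1.eigenvectorUnitary
  · exact Unitary.coe_mul_star_self hρ.1.eigenvectorUnitary
  · exact hρ.1.spectral_theorem
  · intro H
    rw [qfi, dif_pos hρ.1]
    congr 1
    refine Finset.sum_congr rfl fun i _ => Finset.sum_congr rfl fun j _ => ?_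
    congr 3
    rw [Matrix.mul_assoc, Matrix.mul_apply]
    simp only [dotProduct, conjTranspose_apply, mul_apply, mulVec, Pi.star_apply,
      IsHermitian.eigenvectorUnitary_apply]

/-- The derivative `-i [H, ρ]` of the orbit of `ρ` under the time evolution. -/
def orbitDeriv (H ρ : Matrix S S ℂ) : Matrix S S ℂ :=
  (-Complex.I) • (H * ρ - ρ * H)

/-- Symmetric logarithmic derivatives of the orbit of `ρ` generated by `H`. -/
structure IsSLD (ρ H L : Matrix S S ℂ) : Prop where
  isHermitian : L.IsHermitian
  eq : ρ * L + L * ρ = (2 : ℂ) • orbitDeriv H ρ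

theorem trace_conj_unitary {U : Matrix S S ℂ} (hU : Uᴴ * U = 1) (X : Matrix S S ℂ) :
    (U * X * Uᴴ).trace = X.trace := by
  rw [Matrix.trace_mul_comm, ← Matrix.mul_assoc, hU, Matrix.one_mul]

theorem conj_unitary_mul {U : Matrix S S ℂ} (hU : Uᴴ * U = 1) (X Y : Matrix S S ℂ) :
    (U * X * Uᴴ) * (U * Y * Uᴴ) = U * (X * Y) * Uᴴ := by
  have : (U * X * Uᴴ) * (U * Y * Uᴴ) = U * X * (Uᴴ * U) * Y * Uᴴ := by
    simp only [Matrix.mul_assoc]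
  rw [this, hU, Matrix.mul_one]
  simp only [Matrix.mul_assoc]

theorem conj_unitary_conj {U : Matrix S S ℂ} (hU : U * Uᴴ = 1) (X : Matrix S S ℂ) :
    U * (Uᴴ * X * U) * Uᴴ = X := by
  have : U * (Uᴴ * X * U) * Uᴴ = (U * Uᴴ) * X * (U * Uᴴ) := by
    simp only [Matrix.mul_assoc]
  rw [this, hU, Matrix.mul_one, Matrix.one_mul]

theorem isHermitian_conj {X : Matrix S S ℂ} (hX : X.IsHermitian) (U : Matrix S S ℂ) :
    (U * X * Uᴴ).IsHermitian :=
  isHermitian_mul_mul_conjTranspose U hX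

theorem exists_isSLD {ρ H : Matrix S S ℂ} (hρ : ρ.PosSemidef) (hH : H.IsHermitian) :
    ∃ L, IsSLD ρ H L ∧ (ρ * (L * L)).trace = (qfi ρ H : ℂ) := by
  obtain ⟨U, l, hU, hU', hl, rfl, hq⟩ := exists_spectral_qfi hρ
  set G := Uᴴ * H * U with hG
  have hGh : G.IsHermitian := isHermitian_conjTranspose_mul_mul U hH
  have hHG : H = U * G * Uᴴ := (conj_unitary_conj hU' H).symm
  have hGs : ∀ i j, star (G j i) = G i j := fun i j => hGh.apply i j
  have hl0 : ∀ i j, (l i + l j = 0) → l i = 0 ∧ l j = 0 := fun i j h =>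
    ⟨by linarith [hl i, hl j], by linarith [hl i, hl j]⟩
  -- The equation for L is solved entrywise in the eigenbasis of the state. If l i + l j = 0, the
  -- quotient is 0 by convention; both eigenvalues then vanish, and so does the right side of the
  -- equation.
  let L : Matrix S S ℂ := Matrix.of fun i j =>
    -(2 * Complex.I) * (((l j - l i) / (l i + l j) : ℝ) : ℂ) * G i j
  have hL : L.IsHermitian := by
    ext i j
    simp only [L, conjTranspose_apply, of_apply, star_mul', star_neg, hGs]
    simp only [RCLike.star_def, Complex.conj_I, Complex.conj_ofReal, map_ofNat]
    rw [add_comm (l j), ← neg_sub (l j), neg_div]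
    push_cast
    ring
  refine ⟨U * L * Uᴴ, ⟨isHermitian_conj hL U, ?_⟩, ?_⟩
  · rw [conj_unitary_mul hU, conj_unitary_mul hU, ← Matrix.add_mul, ← Matrix.mul_add,
      orbitDeriv, hHG, conj_unitary_mul hU, conj_unitary_mul hU, ← Matrix.sub_mul,
      ← Matrix.mul_sub, smul_smul, ← Matrix.smul_mul, ← Matrix.mul_smul]
    congr 2
    ext i j
    simp only [Matrix.add_apply, diagonal_mul, mul_diagonal, L, of_apply, Matrix.smul_apply,
      Matrix.sub_apply,
      smul_eq_mul]
    by_cases h : l i + l j = 0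
    · obtain ⟨h1, h2⟩ := hl0 i j h
      simp [h1, h2]
    · have h' : (l i : ℂ) + l j ≠ 0 := by exact_mod_cast h
      push_cast
      field_simp
      ring
  · rw [conj_unitary_mul hU, conj_unitary_mul hU, trace_conj_unitary hU, hq]
    have key : (diagonal (fun k => (l k : ℂ)) * (L * L)).trace =
        ((∑ i, ∑ j, l i * (4 * ((l j - l i) / (l i + l j)) ^ 2 * ‖G i j‖ ^ 2) : ℝ) : ℂ) := by
      simp only [Matrix.trace, diag_apply, diagonal_mul, mul_apply (M := L)]
      push_cast
      refine Finset.sum_congr rfl fun i _ => ?_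
      rw [Finset.mul_sum]
      refine Finset.sum_congr rfl fun j _ => ?_
      congr 1
      rw [← hL.apply j i, RCLike.star_def, Complex.mul_conj, Complex.normSq_eq_norm_sq]
      simp only [L, of_apply, norm_mul, norm_neg, Complex.norm_I, Complex.norm_real,
        Complex.norm_two, Real.norm_eq_abs]
      push_cast
      rw [mul_pow, mul_pow, ← Complex.ofReal_pow |(l j - l i) / (l i + l j)|, sq_abs]
      push_cast
      ring
    rw [key]
    norm_cast
    -- Exchanging i and j allows the weight l i to be replaced by (l i + l j) / 2, which cancels one
    -- denominator.
    have sym : ∑ i, ∑ j, l i * (4 * ((l j - l i) / (l i + l j)) ^ 2 * ‖G i j‖ ^ 2) =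
        ∑ i, ∑ j, l j * (4 * ((l j - l i) / (l i + l j)) ^ 2 * ‖G i j‖ ^ 2) := by
      rw [Finset.sum_comm]
      refine Finset.sum_congr rfl fun i _ => Finset.sum_congr rfl fun j _ => ?_
      rw [← hGs j i, norm_star, add_comm (l j), ← neg_sub (l j), neg_div]
      ring
    have two : ∀ a b : ℝ, a = b → a = (a + b) / 2 := by intros; linarith
    rw [two _ _ sym, ← Finset.sum_add_distrib, div_eq_inv_mul, Finset.mul_sum, Finset.mul_sum]
    refine Finset.sum_congr rfl fun i _ => ?_
    rw [← Finset.sum_add_distrib, Finset.mul_sum, Finset.mul_sum]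
    refine Finset.sum_congr rfl fun j _ => ?_
    by_cases h : l i + l j = 0
    · obtain ⟨h1, h2⟩ := hl0 i j h
      simp [h1, h2]
    · field_simp
      ring

end Fisher

/-! ### Monotonicity under covariant operations, and additivity. -/

section Monotonicity

variable {S S' C : Type*} [Fintype S] [DecidableEq S] [Fintype S'] [DecidableEq S']
  [Fintype C] [DecidableEq C]

/-- This is Tr (Y - X) ρ (Y - X) ≥ 0, expanded so that the cross term contains the anticommutator
fixed by the SLD equation. -/
theorem trace_sld_quadratic_nonneg {ρ X Y : Matrix S S ℂ} (hρ : ρ.PosSemidef)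
    (hX : X.IsHermitian) (hY : Y.IsHermitian) :
    0 ≤ (ρ * (Y * Y)).trace - ((ρ * Y + Y * ρ) * X).trace + (ρ * (X * X)).trace := by
  have h := (hρ.mul_mul_conjTranspose_same (Y - X)).trace_nonneg
  rw [(hY.sub hX).eq] at h
  have h1 : (Y * ρ * Y).trace = (ρ * (Y * Y)).trace := by
    rw [Matrix.mul_assoc, Matrix.trace_mul_comm, Matrix.mul_assoc]
  have h2 : (X * ρ * X).trace = (ρ * (X * X)).trace := by
    rw [Matrix.mul_assoc, Matrix.trace_mul_comm, Matrix.mul_assoc]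
  have h3 : (X * ρ * Y).trace = (ρ * Y * X).trace := by
    rw [Matrix.mul_assoc, Matrix.trace_mul_comm]
  have : ((Y - X) * ρ * (Y - X)).trace =
      (ρ * (Y * Y)).trace - ((ρ * Y + Y * ρ) * X).trace + (ρ * (X * X)).trace := by
    simp only [Matrix.sub_mul, Matrix.mul_sub, Matrix.add_mul, trace_sub, trace_add, h1, h2, h3]
    ring
  rwa [this] at h

theorem trace_anticommutator_mul (ρ L : Matrix S S ℂ) :
    ((ρ * L + L * ρ) * L).trace = 2 * (ρ * (L * L)).trace := by
  rw [Matrix.add_mul, trace_add, Matrix.mul_assoc, Matrix.mul_assoc, Matrix.trace_mul_comm L,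
    Matrix.mul_assoc]
  ring

/-- SLDs are not unique when ρ has a kernel. Two of them share the anticommutator with ρ, so the
quadratic inequality, used in both orders, forces equal second moments. Any convenient SLD may
therefore be used to compute `qfi`. -/
theorem IsSLD.trace_eq_qfi {ρ H L : Matrix S S ℂ} (hρ : ρ.PosSemidef) (hH : H.IsHermitian)
    (hL : IsSLD ρ H L) : (ρ * (L * L)).trace = (qfi ρ H : ℂ) := by
  obtain ⟨L₀, hL₀, h₀⟩ := exists_isSLD hρ hH
  have h1 := trace_sld_quadratic_nonneg hρ hL₀.isHermitian hL.isHermitian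
  have h2 := trace_sld_quadratic_nonneg hρ hL.isHermitian hL₀.isHermitian
  rw [hL.eq, ← hL₀.eq, trace_anticommutator_mul] at h1
  rw [hL₀.eq, ← hL.eq, trace_anticommutator_mul] at h2
  rw [← h₀]
  apply le_antisymm
  · rw [← sub_nonneg]; convert h2 using 1; ring
  · rw [← sub_nonneg]; convert h1 using 1; ring

theorem IsChannel.posSemidef {Φ : Matrix S S ℂ →ₗ[ℂ] Matrix S' S' ℂ} (hΦ : IsChannel Φ)
    {ρ : Matrix S S ℂ} (hρ : ρ.PosSemidef) : (Φ ρ).PosSemidef := by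
  have h := hΦ.1 1 (ρ.submatrix Prod.fst Prod.fst) (hρ.submatrix _)
  exact h.submatrix (fun s => (s, (0 : Fin 1)))

theorem IsChannel.isState {Φ : Matrix S S ℂ →ₗ[ℂ] Matrix S' S' ℂ} (hΦ : IsChannel Φ)
    {ρ : Matrix S S ℂ} (hρ : IsState ρ) : IsState (Φ ρ) :=
  ⟨hΦ.posSemidef hρ.1, by rw [hΦ.2, hρ.2]⟩

/-- A Schwarz-type inequality for completely positive trace-preserving maps. -/
theorem IsChannel.trace_schwarz {Φ : Matrix S S ℂ →ₗ[ℂ] Matrix S' S' ℂ} (hΦ : IsChannel Φ)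
    {ρ L : Matrix S S ℂ} {X : Matrix S' S' ℂ} (hρ : ρ.PosSemidef) (hL : L.IsHermitian)
    (hX : X.IsHermitian) :
    (Φ (ρ * L + L * ρ) * X).trace ≤ (ρ * (L * L)).trace + (Φ ρ * (X * X)).trace := by
  -- The block matrix with entries V a ρ (V b)ᴴ is positive, hence so is its image under Φ ⊗ id on a
  -- qubit. Compressing that image by the row (1, -X) and taking the trace gives the claim.
  let V : Fin 2 → Matrix S S ℂ := ![L, 1]
  let Y : Matrix (S × Fin 2) S ℂ := Matrix.of fun p s => V p.2 p.1 s
  have hpos := hΦ.1 2 (Y * ρ * Yᴴ) (hρ.mul_mul_conjTranspose_same Y)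
  have hent : ∀ a b, (Matrix.of fun i j => (Y * ρ * Yᴴ) (i, a) (j, b)) = V a * ρ * (V b)ᴴ := by
    intro a b
    ext i j
    simp [mul_apply, Y]
  have hblock := hpos.submatrix (Sum.elim (fun s => (s, (0 : Fin 2))) fun s => (s, (1 : Fin 2)))
  have hsub : (ampliation Φ 2 (Y * ρ * Yᴴ)).submatrix
      (Sum.elim (fun s => (s, (0 : Fin 2))) fun s => (s, (1 : Fin 2)))
      (Sum.elim (fun s => (s, (0 : Fin 2))) fun s => (s, (1 : Fin 2))) =
      fromBlocks (Φ (L * ρ * L)) (Φ (L * ρ)) (Φ (ρ * L)) (Φ ρ) := by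
    ext (i | i) (j | j) <;> simp [ampliation, hent, V, hL.eq]
  rw [hsub] at hblock
  have h := (hblock.mul_mul_conjTranspose_same (fromCols 1 (-X))).trace_nonneg
  rw [fromCols_mul_fromBlocks, conjTranspose_fromCols_eq_fromRows_conjTranspose,
    fromCols_mul_fromRows] at h
  simp only [conjTranspose_one, conjTranspose_neg, hX.eq, Matrix.one_mul, Matrix.mul_one,
    Matrix.neg_mul, Matrix.mul_neg, Matrix.add_mul, trace_add, trace_neg, hΦ.2] at h
  have h1 : (X * Φ ρ * X).trace = (Φ ρ * (X * X)).trace := by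
    rw [Matrix.mul_assoc, Matrix.trace_mul_comm, Matrix.mul_assoc]
  have h2 : (L * ρ * L).trace = (ρ * (L * L)).trace := by
    rw [Matrix.mul_assoc, Matrix.trace_mul_comm, Matrix.mul_assoc]
  rw [h1, h2, Matrix.trace_mul_comm X] at h
  rw [← sub_nonneg, map_add, Matrix.add_mul, trace_add]
  convert h using 1
  ring

section Derivative

attribute [local instance] Matrix.linftyOpNormedRing Matrix.linftyOpNormedAlgebra

theorem hasDerivAt_evolution (H X : Matrix S S ℂ) :
    HasDerivAt (fun t : ℝ => evolution H t * X * evolution H (-t)) (orbitDeriv H X) 0 := by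
  have h1 : HasDerivAt (fun t : ℝ => evolution H t) ((-Complex.I) • H) 0 := by
    have := hasDerivAt_exp_smul_const (𝕂 := ℝ) ((-Complex.I) • H) (0 : ℝ)
    simp only [zero_smul, NormedSpace.exp_zero, one_mul] at this
    convert! this using 2 with t
    rw [evolution]
    congr 1
    ext i j
    simp
    ring
  have h2 : HasDerivAt (fun t : ℝ => evolution H (-t)) (-((-Complex.I) • H)) 0 := by
    have h := (neg_zero (G := ℝ)).symm ▸ h1
    have := HasDerivAt.scomp (0 : ℝ) h (hasDerivAt_neg (0 : ℝ))
    rwa [neg_one_smul] at this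
  have e0 : evolution H 0 = 1 := by simp [evolution]
  have := (h1.mul_const X).mul h2
  convert! this using 1
  simp only [neg_zero, e0, orbitDeriv]
  simp [sub_eq_add_neg]

/-- Covariance differentiated at t = 0. -/
theorem IsCovariant.map_orbitDeriv {H : Matrix S S ℂ} {H' : Matrix S' S' ℂ}
    {Φ : Matrix S S ℂ →ₗ[ℂ] Matrix S' S' ℂ} (hΦ : IsCovariant H H' Φ) (X : Matrix S S ℂ) :
    Φ (orbitDeriv H X) = orbitDeriv H' (Φ X) := by
  have h1 := hasDerivAt_evolution H' (Φ X)
  have h2 := ((LinearMap.toContinuousLinearMap Φ).restrictScalars ℝ).hasFDerivAt.comp_hasDerivAt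
    (0 : ℝ) (hasDerivAt_evolution H X)
  refine (h2.unique ?_)
  convert! h1 using 1
  funext t
  exact (hΦ.2 X t).symm

end Derivative

/-- The quantum Fisher information does not increase under covariant operations. -/
theorem IsCovariant.qfi_le {H : Matrix S S ℂ} {H' : Matrix S' S' ℂ}
    {Φ : Matrix S S ℂ →ₗ[ℂ] Matrix S' S' ℂ} (hΦ : IsCovariant H H' Φ) (hH : H.IsHermitian)
    (hH' : H'.IsHermitian) {ρ : Matrix S S ℂ} (hρ : ρ.PosSemidef) :
    qfi (Φ ρ) H' ≤ qfi ρ H := by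
  obtain ⟨L, hL, hLq⟩ := exists_isSLD hρ hH
  obtain ⟨X, hX, hXq⟩ := exists_isSLD (hΦ.1.posSemidef hρ) hH'
  -- With both SLDs inserted, the left side becomes 2 F(Φ ρ) and the right side F(ρ) + F(Φ ρ).
  have h := hΦ.1.trace_schwarz hρ hL.isHermitian hX.isHermitian
  rw [hL.eq, map_smul, hΦ.map_orbitDeriv, ← hX.eq, trace_anticommutator_mul, hLq, hXq] at h
  have h' : 2 * qfi (Φ ρ) H' ≤ qfi ρ H + qfi (Φ ρ) H' := by exact_mod_cast h
  linarith

theorem isHermitian_jointHamiltonian {H : Matrix S S ℂ} {K : Matrix C C ℂ} (hH : H.IsHermitian)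
    (hK : K.IsHermitian) : (jointHamiltonian H K).IsHermitian := by
  rw [IsHermitian, jointHamiltonian, conjTranspose_add, conjTranspose_kronecker,
    conjTranspose_kronecker, hH.eq, hK.eq, conjTranspose_one, conjTranspose_one]

theorem trace_mul_sld {ρ H L : Matrix S S ℂ} (hL : IsSLD ρ H L) : (ρ * L).trace = 0 := by
  have h := congrArg trace hL.eq
  rw [trace_add, Matrix.trace_mul_comm L, orbitDeriv, trace_smul, trace_smul, trace_sub,
    Matrix.trace_mul_comm H, sub_self, smul_zero, smul_zero, ← two_mul] at h
  simpa using h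

theorem IsState.kronecker {ρ : Matrix S S ℂ} {τ : Matrix C C ℂ} (hρ : IsState ρ)
    (hτ : IsState τ) : IsState (ρ ⊗ₖ τ) :=
  ⟨hρ.1.kronecker hτ.1, by rw [trace_kronecker, hρ.2, hτ.2, one_mul]⟩

/-- The quantum Fisher information is additive. -/
theorem qfi_kronecker {ρ H : Matrix S S ℂ} {τ K : Matrix C C ℂ} (hρ : IsState ρ)
    (hτ : IsState τ) (hH : H.IsHermitian) (hK : K.IsHermitian) :
    qfi (ρ ⊗ₖ τ) (jointHamiltonian H K) = qfi ρ H + qfi τ K := by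
  obtain ⟨L, hL, hLq⟩ := exists_isSLD hρ.1 hH
  obtain ⟨X, hX, hXq⟩ := exists_isSLD hτ.1 hK
  -- L ⊗ 1 + 1 ⊗ X is an SLD of the product state. In its second moment the cross terms are products
  -- of the first moments Tr ρL and Tr τX, which vanish.
  have hs : IsSLD (ρ ⊗ₖ τ) (jointHamiltonian H K) (jointHamiltonian L X) := by
    refine ⟨isHermitian_jointHamiltonian hL.isHermitian hX.isHermitian, ?_⟩
    have : (ρ ⊗ₖ τ) * jointHamiltonian L X + jointHamiltonian L X * (ρ ⊗ₖ τ) =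
        (ρ * L + L * ρ) ⊗ₖ τ + ρ ⊗ₖ (τ * X + X * τ) := by
      simp only [jointHamiltonian, Matrix.mul_add, Matrix.add_mul, ← mul_kronecker_mul,
        Matrix.mul_one, Matrix.one_mul, add_kronecker, kronecker_add]
      abel
    rw [this, hL.eq, hX.eq]
    simp only [orbitDeriv, jointHamiltonian, Matrix.mul_add, Matrix.add_mul,
      ← mul_kronecker_mul, Matrix.mul_one, Matrix.one_mul, smul_kronecker, kronecker_smul,
      sub_eq_add_neg, smul_add, add_kronecker, kronecker_add, neg_add]
    have hn : (-(ρ * H)) ⊗ₖ τ = -((ρ * H) ⊗ₖ τ) := by ext; simp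
    have hn' : ρ ⊗ₖ (-(τ * K)) = -(ρ ⊗ₖ (τ * K)) := by ext; simp
    rw [hn, hn']
    abel
  have h := hs.trace_eq_qfi (hρ.kronecker hτ).1 (isHermitian_jointHamiltonian hH hK)
  have : ((ρ ⊗ₖ τ) * (jointHamiltonian L X * jointHamiltonian L X)).trace =
      (qfi ρ H : ℂ) + qfi τ K := by
    simp only [jointHamiltonian, Matrix.mul_add, Matrix.add_mul, ← mul_kronecker_mul,
      Matrix.mul_one, Matrix.one_mul, trace_add, trace_kronecker, hLq, hXq, hρ.2, hτ.2,
      trace_mul_sld hL, trace_mul_sld hX]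
    ring
  rw [this] at h
  exact_mod_cast h.symm

end Monotonicity

/-! ### A variational formula for the Fisher information in the Frobenius norm. -/

section Continuity

variable {S S' C : Type*} [Fintype S] [DecidableEq S] [Fintype S'] [DecidableEq S']
  [Fintype C] [DecidableEq C]

attribute [local instance] Matrix.frobeniusNormedAddCommGroup Matrix.frobeniusNormedSpace

theorem frobenius_norm_sq (A : Matrix S S' ℂ) : ‖A‖ ^ 2 = ∑ i, ∑ j, ‖A i j‖ ^ 2 := by
  rw [frobenius_norm_def, ← Real.sqrt_eq_rpow, Real.sq_sqrt]
  · simp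
  · positivity

theorem frobenius_norm_sq' (A : Matrix S S' ℂ) : ‖A‖ ^ 2 = ∑ j, ∑ i, ‖A i j‖ ^ 2 := by
  rw [frobenius_norm_sq, Finset.sum_comm]

theorem trace_conjTranspose_mul_self (A : Matrix S S' ℂ) :
    (Aᴴ * A).trace = ((‖A‖ ^ 2 : ℝ) : ℂ) := by
  rw [frobenius_norm_sq, Finset.sum_comm]
  simp only [Matrix.trace, diag_apply, mul_apply, conjTranspose_apply]
  push_cast
  refine Finset.sum_congr rfl fun i _ => Finset.sum_congr rfl fun j _ => ?_
  rw [RCLike.star_def, mul_comm, Complex.mul_conj, Complex.normSq_eq_norm_sq]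
  push_cast
  rfl

theorem opNorm_nonneg (A : Matrix S S ℂ) : 0 ≤ opNorm A := norm_nonneg _

theorem norm_mulVec_le (A : Matrix S S ℂ) (v : S → ℂ) :
    ‖WithLp.toLp 2 (A *ᵥ v)‖ ≤ opNorm A * ‖WithLp.toLp 2 v‖ := by
  have := (Matrix.toEuclideanCLM (n := S) (𝕜 := ℂ) A).le_opNorm (WithLp.toLp 2 v)
  rwa [Matrix.toEuclideanCLM_toLp] at this

theorem sum_norm_mulVec_sq_le (A : Matrix S S ℂ) (v : S → ℂ) :
    ∑ i, ‖(A *ᵥ v) i‖ ^ 2 ≤ opNorm A ^ 2 * ∑ i, ‖v i‖ ^ 2 := by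
  have := pow_le_pow_left₀ (norm_nonneg _) (norm_mulVec_le A v) 2
  rwa [mul_pow, EuclideanSpace.norm_sq_eq, EuclideanSpace.norm_sq_eq] at this

theorem norm_star_dotProduct_mulVec_le (A : Matrix S S ℂ) (v : S → ℂ) :
    ‖star v ⬝ᵥ (A *ᵥ v)‖ ≤ opNorm A * ∑ i, ‖v i‖ ^ 2 := by
  have h := norm_inner_le_norm (𝕜 := ℂ) (WithLp.toLp 2 v) (WithLp.toLp 2 (A *ᵥ v))
  rw [EuclideanSpace.inner_eq_star_dotProduct, dotProduct_comm] at h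
  refine h.trans ?_
  calc _ ≤ ‖WithLp.toLp 2 v‖ * (opNorm A * ‖WithLp.toLp 2 v‖) := by
        gcongr; exact norm_mulVec_le A v
    _ = opNorm A * ‖WithLp.toLp 2 v‖ ^ 2 := by ring
    _ = _ := by rw [EuclideanSpace.norm_sq_eq]

theorem opNorm_le_of_forall {A : Matrix S S ℂ} {c : ℝ} (hc : 0 ≤ c)
    (h : ∀ v : S → ℂ, ∑ i, ‖(A *ᵥ v) i‖ ^ 2 ≤ c ^ 2 * ∑ i, ‖v i‖ ^ 2) : opNorm A ≤ c := by
  refine ContinuousLinearMap.opNorm_le_bound _ hc fun v => ?_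
  refine le_of_sq_le_sq ?_ (mul_nonneg hc (norm_nonneg v))
  rw [mul_pow, EuclideanSpace.norm_sq_eq, EuclideanSpace.norm_sq_eq]
  exact h (WithLp.ofLp v)

theorem opNorm_kronecker_one_le (H : Matrix S S ℂ) :
    opNorm (H ⊗ₖ (1 : Matrix C C ℂ)) ≤ opNorm H := by
  refine opNorm_le_of_forall (opNorm_nonneg H) fun v => ?_
  rw [Fintype.sum_prod_type_right, Fintype.sum_prod_type_right, Finset.mul_sum]
  refine Finset.sum_le_sum fun c _ => ?_
  refine le_trans (le_of_eq ?_) (sum_norm_mulVec_sq_le H fun s => v (s, c))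
  refine Finset.sum_congr rfl fun s _ => ?_
  congr 2
  simp [mulVec, dotProduct, Fintype.sum_prod_type, one_apply]

theorem opNorm_one_kronecker_le (K : Matrix C C ℂ) :
    opNorm ((1 : Matrix S S ℂ) ⊗ₖ K) ≤ opNorm K := by
  refine opNorm_le_of_forall (opNorm_nonneg K) fun v => ?_
  rw [Fintype.sum_prod_type, Fintype.sum_prod_type, Finset.mul_sum]
  refine Finset.sum_le_sum fun s _ => ?_
  refine le_trans (le_of_eq ?_) (sum_norm_mulVec_sq_le K fun c => v (s, c))
  refine Finset.sum_congr rfl fun c _ => ?_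
  congr 2
  simp [mulVec, dotProduct, Fintype.sum_prod_type, one_apply]

theorem opNorm_jointHamiltonian_le (H : Matrix S S ℂ) (K : Matrix C C ℂ) :
    opNorm (jointHamiltonian H K) ≤ opNorm H + opNorm K := by
  refine le_trans ?_ (add_le_add (opNorm_kronecker_one_le (C := C) H)
    (opNorm_one_kronecker_le (S := S) K))
  rw [opNorm, jointHamiltonian, map_add]
  exact norm_add_le _ _

theorem frobenius_mul_le (A D : Matrix S S ℂ) : ‖A * D‖ ≤ opNorm A * ‖D‖ := by
  refine le_of_sq_le_sq ?_ (mul_nonneg (opNorm_nonneg A) (norm_nonneg D))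
  rw [mul_pow, frobenius_norm_sq', frobenius_norm_sq', Finset.mul_sum]
  exact Finset.sum_le_sum fun q _ => sum_norm_mulVec_sq_le A fun s => D s q

theorem frobenius_unitary_mul {W : Matrix S S ℂ} (hW : Wᴴ * W = 1) (D : Matrix S S ℂ) :
    ‖W * D‖ = ‖D‖ := by
  have : ((W * D)ᴴ * (W * D)).trace = (Dᴴ * D).trace := by
    rw [conjTranspose_mul, Matrix.mul_assoc, ← Matrix.mul_assoc Wᴴ, hW, Matrix.one_mul]
  rw [trace_conjTranspose_mul_self, trace_conjTranspose_mul_self] at this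
  have h : ‖W * D‖ ^ 2 = ‖D‖ ^ 2 := by exact_mod_cast this
  exact (pow_left_inj₀ (norm_nonneg _) (norm_nonneg _) two_ne_zero).1 h

theorem frobenius_mul_le_of_eigenvalues {h : Matrix S S ℂ} (hh : h.IsHermitian) {c : ℝ}
    (hc : 0 ≤ c) (hb : ∀ i, |hh.eigenvalues i| ≤ c) (D : Matrix S S ℂ) :
    ‖h * D‖ ≤ c * ‖D‖ := by
  let W : Matrix S S ℂ := hh.eigenvectorUnitary
  have hW : Wᴴ * W = 1 := Unitary.coe_star_mul_self hh.eigenvectorUnitary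
  have hW' : Wᴴᴴ * Wᴴ = 1 := by
    rw [conjTranspose_conjTranspose]; exact Unitary.coe_mul_star_self hh.eigenvectorUnitary
  have hd : h = W * diagonal (fun i => (hh.eigenvalues i : ℂ)) * Wᴴ := hh.spectral_theorem
  have e : h * D = W * (diagonal (fun i => (hh.eigenvalues i : ℂ)) * (Wᴴ * D)) := by
    conv_lhs => rw [hd]
    simp only [Matrix.mul_assoc]
  rw [e, frobenius_unitary_mul hW, ← frobenius_unitary_mul hW' D]
  refine le_of_sq_le_sq ?_ (mul_nonneg hc (norm_nonneg _))
  rw [mul_pow, frobenius_norm_sq, frobenius_norm_sq, Finset.mul_sum]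
  refine Finset.sum_le_sum fun i _ => ?_
  rw [Finset.mul_sum]
  refine Finset.sum_le_sum fun j _ => ?_
  rw [diagonal_mul, norm_mul, mul_pow, Complex.norm_real, Real.norm_eq_abs]
  gcongr
  exact hb i

/-- The solution `h = R Y R` of the Lyapunov equation `R² h + h R² = 2 R H R` has eigenvalues
bounded by the norm of `H`. -/
theorem abs_eigenvalues_le_of_lyapunov {R Y H h : Matrix S S ℂ} (hR : R.IsHermitian)
    (hh : h.IsHermitian) (hY : h = R * Y * R)
    (heq : R * R * h + h * (R * R) = (2 : ℂ) • (R * H * R)) (i : S) :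
    |hh.eigenvalues i| ≤ opNorm H := by
  set v : S → ℂ := WithLp.ofLp (hh.eigenvectorBasis i) with hv
  set m := hh.eigenvalues i
  have hmv : h *ᵥ v = (m : ℂ) • v := by
    have := hh.mulVec_eigenvectorBasis i
    simpa using this
  have hmv' : star v ᵥ* h = (m : ℂ) • star v := by
    have := congrArg star hmv
    rw [star_mulVec, hh.eq] at this
    rw [this]
    ext; simp
  have hs : star v ⬝ᵥ ((R * R) *ᵥ v) = ((∑ i, ‖(R *ᵥ v) i‖ ^ 2 : ℝ) : ℂ) := by
    rw [← mulVec_mulVec, dotProduct_mulVec]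
    have : star v ᵥ* R = star (R *ᵥ v) := by rw [star_mulVec, hR.eq]
    rw [this]
    simp only [dotProduct, Pi.star_apply]
    push_cast
    refine Finset.sum_congr rfl fun j _ => ?_
    rw [RCLike.star_def, mul_comm, Complex.mul_conj, Complex.normSq_eq_norm_sq]
    push_cast
    rfl
  set s : ℝ := ∑ i, ‖(R *ᵥ v) i‖ ^ 2
  have hs0 : 0 ≤ s := by positivity
  -- The expectation of the Lyapunov equation in an eigenvector v reads m ‖R v‖² = ⟨R v, H R v⟩,
  -- which bounds |m| by the norm of H whenever R v ≠ 0.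
  have key : star v ⬝ᵥ ((R * R * h + h * (R * R)) *ᵥ v) = 2 * m * s := by
    rw [add_mulVec, dotProduct_add, ← mulVec_mulVec, hmv, mulVec_smul, dotProduct_smul,
      ← mulVec_mulVec (M := h), dotProduct_mulVec (A := h), hmv', smul_dotProduct, hs]
    simp only [smul_eq_mul]
    ring
  have key2 : star v ⬝ᵥ (((2 : ℂ) • (R * H * R)) *ᵥ v) =
      2 * (star (R *ᵥ v) ⬝ᵥ (H *ᵥ (R *ᵥ v))) := by
    rw [smul_mulVec, dotProduct_smul, smul_eq_mul, Matrix.mul_assoc, ← mulVec_mulVec,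
      dotProduct_mulVec, star_mulVec, hR.eq, ← mulVec_mulVec]
  rw [heq, key2] at key
  have hnorm := norm_star_dotProduct_mulVec_le H (R *ᵥ v)
  have hn2 := congrArg norm key
  simp only [norm_mul, Complex.norm_two, Complex.norm_real, Real.norm_eq_abs,
    abs_of_nonneg hs0] at hn2
  have hle : |m| * s ≤ opNorm H * s := by
    change _ ≤ opNorm H * s at hnorm
    linarith
  rcases hs0.lt_or_eq with hpos | hzero
  · exact le_of_mul_le_mul_right hle hpos
  -- Here the equation says nothing about m; the form h = R Y R gives h v = 0, hence m = 0.
  · have hRv : R *ᵥ v = 0 := by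
      ext j
      have := (Finset.sum_eq_zero_iff_of_nonneg (fun i _ => by positivity)).1 hzero.symm j
        (Finset.mem_univ j)
      simpa using this
    have h0 : (m : ℂ) • v = 0 := by
      rw [← hmv, hY, ← mulVec_mulVec, hRv, mulVec_zero]
    have hv0 : v ≠ 0 := by
      intro h
      apply hh.eigenvectorBasis.toBasis.ne_zero i
      ext j
      simpa [hv] using congrFun h j
    have : m = 0 := by
      rcases smul_eq_zero.1 h0 with h | h
      · exact_mod_cast h
      · exact absurd h hv0
    rw [this, abs_zero]
    exact opNorm_nonneg H

/-- Every Hermitian `h` on the purifying system gives an upper bound on the quantum Fisher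
information. -/
theorem qfi_le_frobenius {ρ H R h : Matrix S S ℂ} (hρ : ρ.PosSemidef) (hH : H.IsHermitian)
    (hR : R.IsHermitian) (hRR : R * R = ρ) (hh : h.IsHermitian) :
    qfi ρ H ≤ 4 * ‖H * R - R * h‖ ^ 2 := by
  obtain ⟨L, hL, hLq⟩ := exists_isSLD hρ hH
  set A := H * R - R * h with hA
  have hAh : Aᴴ = R * H - h * R := by
    rw [hA, conjTranspose_sub, conjTranspose_mul, conjTranspose_mul, hH.eq, hR.eq, hh.eq]
  -- The choice of h drops out: A R - R Aᴴ = Hρ - ρH, as the two terms R h R cancel.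
  have hF : (qfi ρ H : ℂ) = -Complex.I * (((L * R)ᴴ * A).trace - (Aᴴ * (L * R)).trace) := by
    have h1 := trace_anticommutator_mul ρ L
    rw [hL.eq, hLq, smul_mul, trace_smul, smul_eq_mul] at h1
    have h2 : (orbitDeriv H ρ * L).trace = qfi ρ H := mul_left_cancel₀ two_ne_zero h1
    rw [← h2, orbitDeriv, smul_mul, trace_smul, smul_eq_mul]
    congr 1
    have e1 : ((L * R)ᴴ * A).trace = (A * R * L).trace := by
      rw [conjTranspose_mul, hR.eq, hL.isHermitian.eq, Matrix.trace_mul_comm, Matrix.mul_assoc]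
    have e2 : (Aᴴ * (L * R)).trace = (R * Aᴴ * L).trace := by
      rw [← Matrix.mul_assoc, Matrix.trace_mul_comm, Matrix.mul_assoc]
    rw [e1, e2, ← trace_sub, ← Matrix.sub_mul, hAh, hA, ← hRR]
    congr 2
    simp only [Matrix.sub_mul, Matrix.mul_sub, Matrix.mul_assoc]
    abel
  have hB : ((L * R)ᴴ * (L * R)).trace = (qfi ρ H : ℂ) := by
    rw [conjTranspose_mul, hR.eq, hL.isHermitian.eq, Matrix.mul_assoc, Matrix.trace_mul_comm,
      ← hLq, ← hRR, Matrix.trace_mul_comm (R * R)]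
    simp only [Matrix.mul_assoc]
  -- Cauchy-Schwarz as a square: ‖L R‖² equals F, and the factor 2i makes the cross terms equal to
  -- -2F, so the square is 4‖A‖² - F.
  have hZ := (posSemidef_conjTranspose_mul_self (L * R + (2 * Complex.I) • A)).trace_nonneg
  have hZe : ((L * R + (2 * Complex.I) • A)ᴴ * (L * R + (2 * Complex.I) • A)).trace =
      ((4 * ‖A‖ ^ 2 - qfi ρ H : ℝ) : ℂ) := by
    have hc : (star (2 * Complex.I) : ℂ) = -(2 * Complex.I) := by simp
    rw [conjTranspose_add, conjTranspose_smul, hc]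
    simp only [Matrix.add_mul, Matrix.mul_add, Matrix.smul_mul, Matrix.mul_smul, trace_add,
      trace_smul, smul_eq_mul, hB, trace_conjTranspose_mul_self A]
    have hx : ((L * R)ᴴ * A).trace - (Aᴴ * (L * R)).trace = Complex.I * qfi ρ H := by
      linear_combination (-Complex.I) * hF +
        (((L * R)ᴴ * A).trace - (Aᴴ * (L * R)).trace) * Complex.I_sq
    rw [sub_eq_iff_eq_add.1 hx]
    push_cast
    linear_combination (2 * (qfi ρ H : ℂ) - 4 * (‖A‖ : ℂ) ^ 2) * Complex.I_sq
  rw [hZe] at hZ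
  have : 0 ≤ 4 * ‖A‖ ^ 2 - qfi ρ H := by exact_mod_cast hZ
  linarith

/-- The optimal choice of `h` in `qfi_le_frobenius` is a contraction of `H`. -/
theorem exists_optimal_purification {ρ H : Matrix S S ℂ} (hρ : ρ.PosSemidef)
    (hH : H.IsHermitian) :
    ∃ R h : Matrix S S ℂ, R.PosSemidef ∧ R * R = ρ ∧ h.IsHermitian ∧
      (∀ D : Matrix S S ℂ, ‖h * D‖ ≤ opNorm H * ‖D‖) ∧ 4 * ‖H * R - R * h‖ ^ 2 = qfi ρ H := by
  obtain ⟨U, l, hU, hU', hl, rfl, hq⟩ := exists_spectral_qfi hρ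
  set G := Uᴴ * H * U with hG
  have hGh : G.IsHermitian := isHermitian_conjTranspose_mul_mul U hH
  have hHG : H = U * G * Uᴴ := (conj_unitary_conj hU' H).symm
  have hGs : ∀ i j, star (G j i) = G i j := fun i j => hGh.apply i j
  have hl0 : ∀ i j, (l i + l j = 0) → l i = 0 ∧ l j = 0 := fun i j h =>
    ⟨by linarith [hl i, hl j], by linarith [hl i, hl j]⟩
  let d : Matrix S S ℂ := diagonal fun i => ((√(l i) : ℝ) : ℂ)
  -- In the eigenbasis the minimizer has entries 2√(l i)√(l j) / (l i + l j) · G i j. The square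
  -- roots are split off because the eigenvalue bound needs the form R Y R.
  let Y : Matrix S S ℂ := Matrix.of fun i j => ((2 / (l i + l j) : ℝ) : ℂ) * G i j
  have hd : d.PosSemidef := PosSemidef.diagonal fun i => by
    simp
  have hdd : d * d = diagonal fun i => (l i : ℂ) := by
    rw [diagonal_mul_diagonal]
    congr 1
    funext i
    rw [← Complex.ofReal_mul, Real.mul_self_sqrt (hl i)]
  have hYh : Y.IsHermitian := by
    ext i j
    simp only [Y, conjTranspose_apply, of_apply, star_mul', hGs]
    rw [RCLike.star_def, Complex.conj_ofReal, add_comm]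
  have hdY : (d * Y * d).IsHermitian := by
    have := isHermitian_conj hYh d
    rwa [hd.1.eq] at this
  have hent : ∀ i j, (d * Y * d) i j = ((√(l i) * √(l j) * (2 / (l i + l j)) : ℝ) : ℂ) * G i j := by
    intro i j
    simp only [d, Y, mul_diagonal, diagonal_mul, of_apply]
    push_cast
    ring
  have hR : (U * d * Uᴴ).PosSemidef := hd.mul_mul_conjTranspose_same U
  have hh : (U * (d * Y * d) * Uᴴ).IsHermitian := isHermitian_conj hdY U
  refine ⟨U * d * Uᴴ, U * (d * Y * d) * Uᴴ, hR, ?_, hh, ?_, ?_⟩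
  · rw [conj_unitary_mul hU, hdd]
  · refine frobenius_mul_le_of_eigenvalues hh (opNorm_nonneg H)
      (abs_eigenvalues_le_of_lyapunov hR.1 hh (Y := U * Y * Uᴴ) ?_ ?_)
    · rw [conj_unitary_mul hU, conj_unitary_mul hU]
    · rw [hHG]
      simp only [conj_unitary_mul hU]
      rw [← Matrix.add_mul, ← Matrix.mul_add, ← Matrix.smul_mul, ← Matrix.mul_smul]
      congr 2
      ext i j
      rw [hdd, Matrix.add_apply, diagonal_mul _ (d * Y * d), mul_diagonal _ (d * Y * d), hent,
        Matrix.smul_apply, mul_diagonal, diagonal_mul]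
      by_cases h : l i + l j = 0
      · obtain ⟨h1, h2⟩ := hl0 i j h
        simp [h1, h2]
      · have h' : (l i : ℂ) + l j ≠ 0 := by exact_mod_cast h
        push_cast
        field_simp
        rw [smul_eq_mul]
        ring
  · have e : H * (U * d * Uᴴ) - U * d * Uᴴ * (U * (d * Y * d) * Uᴴ) =
        U * ((G * d - d * (d * Y * d)) * Uᴴ) := by
      rw [hHG, conj_unitary_mul hU, conj_unitary_mul hU, ← Matrix.sub_mul, ← Matrix.mul_sub,
        Matrix.mul_assoc]
    have hU'' : Uᴴᴴ * Uᴴ = 1 := by rwa [conjTranspose_conjTranspose]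
    rw [e, frobenius_unitary_mul hU, ← frobenius_norm_conjTranspose, conjTranspose_mul,
      conjTranspose_conjTranspose, frobenius_unitary_mul hU, frobenius_norm_conjTranspose,
      frobenius_norm_sq, hq]
    have entry : ∀ i j, ‖(G * d - d * (d * Y * d)) i j‖ ^ 2 =
        l j * ((l j - l i) / (l i + l j)) ^ 2 * ‖G i j‖ ^ 2 := by
      intro i j
      have : (G * d - d * (d * Y * d)) i j =
          ((√(l j) * ((l j - l i) / (l i + l j)) : ℝ) : ℂ) * G i j := by
        rw [Matrix.sub_apply, diagonal_mul, hent, mul_diagonal]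
        by_cases h : l i + l j = 0
        · obtain ⟨h1, h2⟩ := hl0 i j h
          simp [h1, h2]
        · have h' : (l i : ℂ) + l j ≠ 0 := by exact_mod_cast h
          have hsq : ((√(l i) : ℝ) : ℂ) ^ 2 = l i := by
            rw [← Complex.ofReal_pow, Real.sq_sqrt (hl i)]
          push_cast
          field_simp
          rw [hsq]
          ring
      rw [this, norm_mul, mul_pow, Complex.norm_real, Real.norm_eq_abs, sq_abs, mul_pow,
        Real.sq_sqrt (hl j)]
    simp only [entry]
    have sym : ∑ i, ∑ j, l j * ((l j - l i) / (l i + l j)) ^ 2 * ‖G i j‖ ^ 2 =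
        ∑ i, ∑ j, l i * ((l j - l i) / (l i + l j)) ^ 2 * ‖G i j‖ ^ 2 := by
      rw [Finset.sum_comm]
      refine Finset.sum_congr rfl fun i _ => Finset.sum_congr rfl fun j _ => ?_
      rw [← hGs j i, norm_star, add_comm (l j), ← neg_sub (l j), neg_div]
      ring
    have two : ∀ a b : ℝ, a = b → a = (a + b) / 2 := by intros; linarith
    rw [two _ _ sym, ← Finset.sum_add_distrib, div_eq_inv_mul, Finset.mul_sum, Finset.mul_sum,
      Finset.mul_sum]
    refine Finset.sum_congr rfl fun i _ => ?_
    rw [← Finset.sum_add_distrib, Finset.mul_sum, Finset.mul_sum, Finset.mul_sum]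
    refine Finset.sum_congr rfl fun j _ => ?_
    by_cases h : l i + l j = 0
    · obtain ⟨h1, h2⟩ := hl0 i j h
      simp [h1, h2]
    · field_simp
      ring

end Continuity

/-! ### Powers-Størmer, dimension-free continuity, and the bound for catalytic conversions. -/

section TraceNorm

variable {S S' C : Type*} [Fintype S] [DecidableEq S] [Fintype S'] [DecidableEq S']
  [Fintype C] [DecidableEq C]

theorem re_diag_nonneg {X : Matrix S S ℂ} (hX : X.PosSemidef) (i : S) : 0 ≤ (X i i).re :=
  (Complex.le_def.1 (hX.diag_nonneg (i := i))).1

theorem exists_unitary_diagonal {M : Matrix S S ℂ} (hM : M.IsHermitian) :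
    ∃ (W : Matrix S S ℂ) (m : S → ℝ), Wᴴ * W = 1 ∧ W * Wᴴ = 1 ∧
      M = W * diagonal (fun i => (m i : ℂ)) * Wᴴ :=
  ⟨hM.eigenvectorUnitary, hM.eigenvalues, Unitary.coe_star_mul_self hM.eigenvectorUnitary,
    Unitary.coe_mul_star_self hM.eigenvectorUnitary, hM.spectral_theorem⟩

theorem conj_eq_of_eq_conj {W X M : Matrix S S ℂ} (hW : Wᴴ * W = 1) (h : M = W * X * Wᴴ) :
    Wᴴ * M * W = X := by
  have h' : Wᴴ * (W * X * Wᴴ) * W = (Wᴴ * W) * X * (Wᴴ * W) := by simp only [Matrix.mul_assoc]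
  rw [h, h', hW, Matrix.one_mul, Matrix.mul_one]

theorem traceNorm_eq_sum_abs {M W : Matrix S S ℂ} {m : S → ℝ} (hW : Wᴴ * W = 1)
    (hM : M = W * diagonal (fun i => (m i : ℂ)) * Wᴴ) : traceNorm M = ∑ i, |m i| := by
  have hA : (W * diagonal (fun i => ((|m i| : ℝ) : ℂ)) * Wᴴ).PosSemidef :=
    (PosSemidef.diagonal fun i => by simp).mul_mul_conjTranspose_same W
  have hsq : (W * diagonal (fun i => ((|m i| : ℝ) : ℂ)) * Wᴴ) *
      (W * diagonal (fun i => ((|m i| : ℝ) : ℂ)) * Wᴴ) = Mᴴ * M := by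
    have hMh : Mᴴ = M := by
      rw [hM]
      refine isHermitian_conj ?_ W
      ext i j
      by_cases h : i = j
      · subst h; simp
      · simp [h, Ne.symm h]
    rw [hMh, hM, conj_unitary_mul hW, conj_unitary_mul hW, diagonal_mul_diagonal,
      diagonal_mul_diagonal]
    congr 3
    funext i
    norm_cast
    exact abs_mul_abs_self (m i)
  rw [traceNorm, CFC.sqrt_unique hsq (nonneg_iff_posSemidef.2 hA), trace_conj_unitary hW,
    trace_diagonal]
  simp

theorem traceNorm_sub_le {P Q : Matrix S S ℂ} (hP : P.PosSemidef) (hQ : Q.PosSemidef) :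
    traceNorm (P - Q) ≤ P.trace.re + Q.trace.re := by
  obtain ⟨W, m, hW, hW', hM⟩ := exists_unitary_diagonal (hP.1.sub hQ.1)
  rw [traceNorm_eq_sum_abs hW hM]
  have hd := conj_eq_of_eq_conj hW hM
  have tr : ∀ X : Matrix S S ℂ, X.trace = (Wᴴ * X * W).trace := fun X => by
    rw [Matrix.trace_mul_comm, ← Matrix.mul_assoc, hW', Matrix.one_mul]
  rw [tr P, tr Q, Matrix.trace, Matrix.trace, Complex.re_sum, Complex.re_sum,
    ← Finset.sum_add_distrib]
  refine Finset.sum_le_sum fun i _ => ?_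
  have hPi := re_diag_nonneg (hP.conjTranspose_mul_mul_same W) i
  have hQi := re_diag_nonneg (hQ.conjTranspose_mul_mul_same W) i
  have hi := congrArg Complex.re (congrFun (congrFun hd i) i)
  rw [Matrix.mul_sub, Matrix.sub_mul, Matrix.sub_apply, diagonal_apply_eq, Complex.sub_re,
    Complex.ofReal_re] at hi
  simp only [diag_apply]
  rw [← hi, abs_le]
  constructor <;> linarith

/-- Since |M| ± M ≥ 0, the diagonal of |M| dominates that of M in absolute value, in every
orthonormal basis. -/
theorem sum_norm_diag_le_traceNorm {M W : Matrix S S ℂ} (hM : M.IsHermitian)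
    (hW' : W * Wᴴ = 1) : ∑ i, ‖(Wᴴ * M * W) i i‖ ≤ traceNorm M := by
  have hsa : IsSelfAdjoint M := hM
  have h1 : (CFC.abs M - M).PosSemidef := by
    rw [← nonneg_iff_posSemidef, CFC.abs_sub_self M]
    exact smul_nonneg zero_le_two (CFC.negPart_nonneg M)
  have h2 : (CFC.abs M + M).PosSemidef := by
    rw [← nonneg_iff_posSemidef, CFC.abs_add_self M]
    exact smul_nonneg zero_le_two (CFC.posPart_nonneg M)
  have ht : traceNorm M = ((Wᴴ * CFC.abs M * W).trace).re := by
    rw [Matrix.trace_mul_comm, ← Matrix.mul_assoc, hW', Matrix.one_mul]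
    rfl
  rw [ht, Matrix.trace, Complex.re_sum]
  refine Finset.sum_le_sum fun i _ => ?_
  have h1i := re_diag_nonneg (h1.conjTranspose_mul_mul_same W) i
  have h2i := re_diag_nonneg (h2.conjTranspose_mul_mul_same W) i
  rw [Matrix.mul_sub, Matrix.sub_mul, Matrix.sub_apply, Complex.sub_re] at h1i
  rw [Matrix.mul_add, Matrix.add_mul, Matrix.add_apply, Complex.add_re] at h2i
  have hre : (((Wᴴ * M * W) i i).re : ℂ) = (Wᴴ * M * W) i i := by
    have := (isHermitian_conjTranspose_mul_mul W hM).apply i i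
    exact Complex.conj_eq_iff_re.1 this
  rw [← hre, Complex.norm_real, Real.norm_eq_abs, abs_le, diag_apply]
  constructor <;> linarith

attribute [local instance] Matrix.frobeniusNormedAddCommGroup Matrix.frobeniusNormedSpace

/-- The Powers-Størmer inequality. -/
theorem frobenius_sub_sq_le_traceNorm {A B : Matrix S S ℂ} (hA : A.PosSemidef)
    (hB : B.PosSemidef) : ‖A - B‖ ^ 2 ≤ traceNorm (A * A - B * B) := by
  obtain ⟨W, δ, hW, hW', hM⟩ := exists_unitary_diagonal (hA.1.sub hB.1)
  have hd := conj_eq_of_eq_conj hW hM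
  have hherm : (A * A - B * B).IsHermitian := by
    have h := (posSemidef_self_mul_conjTranspose A).1.sub (posSemidef_self_mul_conjTranspose B).1
    rwa [hA.1.eq, hB.1.eq] at h
  refine le_trans ?_ (sum_norm_diag_le_traceNorm hherm hW')
  have hnorm : ‖A - B‖ ^ 2 = ∑ i, δ i ^ 2 := by
    have h := trace_conjTranspose_mul_self (A - B)
    rw [(hA.1.sub hB.1).eq, hM, conj_unitary_mul hW, trace_conj_unitary hW,
      diagonal_mul_diagonal, trace_diagonal] at h
    rw [hM]
    have h' : ∑ i, δ i * δ i = ‖W * diagonal (fun i => (δ i : ℂ)) * Wᴴ‖ ^ 2 := by exact_mod_cast h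
    rw [← h']
    exact Finset.sum_congr rfl fun i _ => (sq (δ i)).symm
  rw [hnorm]
  refine Finset.sum_le_sum fun i _ => ?_
  set A' := Wᴴ * A * W with hA'
  set B' := Wᴴ * B * W with hB'
  have hcong : ∀ X Y : Matrix S S ℂ, Wᴴ * (X * Y) * W = (Wᴴ * X * W) * (Wᴴ * Y * W) := by
    intro X Y
    have : (Wᴴ * X * W) * (Wᴴ * Y * W) = Wᴴ * X * (W * Wᴴ) * Y * W := by
      simp only [Matrix.mul_assoc]
    rw [this, hW', Matrix.mul_one]
    simp only [Matrix.mul_assoc]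
  have hAB : A' = B' + diagonal (fun i => (δ i : ℂ)) := by
    rw [← hd, Matrix.mul_sub, Matrix.sub_mul]; abel
  -- In the eigenbasis of A - B, positivity gives A' i i + B' i i ≥ |A' i i - B' i i| = |δ i|, so
  -- the i-th diagonal entry of A² - B² has modulus at least δ i ².
  have hentry : (Wᴴ * (A * A - B * B) * W) i i = δ i * (A' i i + B' i i) := by
    rw [Matrix.mul_sub, Matrix.sub_mul, hcong, hcong, ← hA', ← hB', hAB]
    simp only [Matrix.add_mul, Matrix.mul_add, Matrix.add_apply, Matrix.sub_apply, diagonal_mul,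
      mul_diagonal, diagonal_apply_eq]
    ring
  have hPi := re_diag_nonneg (hA.conjTranspose_mul_mul_same W) i
  have hQi := re_diag_nonneg (hB.conjTranspose_mul_mul_same W) i
  rw [← hA'] at hPi
  rw [← hB'] at hQi
  have hi := congrArg Complex.re (congrFun (congrFun hAB i) i)
  rw [Matrix.add_apply, diagonal_apply_eq, Complex.add_re, Complex.ofReal_re] at hi
  rw [hentry, norm_mul, Complex.norm_real, Real.norm_eq_abs, ← sq_abs, sq]
  gcongr
  refine le_trans ?_ (Complex.re_le_norm _)
  rw [Complex.add_re, abs_le]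
  constructor <;> linarith

/-- Dimension-free continuity of the quantum Fisher information. -/
theorem qfi_le_of_traceNorm {H μ ω : Matrix S S ℂ} (hH : H.IsHermitian) (hμ : μ.PosSemidef)
    (hω : ω.PosSemidef) {c s F : ℝ} (hc : opNorm H ≤ c) (hs : 0 ≤ s)
    (hd : traceNorm (μ - ω) ≤ s ^ 2) (hF0 : 0 ≤ F) (hF : qfi μ H ≤ 4 * F ^ 2) :
    qfi ω H ≤ 4 * (F + 2 * c * s) ^ 2 := by
  have hc0 : 0 ≤ c := (opNorm_nonneg H).trans hc
  obtain ⟨R, h, hR, hRR, hh, hhb, hopt⟩ := exists_optimal_purification hμ hH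
  obtain ⟨R', -, hR', hRR', -⟩ := exists_optimal_purification hω hH
  -- The optimal h of μ serves as a trial for ω. Replacing R by R' costs one term with H and one
  -- with h, each at most c ‖R' - R‖.
  refine (qfi_le_frobenius hω hH hR'.1 hRR' hh).trans ?_
  have hΔ : ‖R' - R‖ ≤ s := by
    refine le_of_sq_le_sq ?_ hs
    rw [norm_sub_rev]
    refine (frobenius_sub_sq_le_traceNorm hR hR').trans ?_
    rwa [hRR, hRR']
  have h1 : ‖H * R - R * h‖ ≤ F := by
    refine le_of_sq_le_sq ?_ hF0
    linarith
  have h2 : ‖H * (R' - R)‖ ≤ c * s := (frobenius_mul_le H _).trans (by gcongr)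
  have h3 : ‖(R' - R) * h‖ ≤ c * s := by
    rw [← frobenius_norm_conjTranspose, conjTranspose_mul, hh.eq, (hR'.1.sub hR.1).eq]
    exact (hhb _).trans (by gcongr)
  have e : H * R' - R' * h = (H * R - R * h) + H * (R' - R) - (R' - R) * h := by
    rw [Matrix.mul_sub, Matrix.sub_mul]; abel
  have h4 : ‖H * R' - R' * h‖ ≤ F + 2 * c * s := by
    rw [e]
    refine (norm_sub_le _ _).trans ?_
    have := norm_add_le (H * R - R * h) (H * (R' - R))
    linarith
  gcongr

/-- The trial h = 0 suffices. This bounds the Fisher information of all admissible catalysts by the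
bound on their Hamiltonians. -/
theorem qfi_le_opNorm_sq {τ K : Matrix C C ℂ} (hτ : IsState τ) (hK : K.IsHermitian) :
    qfi τ K ≤ 4 * opNorm K ^ 2 := by
  obtain ⟨R, -, hR, hRR, -⟩ := exists_optimal_purification hτ.1 hK
  refine (qfi_le_frobenius hτ.1 hK hR.1 hRR (h := 0) (by simp [IsHermitian])).trans ?_
  have h1 : ‖R‖ ^ 2 = 1 := by
    have h := trace_conjTranspose_mul_self R
    rw [hR.1.eq, hRR, hτ.2] at h
    exact_mod_cast h.symm
  have h2 := pow_le_pow_left₀ (norm_nonneg _) (frobenius_mul_le K R) 2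
  rw [mul_pow, h1, mul_one] at h2
  rw [Matrix.mul_zero, sub_zero]
  gcongr

theorem qfi_nonneg {ρ H : Matrix S S ℂ} (hρ : ρ.PosSemidef) (hH : H.IsHermitian) :
    0 ≤ qfi ρ H := by
  obtain ⟨R, h, -, -, -, -, he⟩ := exists_optimal_purification hρ hH
  rw [← he]
  positivity

/-- The error is written s² because square roots of states move by at most s. With F(μ) = 4x² and c
= ‖H'‖ + M, continuity gives F(σ) + F(τ) ≤ 4(x + 2cs)², while monotonicity gives 4x² ≤ F(ρ) + F(τ).
The term F(τ) cancels from the leading order and survives only in the bound on x, where it is at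
most 4M². -/
theorem CatalyticConversion.qfi_le {H ρ : Matrix S S ℂ} {H' σ : Matrix S' S' ℂ}
    {K τ : Matrix C C ℂ} {Φ : Matrix (S × C) (S × C) ℂ →ₗ[ℂ] Matrix (S' × C) (S' × C) ℂ}
    {s M : ℝ} (hH : H.IsHermitian) (hH' : H'.IsHermitian) (hρ : IsState ρ) (hσ : IsState σ)
    (hs : 0 ≤ s) (h : CatalyticConversion H H' ρ σ (s ^ 2) K τ Φ) (hM : opNorm K ≤ M) :
    qfi σ H' ≤ qfi ρ H + 16 * (√(qfi ρ H / 4 + M ^ 2) * ((opNorm H' + M) * s) +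
      ((opNorm H' + M) * s) ^ 2) := by
  obtain ⟨hK, hτ, hΦ, -, herr⟩ := h
  have hM0 : 0 ≤ M := (opNorm_nonneg K).trans hM
  have hJ := isHermitian_jointHamiltonian hH hK
  have hJ' := isHermitian_jointHamiltonian hH' hK
  have hmono := hΦ.qfi_le hJ hJ' (hρ.kronecker hτ).1
  rw [qfi_kronecker hρ hτ hH hK] at hmono
  have hμ := (hΦ.1.isState (hρ.kronecker hτ)).1
  have hFμ : 0 ≤ qfi (Φ (ρ ⊗ₖ τ)) (jointHamiltonian H' K) := qfi_nonneg hμ hJ'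
  set x := √(qfi (Φ (ρ ⊗ₖ τ)) (jointHamiltonian H' K) / 4) with hx
  have hx2 : x ^ 2 = qfi (Φ (ρ ⊗ₖ τ)) (jointHamiltonian H' K) / 4 := Real.sq_sqrt (by linarith)
  have hc : opNorm (jointHamiltonian H' K) ≤ opNorm H' + M :=
    (opNorm_jointHamiltonian_le H' K).trans (by linarith)
  have hcont := qfi_le_of_traceNorm hJ' hμ (hσ.kronecker hτ).1 hc hs herr.le (F := x)
    (Real.sqrt_nonneg _) (by linarith)
  rw [qfi_kronecker hσ hτ hH' hK] at hcont
  have hτK := qfi_le_opNorm_sq hτ hK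
  have hKM : opNorm K ^ 2 ≤ M ^ 2 := pow_le_pow_left₀ (opNorm_nonneg K) hM 2
  have hxB : x ≤ √(qfi ρ H / 4 + M ^ 2) := Real.sqrt_le_sqrt (by linarith)
  have hcs : 0 ≤ (opNorm H' + M) * s := mul_nonneg (add_nonneg (opNorm_nonneg H') hM0) hs
  have hprod := mul_le_mul_of_nonneg_right hxB hcs
  nlinarith

/-- Bounded approximate catalysis does not increase the quantum Fisher information. -/
theorem BoundedApproxCatalytic.qfi_le {H ρ : Matrix S S ℂ} {H' σ : Matrix S' S' ℂ}
    (hH : H.IsHermitian) (hH' : H'.IsHermitian) (hρ : IsState ρ) (hσ : IsState σ)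
    (h : BoundedApproxCatalytic H H' ρ σ) : qfi σ H' ≤ qfi ρ H := by
  obtain ⟨M, hM⟩ := h
  have hbound : ∀ s : ℝ, 0 < s → qfi σ H' ≤ qfi ρ H +
      16 * (√(qfi ρ H / 4 + M ^ 2) * ((opNorm H' + M) * s) + ((opNorm H' + M) * s) ^ 2) := by
    intro s hs
    obtain ⟨d, K, τ, Φ, hconv, hK⟩ := hM (s ^ 2) (by positivity)
    exact hconv.qfi_le hH hH' hρ hσ hs.le hK.le
  have hlim : Filter.Tendsto (fun s : ℝ => qfi ρ H +
      16 * (√(qfi ρ H / 4 + M ^ 2) * ((opNorm H' + M) * s) + ((opNorm H' + M) * s) ^ 2))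
      (nhdsWithin 0 (Set.Ioi 0)) (nhds (qfi ρ H)) := by
    have hcont : Continuous fun s : ℝ => qfi ρ H +
      16 * (√(qfi ρ H / 4 + M ^ 2) * ((opNorm H' + M) * s) + ((opNorm H' + M) * s) ^ 2) := by
      fun_prop
    have := hcont.tendsto 0
    simp only [mul_zero, add_zero, ne_eq, OfNat.ofNat_ne_zero, not_false_eq_true, zero_pow] at this
    exact this.mono_left nhdsWithin_le_nhds
  exact ge_of_tendsto hlim (Filter.eventually_of_mem self_mem_nhdsWithin hbound)

theorem CatalyticConversion.mono {H ρ : Matrix S S ℂ} {H' σ : Matrix S' S' ℂ}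
    {K τ : Matrix C C ℂ} {Φ : Matrix (S × C) (S × C) ℂ →ₗ[ℂ] Matrix (S' × C) (S' × C) ℂ}
    {ε ε' : ℝ} (h : CatalyticConversion H H' ρ σ ε K τ Φ) (hε : ε ≤ ε') :
    CatalyticConversion H H' ρ σ ε' K τ Φ :=
  ⟨h.1, h.2.1, h.2.2.1, h.2.2.2.1, h.2.2.2.2.trans_le hε⟩

/-- Increasing the quantum Fisher information requires unbounded catalyst Hamiltonians. -/
theorem requiresUnboundedCatalyst_of_qfi_lt {H ρ : Matrix S S ℂ} {H' σ : Matrix S' S' ℂ}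
    (hH : H.IsHermitian) (hH' : H'.IsHermitian) (hρ : IsState ρ) (hσ : IsState σ)
    (h : qfi ρ H < qfi σ H') : RequiresUnboundedCatalyst H H' ρ σ := by
  intro M
  -- If M is a counterexample, arbitrarily small errors are reached with norms below M, which is
  -- bounded catalysis.
  by_contra! hcon
  refine absurd (BoundedApproxCatalytic.qfi_le hH hH' hρ hσ ⟨M, fun ε hε => ?_⟩) (not_le.2 h)
  obtain ⟨ε', hε', d, K, τ, Φ, hconv, hK⟩ := hcon ε hε
  exact ⟨d, K, τ, Φ, hconv.mono hε', hK⟩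

end TraceNorm

/-! ### Diagonal Hamiltonians and Kraus operators with definite energy shifts. -/

section Kraus

variable {S S' C D E : Type*} [Fintype S] [DecidableEq S] [Fintype S'] [DecidableEq S']
  [Fintype C] [DecidableEq C] [Fintype D] [DecidableEq D] [Fintype E] [DecidableEq E]

/-- The Hamiltonian with energy `h i` in the basis state `i`. -/
def energyMatrix (h : S → ℝ) : Matrix S S ℂ := diagonal fun i => (h i : ℂ)

theorem isHermitian_energyMatrix (h : S → ℝ) : (energyMatrix h).IsHermitian := by
  rw [energyMatrix, IsHermitian, diagonal_conjTranspose]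
  congr 1
  funext i
  simp

theorem jointHamiltonian_energyMatrix (h : S → ℝ) (k : C → ℝ) :
    jointHamiltonian (energyMatrix h) (energyMatrix k) =
      energyMatrix fun p : S × C => h p.1 + k p.2 := by
  ext ⟨s, c⟩ ⟨s', c'⟩
  by_cases h1 : s = s' <;> by_cases h2 : c = c' <;>
    simp [jointHamiltonian, energyMatrix, h1, h2, one_apply]

theorem evolution_energyMatrix (h : S → ℝ) (t : ℝ) :
    evolution (energyMatrix h) t =
      diagonal fun i => Complex.exp (-(Complex.I * t) * h i) := by
  rw [evolution, energyMatrix, ← diagonal_smul, Matrix.exp_diagonal]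
  congr 1
  funext i
  rw [Pi.coe_exp, Complex.exp_eq_exp_ℂ, Pi.smul_apply, smul_eq_mul]

theorem evolution_conj_apply (h : S → ℝ) (t : ℝ) (X : Matrix S S ℂ) (i j : S) :
    (evolution (energyMatrix h) t * X * evolution (energyMatrix h) (-t)) i j =
      Complex.exp (-(Complex.I * t) * (h i - h j)) * X i j := by
  rw [evolution_energyMatrix, evolution_energyMatrix, mul_diagonal, diagonal_mul, mul_sub,
    sub_eq_add_neg, Complex.exp_add]
  push_cast
  ring_nf

theorem mul_mul_conjTranspose_apply (A : Matrix S' S ℂ) (X : Matrix S S ℂ) (i j : S') :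
    (A * X * Aᴴ) i j = ∑ q', ∑ q, A i q * X q q' * star (A j q') := by
  simp only [mul_apply, conjTranspose_apply, Finset.sum_mul]

/-- The completely positive map with Kraus operators `K e`. -/
def krausMap (K : E → Matrix S' S ℂ) : Matrix S S ℂ →ₗ[ℂ] Matrix S' S' ℂ where
  toFun X := ∑ e, K e * X * (K e)ᴴ
  map_add' X Y := by simp only [Matrix.mul_add, Matrix.add_mul, Finset.sum_add_distrib]
  map_smul' c X := by
    simp only [Matrix.mul_smul, Matrix.smul_mul, Finset.smul_sum, RingHom.id_apply]

theorem krausMap_apply (K : E → Matrix S' S ℂ) (X : Matrix S S ℂ) :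
    krausMap K X = ∑ e, K e * X * (K e)ᴴ := rfl

theorem isChannel_krausMap {K : E → Matrix S' S ℂ} (hK : ∑ e, (K e)ᴴ * K e = 1) :
    IsChannel (krausMap K) := by
  constructor
  · intro k X hX
    have : ampliation (krausMap K) k X =
        ∑ e, (K e ⊗ₖ (1 : Matrix (Fin k) (Fin k) ℂ)) * X *
          (K e ⊗ₖ (1 : Matrix (Fin k) (Fin k) ℂ))ᴴ := by
      ext ⟨p, a⟩ ⟨q, b⟩
      simp only [ampliation, krausMap_apply, of_apply, Matrix.sum_apply]
      refine Finset.sum_congr rfl fun e _ => ?_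
      simp [mul_apply, Fintype.sum_prod_type, one_apply, apply_ite (starRingEnd ℂ)]
    rw [this]
    exact posSemidef_sum _ fun e _ => hX.mul_mul_conjTranspose_same _
  · intro X
    rw [krausMap_apply, trace_sum]
    have : ∀ e, (K e * X * (K e)ᴴ).trace = ((K e)ᴴ * K e * X).trace := fun e => by
      rw [Matrix.trace_mul_comm, Matrix.mul_assoc]
    simp only [this]
    rw [← trace_sum, ← Finset.sum_mul, hK, Matrix.one_mul]

/-- Kraus operators with definite energy shifts define a covariant operation. -/
theorem isCovariant_krausMap {h : S → ℝ} {h' : S' → ℝ} {K : E → Matrix S' S ℂ}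
    (hK : ∑ e, (K e)ᴴ * K e = 1)
    (hw : ∀ e, ∃ w : ℝ, ∀ p q, K e p q ≠ 0 → h' p + w = h q) :
    IsCovariant (energyMatrix h) (energyMatrix h') (krausMap K) := by
  refine ⟨isChannel_krausMap hK, fun X t => ?_⟩
  ext i j
  rw [evolution_conj_apply, krausMap_apply, krausMap_apply, Matrix.sum_apply, Matrix.sum_apply,
    Finset.mul_sum]
  refine Finset.sum_congr rfl fun e _ => ?_
  obtain ⟨w, hw⟩ := hw e
  rw [mul_mul_conjTranspose_apply, mul_mul_conjTranspose_apply, Finset.mul_sum]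
  simp only [Finset.mul_sum]
  refine Finset.sum_congr rfl fun q' _ => Finset.sum_congr rfl fun q _ => ?_
  rw [evolution_conj_apply]
  by_cases h1 : K e i q = 0
  · simp [h1]
  by_cases h2 : K e j q' = 0
  · simp [h2]
  have e1 := hw _ _ h1
  have e2 := hw _ _ h2
  -- The shift w is common to both indices of a Kraus operator, so it cancels and the phases on the
  -- two sides agree.
  have : (h' i : ℂ) - h' j = h q - h q' := by
    rw [← e1, ← e2]; push_cast; ring
  rw [this]
  ring

end Kraus

/-! ### Transport of catalysts from arbitrary finite index types to `Fin d`. -/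

section Reindex

variable {S S' C D : Type*} [Fintype S] [DecidableEq S] [Fintype S'] [DecidableEq S']
  [Fintype C] [DecidableEq C] [Fintype D] [DecidableEq D]

theorem traceNorm_submatrix (e : D ≃ C) (M : Matrix C C ℂ) :
    traceNorm (M.submatrix e e) = traceNorm M := by
  have hpos := (nonneg_iff_posSemidef.1 (CFC.sqrt_nonneg (Mᴴ * M))).submatrix e
  have hsq : (CFC.sqrt (Mᴴ * M)).submatrix e e * (CFC.sqrt (Mᴴ * M)).submatrix e e =
      (M.submatrix e e)ᴴ * M.submatrix e e := by
    rw [conjTranspose_submatrix, submatrix_mul_equiv, submatrix_mul_equiv,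
      CFC.sqrt_mul_sqrt_self _ (nonneg_iff_posSemidef.2 (posSemidef_conjTranspose_mul_self M))]
  rw [traceNorm, CFC.sqrt_unique hsq (nonneg_iff_posSemidef.2 hpos), traceNorm]
  congr 1
  exact e.sum_comp fun i => CFC.sqrt (Mᴴ * M) i i

/-- Catalytic conversions with diagonal catalyst Hamiltonians may be relabelled. -/
theorem CatalyticConversion.reindex {h : S → ℝ} {h' : S' → ℝ} {ρ : Matrix S S ℂ}
    {σ : Matrix S' S' ℂ} {ε : ℝ} {k : C → ℝ} {τ : Matrix C C ℂ}
    {Φ : Matrix (S × C) (S × C) ℂ →ₗ[ℂ] Matrix (S' × C) (S' × C) ℂ} (e : D ≃ C)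
    (hc : CatalyticConversion (energyMatrix h) (energyMatrix h') ρ σ ε (energyMatrix k) τ Φ) :
    ∃ (K' τ' : Matrix D D ℂ)
      (Φ' : Matrix (S × D) (S × D) ℂ →ₗ[ℂ] Matrix (S' × D) (S' × D) ℂ),
      CatalyticConversion (energyMatrix h) (energyMatrix h') ρ σ ε K' τ' Φ' := by
  obtain ⟨-, hτ, hΦ, hred, herr⟩ := hc
  let f : S × C ≃ S × D := (Equiv.refl S).prodCongr e.symm
  let g : S' × D ≃ S' × C := (Equiv.refl S').prodCongr e
  let Φ' : Matrix (S × D) (S × D) ℂ →ₗ[ℂ] Matrix (S' × D) (S' × D) ℂ :=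
    { toFun := fun X => (Φ (X.submatrix f f)).submatrix g g
      map_add' := fun X Y => by
        have : (X + Y).submatrix f f = X.submatrix f f + Y.submatrix f f := rfl
        rw [this, map_add]; rfl
      map_smul' := fun c X => by
        have : (c • X).submatrix f f = c • X.submatrix f f := rfl
        rw [this, map_smul]; rfl }
  have hprod : Φ' (ρ ⊗ₖ τ.submatrix e e) = (Φ (ρ ⊗ₖ τ)).submatrix g g := by
    change (Φ ((ρ ⊗ₖ τ.submatrix e e).submatrix f f)).submatrix g g = _
    congr 2
    ext ⟨s, c⟩ ⟨s', c'⟩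
    simp [f]
  refine ⟨energyMatrix fun d => k (e d), τ.submatrix e e, Φ', isHermitian_energyMatrix _,
    ⟨hτ.1.submatrix e, ?_⟩, ⟨⟨fun m X hX => ?_, fun X => ?_⟩, fun X t => ?_⟩, ?_, ?_⟩
  · rw [← hτ.2]; exact e.sum_comp fun i => τ i i
  · exact (hΦ.1.1 m (X.submatrix (fun p => (f p.1, p.2)) fun p => (f p.1, p.2))
      (hX.submatrix _)).submatrix fun p : (S' × D) × Fin m => (g p.1, p.2)
  · have h1 := hΦ.1.2 (X.submatrix f f)
    have h2 : (Φ' X).trace = (Φ (X.submatrix f f)).trace :=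
      g.sum_comp fun i => Φ (X.submatrix f f) i i
    rw [h2, h1]
    exact f.sum_comp fun i => X i i
  · rw [jointHamiltonian_energyMatrix, jointHamiltonian_energyMatrix]
    have hcov := hΦ.2 (X.submatrix f f) t
    rw [jointHamiltonian_energyMatrix, jointHamiltonian_energyMatrix] at hcov
    have hX : evolution (energyMatrix fun p : S × C => h p.1 + k p.2) t * X.submatrix f f *
        evolution (energyMatrix fun p : S × C => h p.1 + k p.2) (-t) =
        (evolution (energyMatrix fun p : S × D => h p.1 + k (e p.2)) t * X *
        evolution (energyMatrix fun p : S × D => h p.1 + k (e p.2)) (-t)).submatrix f f := by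
      ext i j
      rw [evolution_conj_apply, submatrix_apply, submatrix_apply, evolution_conj_apply]
      simp [f]
    rw [hX] at hcov
    ext i j
    have hij := congrFun (congrFun hcov (g i)) (g j)
    rw [evolution_conj_apply] at hij ⊢
    exact hij
  · rw [hprod]
    ext c c'
    exact congrFun (congrFun hred (e c)) (e c')
  · rw [hprod]
    have : (Φ (ρ ⊗ₖ τ)).submatrix g g - σ ⊗ₖ τ.submatrix e e =
        (Φ (ρ ⊗ₖ τ) - σ ⊗ₖ τ).submatrix g g := by
      ext ⟨s, c⟩ ⟨s', c'⟩
      simp [g]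
    rw [this, traceNorm_submatrix]
    exact herr

end Reindex

/-! ### A closed chain of state changes as a catalyst. -/

section Cycle

variable {S S' β ι : Type*} [Fintype S] [DecidableEq S] [Fintype S'] [DecidableEq S']
  [Fintype β] [DecidableEq β] [Fintype ι] [DecidableEq ι]

/-- A covariant operation takes `ρ ⊗ τ` to a state with reduced catalyst state `τ'` that differs
from `σ ⊗ τ'` by a difference of positive matrices of total trace at most `η`. -/
def CatalysisStep (h : S → ℝ) (h' : S' → ℝ) (k : β → ℝ) (ρ : Matrix S S ℂ) (σ : Matrix S' S' ℂ)
    (τ τ' : Matrix β β ℂ) (η : ℝ) : Prop :=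
  ∃ Φ : Matrix (S × β) (S × β) ℂ →ₗ[ℂ] Matrix (S' × β) (S' × β) ℂ,
    IsCovariant (energyMatrix fun p : S × β => h p.1 + k p.2)
      (energyMatrix fun p : S' × β => h' p.1 + k p.2) Φ ∧
    reducedSnd (Φ (ρ ⊗ₖ τ)) = τ' ∧
    ∃ P Q : Matrix (S' × β) (S' × β) ℂ, P.PosSemidef ∧ Q.PosSemidef ∧
      Φ (ρ ⊗ₖ τ) - σ ⊗ₖ τ' = P - Q ∧ P.trace.re + Q.trace.re ≤ η

theorem CatalysisStep.isState {h : S → ℝ} {h' : S' → ℝ} {k : β → ℝ} {ρ : Matrix S S ℂ}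
    {σ : Matrix S' S' ℂ} {τ τ' : Matrix β β ℂ} {η : ℝ} (hs : CatalysisStep h h' k ρ σ τ τ' η)
    (hρ : IsState ρ) (hτ : IsState τ) : IsState τ' := by
  obtain ⟨Φ, hΦ, rfl, -⟩ := hs
  have hμ := hΦ.1.isState (hρ.kronecker hτ)
  constructor
  · have : reducedSnd (Φ (ρ ⊗ₖ τ)) =
        ∑ s, (Φ (ρ ⊗ₖ τ)).submatrix (fun b => (s, b)) fun b => (s, b) := by
      ext b b'
      simp [reducedSnd, Matrix.sum_apply]
    rw [this]
    exact posSemidef_sum _ fun s _ => hμ.1.submatrix _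
  · rw [← hμ.2, Matrix.trace, Matrix.trace, Fintype.sum_prod_type, Finset.sum_comm]
    rfl

/-- The matrix on `P` that is `Y` on the block with label `i` and zero elsewhere. -/
def blockEmbed {P Q : Type*} (l : P → ι) (f : P → Q) (i : ι) (Y : Matrix Q Q ℂ) : Matrix P P ℂ :=
  Matrix.of fun p p' => if l p = i ∧ l p' = i then Y (f p) (f p') else 0

theorem blockEmbed_posSemidef {P Q : Type*} [Fintype P] [DecidableEq P] [Fintype Q] (l : P → ι)
    (f : P → Q) (i : ι) {Y : Matrix Q Q ℂ} (hY : Y.PosSemidef) :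
    (blockEmbed l f i Y).PosSemidef := by
  have h := (hY.submatrix f).mul_mul_conjTranspose_same
    (diagonal fun p => if l p = i then (1 : ℂ) else 0)
  convert h using 1
  ext p p'
  by_cases h1 : l p = i <;> by_cases h2 : l p' = i <;>
    simp [blockEmbed, h1, h2, diagonal_conjTranspose]

theorem trace_blockEmbed (T : Type*) [Fintype T] (i : ι) (Y : Matrix (T × β) (T × β) ℂ) :
    (blockEmbed (fun p : T × (ι × β) => p.2.1) (fun p => (p.1, p.2.2)) i Y).trace = Y.trace := by
  simp only [Matrix.trace, diag_apply, blockEmbed, of_apply, and_self, Fintype.sum_prod_type]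
  refine Finset.sum_congr rfl fun t _ => ?_
  rw [Finset.sum_comm]
  simp

/-- The block diagonal channel that applies `Φ i` in the block `i` and moves it to the block
`nxt i`. -/
def cycleMap (nxt : Equiv.Perm ι)
    (Φ : ι → Matrix (S × β) (S × β) ℂ →ₗ[ℂ] Matrix (S' × β) (S' × β) ℂ) :
    Matrix (S × (ι × β)) (S × (ι × β)) ℂ →ₗ[ℂ] Matrix (S' × (ι × β)) (S' × (ι × β)) ℂ where
  toFun X := ∑ i, blockEmbed (fun p : S' × (ι × β) => p.2.1) (fun p => (p.1, p.2.2)) (nxt i)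
    (Φ i (X.submatrix (fun p => (p.1, i, p.2)) fun p => (p.1, i, p.2)))
  map_add' X Y := by
    rw [← Finset.sum_add_distrib]
    refine Finset.sum_congr rfl fun i _ => ?_
    rw [submatrix_add, Pi.add_apply, Pi.add_apply, map_add]
    ext p q
    simp only [blockEmbed, of_apply, Matrix.add_apply]
    split_ifs <;> simp
  map_smul' c X := by
    rw [RingHom.id_apply, Finset.smul_sum]
    refine Finset.sum_congr rfl fun i _ => ?_
    rw [submatrix_smul, Pi.smul_apply, Pi.smul_apply, map_smul]
    ext p q
    simp only [blockEmbed, of_apply, Matrix.smul_apply]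
    split_ifs <;> simp

theorem cycleMap_apply (nxt : Equiv.Perm ι)
    (Φ : ι → Matrix (S × β) (S × β) ℂ →ₗ[ℂ] Matrix (S' × β) (S' × β) ℂ)
    (X : Matrix (S × (ι × β)) (S × (ι × β)) ℂ) :
    cycleMap nxt Φ X =
      ∑ i, blockEmbed (fun p : S' × (ι × β) => p.2.1) (fun p => (p.1, p.2.2)) (nxt i)
        (Φ i (X.submatrix (fun p => (p.1, i, p.2)) fun p => (p.1, i, p.2))) := rfl

theorem isChannel_cycleMap (nxt : Equiv.Perm ι)
    {Φ : ι → Matrix (S × β) (S × β) ℂ →ₗ[ℂ] Matrix (S' × β) (S' × β) ℂ}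
    (hΦ : ∀ i, IsChannel (Φ i)) : IsChannel (cycleMap nxt Φ) := by
  constructor
  · intro m X hX
    have : ampliation (cycleMap nxt Φ) m X =
        ∑ i, blockEmbed (fun p : (S' × (ι × β)) × Fin m => p.1.2.1)
          (fun p => ((p.1.1, p.1.2.2), p.2)) (nxt i)
          (ampliation (Φ i) m (X.submatrix (fun p => ((p.1.1, i, p.1.2), p.2))
            fun p => ((p.1.1, i, p.1.2), p.2))) := by
      ext p q
      simp only [ampliation, cycleMap_apply, of_apply, Matrix.sum_apply, blockEmbed]
      rfl
    rw [this]
    exact posSemidef_sum _ fun i _ =>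
      blockEmbed_posSemidef _ _ _ ((hΦ i).1 m _ (hX.submatrix _))
  · intro X
    rw [cycleMap_apply, trace_sum]
    simp only [trace_blockEmbed, (hΦ _).2]
    simp only [Matrix.trace, diag_apply, submatrix_apply, Fintype.sum_prod_type]
    rw [Finset.sum_comm]

theorem isCovariant_cycleMap (nxt : Equiv.Perm ι) {h : S → ℝ} {h' : S' → ℝ} {k : β → ℝ}
    {Φ : ι → Matrix (S × β) (S × β) ℂ →ₗ[ℂ] Matrix (S' × β) (S' × β) ℂ}
    (hΦ : ∀ i, IsCovariant (energyMatrix fun p : S × β => h p.1 + k p.2)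
      (energyMatrix fun p : S' × β => h' p.1 + k p.2) (Φ i)) :
    IsCovariant (energyMatrix fun p : S × (ι × β) => h p.1 + k p.2.2)
      (energyMatrix fun p : S' × (ι × β) => h' p.1 + k p.2.2) (cycleMap nxt Φ) := by
  refine ⟨isChannel_cycleMap nxt fun i => (hΦ i).1, fun X t => ?_⟩
  ext p q
  rw [evolution_conj_apply, cycleMap_apply, cycleMap_apply, Matrix.sum_apply, Matrix.sum_apply,
    Finset.mul_sum]
  refine Finset.sum_congr rfl fun i _ => ?_
  simp only [blockEmbed, of_apply]
  split_ifs
  · have hX : (evolution (energyMatrix fun p : S × (ι × β) => h p.1 + k p.2.2) t * X *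
        evolution (energyMatrix fun p : S × (ι × β) => h p.1 + k p.2.2) (-t)).submatrix
          (fun p : S × β => (p.1, i, p.2)) (fun p => (p.1, i, p.2)) =
        evolution (energyMatrix fun p : S × β => h p.1 + k p.2) t *
          X.submatrix (fun p : S × β => (p.1, i, p.2)) (fun p => (p.1, i, p.2)) *
          evolution (energyMatrix fun p : S × β => h p.1 + k p.2) (-t) := by
      ext a b
      rw [evolution_conj_apply, submatrix_apply, submatrix_apply, evolution_conj_apply]
    rw [hX, ← (hΦ i).2, evolution_conj_apply]
  · simp

/-- A cyclic sequence of catalysis steps with small mean error is a catalytic conversion. -/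
theorem exists_catalyticConversion_of_cycle [Nonempty ι] (nxt : Equiv.Perm ι) {h : S → ℝ}
    {h' : S' → ℝ} {k : β → ℝ} {ρ : Matrix S S ℂ} {σ : Matrix S' S' ℂ}
    {τ : ι → Matrix β β ℂ} {η : ι → ℝ} {ε : ℝ} (hτ : ∀ i, IsState (τ i))
    (hstep : ∀ i, CatalysisStep h h' k ρ σ (τ i) (τ (nxt i)) (η i))
    (hε : ∑ i, η i < ε * Fintype.card ι) :
    ∃ (τt : Matrix (ι × β) (ι × β) ℂ)
      (Φ : Matrix (S × (ι × β)) (S × (ι × β)) ℂ →ₗ[ℂ] Matrix (S' × (ι × β)) (S' × (ι × β)) ℂ),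
      CatalyticConversion (energyMatrix h) (energyMatrix h') ρ σ ε
        (energyMatrix fun c : ι × β => k c.2) τt Φ := by
  choose Φ hΦ hred P Q hP hQ hPQ herr using hstep
  have hL : (0 : ℝ) < Fintype.card ι := by exact_mod_cast Fintype.card_pos
  have hLc : (Fintype.card ι : ℂ) ≠ 0 := by exact_mod_cast hL.ne'
  set c : ℂ := (Fintype.card ι : ℂ)⁻¹ with hc
  have hc0 : 0 ≤ c := by
    have : c = (((Fintype.card ι : ℝ)⁻¹ : ℝ) : ℂ) := by rw [hc]; push_cast; rfl
    rw [this]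
    exact_mod_cast (inv_pos.2 hL).le
  -- The catalyst is the uniform mixture of the states of the chain, each tagged by its position;
  -- the tag carries no energy.
  let τt : Matrix (ι × β) (ι × β) ℂ := ∑ i, c • blockEmbed Prod.fst Prod.snd i (τ i)
  have hsub : ∀ i, (ρ ⊗ₖ τt).submatrix (fun p : S × β => (p.1, i, p.2))
      (fun p => (p.1, i, p.2)) = c • (ρ ⊗ₖ τ i) := by
    intro i
    ext p q
    simp [τt, Matrix.sum_apply, blockEmbed]
    ring
  have hout : cycleMap nxt Φ (ρ ⊗ₖ τt) = ∑ i, c •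
      blockEmbed (fun p : S' × (ι × β) => p.2.1) (fun p => (p.1, p.2.2)) (nxt i)
        (Φ i (ρ ⊗ₖ τ i)) := by
    rw [cycleMap_apply]
    refine Finset.sum_congr rfl fun i _ => ?_
    rw [hsub, map_smul]
    ext p q
    simp only [blockEmbed, of_apply, Matrix.smul_apply]
    split_ifs <;> simp
  -- Moving every state one step along the chain only permutes the terms, so the catalyst is
  -- returned exactly although no single τ i is.
  have hτt : τt = ∑ i, c • blockEmbed Prod.fst Prod.snd (nxt i) (τ (nxt i)) :=
    (Equiv.sum_comp nxt fun i => c • blockEmbed Prod.fst Prod.snd i (τ i)).symm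
  refine ⟨τt, cycleMap nxt Φ, isHermitian_energyMatrix _, ⟨?_, ?_⟩, ?_, ?_, ?_⟩
  · exact posSemidef_sum _ fun i _ => (blockEmbed_posSemidef _ _ _ (hτ i).1).smul hc0
  · have : ∀ i, (blockEmbed Prod.fst Prod.snd i (τ i) : Matrix (ι × β) (ι × β) ℂ).trace = 1 := by
      intro i
      rw [← (hτ i).2]
      simp only [Matrix.trace, diag_apply, blockEmbed, of_apply, and_self,
        Fintype.sum_prod_type]
      rw [Finset.sum_comm]
      simp
    simp only [τt, trace_sum, trace_smul, this]
    simp [hc, hLc]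
  · rw [jointHamiltonian_energyMatrix, jointHamiltonian_energyMatrix]
    exact isCovariant_cycleMap nxt hΦ
  · rw [hout, hτt]
    ext b b'
    simp only [reducedSnd, of_apply, Matrix.sum_apply, Matrix.smul_apply, blockEmbed]
    rw [Finset.sum_comm]
    refine Finset.sum_congr rfl fun i _ => ?_
    rw [← Finset.smul_sum]
    congr 1
    rw [← hred i]
    split_ifs
    · rfl
    · simp
  · have hdiff : cycleMap nxt Φ (ρ ⊗ₖ τt) - σ ⊗ₖ τt =
        (∑ i, c • blockEmbed (fun p : S' × (ι × β) => p.2.1) (fun p => (p.1, p.2.2)) (nxt i)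
          (P i)) -
        ∑ i, c • blockEmbed (fun p : S' × (ι × β) => p.2.1) (fun p => (p.1, p.2.2)) (nxt i)
          (Q i) := by
      rw [hout, hτt]
      ext ⟨s, j, b⟩ ⟨s', j', b'⟩
      simp only [Matrix.sub_apply, Matrix.sum_apply, kroneckerMap_apply, Matrix.smul_apply]
      rw [Finset.mul_sum, ← Finset.sum_sub_distrib, ← Finset.sum_sub_distrib]
      refine Finset.sum_congr rfl fun i _ => ?_
      simp only [blockEmbed, of_apply]
      split_ifs
      · have := congrFun (congrFun (hPQ i) (s, b)) (s', b')
        simp only [Matrix.sub_apply, kroneckerMap_apply] at this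
        rw [← smul_sub, ← this, smul_eq_mul, smul_eq_mul]
        ring
      · simp
    rw [hdiff]
    refine (traceNorm_sub_le
      (posSemidef_sum _ fun i _ => (blockEmbed_posSemidef _ _ _ (hP i)).smul hc0)
      (posSemidef_sum _ fun i _ => (blockEmbed_posSemidef _ _ _ (hQ i)).smul hc0)).trans_lt ?_
    have hcr : c = (((Fintype.card ι : ℝ)⁻¹ : ℝ) : ℂ) := by rw [hc]; push_cast; rfl
    simp only [trace_sum, trace_smul, trace_blockEmbed, Complex.re_sum]
    rw [hcr]
    simp only [smul_eq_mul, Complex.re_ofReal_mul]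
    rw [← Finset.sum_add_distrib]
    simp only [← mul_add]
    rw [← Finset.mul_sum, inv_mul_lt_iff₀ hL, mul_comm]
    exact (Finset.sum_le_sum fun i _ => herr i).trans_lt hε

end Cycle

/-! ### States as Gram matrices of real vectors, and catalysis steps between them. -/

section Gram

variable {S S' β R R' E : Type*} [Fintype S] [DecidableEq S] [Fintype S'] [DecidableEq S']
  [Fintype β] [DecidableEq β] [Fintype R] [Fintype R'] [Fintype E] [DecidableEq E]

/-- The Gram matrix `T Tᵀ` of a real matrix `T`. -/
def gram (T : β → R → ℝ) : Matrix β β ℂ :=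
  Matrix.of fun i j => ((∑ r, T i r * T j r : ℝ) : ℂ)

theorem gram_eq_mul (T : β → R → ℝ) :
    gram T = (Matrix.of fun i r => (T i r : ℂ)) * (Matrix.of fun i r => (T i r : ℂ))ᴴ := by
  ext i j
  simp [gram, mul_apply]

theorem gram_posSemidef (T : β → R → ℝ) : (gram T).PosSemidef := by
  rw [gram_eq_mul]
  exact posSemidef_self_mul_conjTranspose _

theorem trace_gram (T : β → R → ℝ) : (gram T).trace = ((∑ i, ∑ r, T i r ^ 2 : ℝ) : ℂ) := by
  simp [Matrix.trace, gram, sq]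

/-- The pure state with real amplitudes `ψ`. -/
def realPure (ψ : S → ℝ) : Matrix S S ℂ := Matrix.of fun i j => ((ψ i * ψ j : ℝ) : ℂ)

theorem isState_realPure {ψ : S → ℝ} (hψ : ∑ s, ψ s ^ 2 = 1) : IsState (realPure ψ) := by
  have : realPure ψ = gram fun s (_ : Unit) => ψ s := by ext; simp [realPure, gram]
  rw [this]
  refine ⟨gram_posSemidef _, ?_⟩
  rw [trace_gram]
  simp only [Finset.univ_unique, Finset.sum_singleton, hψ, Complex.ofReal_one]

/-- A factor T of a mixed state is a purification with purifying index r. The Kraus index e joins r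
as a discarded environment, so the image is again a Gram matrix, with index (e, r). -/
theorem krausMap_realPure_kronecker_gram {K : E → S' × β → S × β → ℝ} {ψ : S → ℝ} {T : β → R → ℝ}
    {V : S' × β → E × R → ℝ}
    (hV : ∀ p e r, V p (e, r) = ∑ q, K e p q * (ψ q.1 * T q.2 r)) :
    krausMap (fun e => Matrix.of fun p q => (K e p q : ℂ)) (realPure ψ ⊗ₖ gram T) = gram V := by
  have hprod : realPure ψ ⊗ₖ gram T = gram fun (q : S × β) r => ψ q.1 * T q.2 r := by
    ext ⟨s, b⟩ ⟨s', b'⟩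
    simp only [realPure, gram, kroneckerMap_apply, of_apply]
    rw [← Complex.ofReal_mul, Finset.mul_sum]
    congr 1
    exact Finset.sum_congr rfl fun r _ => by ring
  rw [hprod, gram_eq_mul, krausMap_apply]
  ext p p'
  simp only [Matrix.sum_apply, gram, of_apply, Fintype.sum_prod_type]
  push_cast
  refine Finset.sum_congr rfl fun e _ => ?_
  have : ∀ (A : Matrix (S' × β) (S × β) ℂ) (B : Matrix (S × β) R ℂ),
      A * (B * Bᴴ) * Aᴴ = (A * B) * (A * B)ᴴ := fun A B => by
    rw [conjTranspose_mul]; simp only [Matrix.mul_assoc]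
  rw [this, mul_apply]
  refine Finset.sum_congr rfl fun r _ => ?_
  rw [hV, hV, conjTranspose_apply, mul_apply, mul_apply]
  simp

theorem isCovariant_realKraus {h : S → ℝ} {h' : S' → ℝ} {k : β → ℝ}
    {K : E → S' × β → S × β → ℝ}
    (hK : ∀ q q', ∑ e, ∑ p, K e p q * K e p q' = if q = q' then 1 else 0)
    (hw : ∀ e, ∃ w : ℝ, ∀ p q, K e p q ≠ 0 → h' p.1 + k p.2 + w = h q.1 + k q.2) :
    IsCovariant (energyMatrix fun p : S × β => h p.1 + k p.2)
      (energyMatrix fun p : S' × β => h' p.1 + k p.2)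
      (krausMap fun e => Matrix.of fun p q => (K e p q : ℂ)) := by
  refine isCovariant_krausMap ?_ fun e => ?_
  · ext q q'
    simp only [Matrix.sum_apply, mul_apply, conjTranspose_apply, of_apply, one_apply]
    have := congrArg (fun x : ℝ => (x : ℂ)) (hK q q')
    rw [apply_ite (fun x : ℝ => (x : ℂ))] at this
    push_cast at this
    simpa using this
  · obtain ⟨w, hw⟩ := hw e
    exact ⟨w, fun p q hpq => hw p q (by simpa using hpq)⟩

theorem reducedSnd_gram {V : S' × β → R → ℝ} {T' : β → R' → ℝ}
    (hm : ∀ b b', ∑ s, ∑ x, V (s, b) x * V (s, b') x = ∑ r, T' b r * T' b' r) :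
    reducedSnd (gram V) = gram T' := by
  ext b b'
  simp only [reducedSnd, gram, of_apply]
  rw [← Complex.ofReal_sum, hm]

/-- A catalysis step for which no error estimate is needed. -/
theorem CatalysisStep.of_kraus {h : S → ℝ} {h' : S' → ℝ} {k : β → ℝ}
    {K : E → S' × β → S × β → ℝ}
    (hK : ∀ q q', ∑ e, ∑ p, K e p q * K e p q' = if q = q' then 1 else 0)
    (hw : ∀ e, ∃ w : ℝ, ∀ p q, K e p q ≠ 0 → h' p.1 + k p.2 + w = h q.1 + k q.2)
    {ψ : S → ℝ} {T : β → R → ℝ} {T' : β → R' → ℝ} {σ : Matrix S' S' ℂ}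
    (hψ : ∑ s, ψ s ^ 2 = 1) (hT : IsState (gram T)) (hσ : IsState σ)
    {V : S' × β → E × R → ℝ} (hV : ∀ p e r, V p (e, r) = ∑ q, K e p q * (ψ q.1 * T q.2 r))
    (hm : ∀ b b', ∑ s, ∑ x, V (s, b) x * V (s, b') x = ∑ r, T' b r * T' b' r) :
    CatalysisStep h h' k (realPure ψ) σ (gram T) (gram T') 2 := by
  have hcov := isCovariant_realKraus hK hw
  have hμ := hcov.1.isState ((isState_realPure hψ).kronecker hT)
  have hΦ := krausMap_realPure_kronecker_gram hV
  have hred := reducedSnd_gram hm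
  -- A step with some uncontrolled η already shows that `gram T'` is a state; afterwards the error
  -- is at most 1 + 1, the traces of two states.
  have hstep : ∃ η, CatalysisStep h h' k (realPure ψ) σ (gram T) (gram T') η :=
    ⟨_, _, hcov, by rw [hΦ, hred], gram V, 0 - (0 - σ ⊗ₖ gram T'), gram_posSemidef V, by
      rw [sub_sub_cancel]; exact hσ.1.kronecker (gram_posSemidef T'), by
      rw [hΦ, sub_sub_cancel], le_rfl⟩
  obtain ⟨η, hη⟩ := hstep
  have hT' := hη.isState (isState_realPure hψ) hT
  refine ⟨_, hcov, by rw [hΦ, hred], _, _, hμ.1, (hσ.kronecker hT').1, rfl, ?_⟩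
  rw [hμ.2, (hσ.kronecker hT').2]
  norm_num

/-- A catalysis step with an error estimate from the distance of Gram vectors. -/
theorem CatalysisStep.of_kraus_of_close {h : S → ℝ} {h' : S' → ℝ} {k : β → ℝ}
    {K : E → S' × β → S × β → ℝ}
    (hK : ∀ q q', ∑ e, ∑ p, K e p q * K e p q' = if q = q' then 1 else 0)
    (hw : ∀ e, ∃ w : ℝ, ∀ p q, K e p q ≠ 0 → h' p.1 + k p.2 + w = h q.1 + k q.2)
    {ψ : S → ℝ} {T : β → R → ℝ} {T' : β → R' → ℝ} {σ : Matrix S' S' ℂ}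
    (hψ : ∑ s, ψ s ^ 2 = 1) (hT : IsState (gram T)) (hσ : IsState σ)
    {V : S' × β → E × R → ℝ} (hV : ∀ p e r, V p (e, r) = ∑ q, K e p q * (ψ q.1 * T q.2 r))
    (hm : ∀ b b', ∑ s, ∑ x, V (s, b) x * V (s, b') x = ∑ r, T' b r * T' b' r)
    {W : S' × β → E × R → ℝ} (hW : gram W = σ ⊗ₖ gram T') {ζ x : ℝ} (hx : 0 < x)
    (hζ : ∑ p, ∑ y, (V p y - W p y) ^ 2 ≤ ζ) :
    CatalysisStep h h' k (realPure ψ) σ (gram T) (gram T')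
      ((x ^ 2 * ζ + 4 * (x⁻¹) ^ 2) / 2) := by
  obtain ⟨Φ₀, hΦ₀⟩ := CatalysisStep.of_kraus hK hw hψ hT hσ hV hm
  have hT' := CatalysisStep.isState ⟨Φ₀, hΦ₀⟩ (isState_realPure hψ) hT
  have hcov := isCovariant_realKraus hK hw
  have hΦ := krausMap_realPure_kronecker_gram hV
  have hred := reducedSnd_gram hm
  have hV1 : ∑ p, ∑ y, V p y ^ 2 = 1 := by
    have h1 := (hcov.1.isState ((isState_realPure hψ).kronecker hT)).2
    rw [hΦ, trace_gram] at h1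
    exact_mod_cast h1
  have hW1 : ∑ p, ∑ y, W p y ^ 2 = 1 := by
    have h1 := (hσ.kronecker hT').2
    rw [← hW, trace_gram] at h1
    exact_mod_cast h1
  -- Polarization: V Vᵀ - W Wᵀ is the symmetrized product of V - W and V + W, which splits as A Aᵀ -
  -- B Bᵀ. Scaling the factors by x and x⁻¹ balances the small norm of V - W against that of V + W.
  let A : S' × β → E × R → ℝ := fun p y => (x * (V p y - W p y) + x⁻¹ * (V p y + W p y)) / 2
  let B : S' × β → E × R → ℝ := fun p y => (x * (V p y - W p y) - x⁻¹ * (V p y + W p y)) / 2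
  refine ⟨_, hcov, by rw [hΦ, hred], gram A, gram B, gram_posSemidef A, gram_posSemidef B, ?_, ?_⟩
  · rw [hΦ, ← hW]
    ext p p'
    simp only [gram, Matrix.sub_apply, of_apply]
    norm_cast
    rw [← Finset.sum_sub_distrib, ← Finset.sum_sub_distrib]
    refine Finset.sum_congr rfl fun y _ => ?_
    simp only [A, B]
    field_simp
    ring
  · rw [trace_gram, trace_gram, Complex.ofReal_re, Complex.ofReal_re]
    have hsum : ∑ p, ∑ y, A p y ^ 2 + ∑ p, ∑ y, B p y ^ 2 =
        (x ^ 2 * ∑ p, ∑ y, (V p y - W p y) ^ 2 +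
          (x⁻¹) ^ 2 * ∑ p, ∑ y, (V p y + W p y) ^ 2) / 2 := by
      simp only [Finset.mul_sum, ← Finset.sum_add_distrib, Finset.sum_div]
      refine Finset.sum_congr rfl fun p _ => Finset.sum_congr rfl fun y _ => ?_
      simp only [A, B]
      ring
    have hplus : ∑ p, ∑ y, (V p y + W p y) ^ 2 ≤ 4 := by
      have : ∑ p, ∑ y, (V p y + W p y) ^ 2 ≤
          2 * ∑ p, ∑ y, V p y ^ 2 + 2 * ∑ p, ∑ y, W p y ^ 2 := by
        simp only [Finset.mul_sum, ← Finset.sum_add_distrib]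
        refine Finset.sum_le_sum fun p _ => Finset.sum_le_sum fun y _ => ?_
        nlinarith [sq_nonneg (V p y - W p y)]
      rw [hV1, hW1] at this
      linarith
    rw [hsum]
    have h1 := mul_le_mul_of_nonneg_left hζ (sq_nonneg x)
    have h2 := mul_le_mul_of_nonneg_left hplus (sq_nonneg x⁻¹)
    linarith

/-- The Kraus operators of an injective map of basis states. -/
def pointKraus (F : S × β → (S' × β) × E) (e : E) (p : S' × β) (q : S × β) : ℝ :=
  if F q = (p, e) then 1 else 0

theorem pointKraus_complete {F : S × β → (S' × β) × E} (hF : Function.Injective F) (q q' : S × β) :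
    ∑ e, ∑ p, pointKraus F e p q * pointKraus F e p q' = if q = q' then 1 else 0 := by
  rw [Finset.sum_comm, ← Fintype.sum_prod_type'
    (f := fun p e => pointKraus F e p q * pointKraus F e p q')]
  simp only [pointKraus, Prod.mk.eta]
  simp [hF.eq_iff, eq_comm]

/-- F need not be onto: `side` describes its range and G inverts it there, so amplitudes are pulled
back along G and vanish off the range. -/
theorem sum_pointKraus_mul {F : S × β → (S' × β) × E} {side : S' × β → E → Prop}
    [∀ p e, Decidable (side p e)] {G : S' × β → E → S × β}
    (hFG : ∀ q p e, F q = (p, e) ↔ side p e ∧ q = G p e) (g : S × β → ℝ) (e : E) (p : S' × β) :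
    ∑ q, pointKraus F e p q * g q = if side p e then g (G p e) else 0 := by
  simp only [pointKraus, hFG]
  by_cases h : side p e <;> simp [h]

theorem injective_of_iff {F : S × β → (S' × β) × E} {side : S' × β → E → Prop}
    {G : S' × β → E → S × β} (hFG : ∀ q p e, F q = (p, e) ↔ side p e ∧ q = G p e) :
    Function.Injective F := by
  intro q q' h
  have h1 := (hFG q (F q).1 (F q).2).1 rfl
  have h2 := (hFG q' (F q).1 (F q).2).1 h.symm
  exact h1.2.trans h2.2.symm

end Gram

/-! ### Binomial amplitudes and their near invariance under shifts. -/

section Binomial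

theorem sum_pi_succ {α M : Type*} [Fintype α] [AddCommMonoid M] {n : ℕ}
    (F : (Fin (n + 1) → α) → M) :
    ∑ x, F x = ∑ a, ∑ y : Fin n → α, F (Fin.cons a y) := by
  rw [← Fintype.sum_prod_type' (f := fun a (y : Fin n → α) => F (Fin.cons a y))]
  exact ((Fin.consEquiv fun _ => α).sum_comp F).symm

/-- The number of ones in a bit string. -/
def weight {n : ℕ} (x : Fin n → Fin 2) : ℕ := ∑ i, (x i : ℕ)

theorem weight_cons {n : ℕ} (a : Fin 2) (x : Fin n → Fin 2) :
    weight (Fin.cons a x : Fin (n + 1) → Fin 2) = a + weight x := by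
  simp [weight, Fin.sum_univ_succ]

theorem weight_le {n : ℕ} (x : Fin n → Fin 2) : weight x ≤ n := by
  have : weight x ≤ ∑ _i : Fin n, 1 := Finset.sum_le_sum fun i _ => by omega
  simpa using this

theorem card_weight_eq (n w : ℕ) :
    ∑ x : Fin n → Fin 2, (if weight x = w then 1 else 0) = n.choose w := by
  induction n generalizing w with
  | zero =>
    cases w <;> simp [weight]
  | succ n ih =>
    rw [sum_pi_succ, Fin.sum_univ_two]
    simp only [weight_cons, Fin.val_zero, Fin.val_one, zero_add]
    rw [ih]
    cases w with
    | zero => simp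
    | succ w =>
      have : ∀ x : Fin n → Fin 2, (1 + weight x = w + 1) ↔ weight x = w := fun x => by omega
      simp only [this]
      rw [ih, Nat.choose_succ_succ, add_comm]

/-- The amplitudes of the `N`-fold plus state in the energy basis. -/
def binAmp (N : ℕ) (z : ℤ) : ℝ :=
  if 0 ≤ z then √((N.choose z.toNat : ℝ) / 2 ^ N) else 0

theorem binAmp_natCast (N w : ℕ) : binAmp N w = √((N.choose w : ℝ) / 2 ^ N) := by
  simp [binAmp]

theorem binAmp_natCast_sq (N w : ℕ) : binAmp N w ^ 2 = (N.choose w : ℝ) / 2 ^ N := by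
  rw [binAmp_natCast, Real.sq_sqrt (by positivity)]

theorem binAmp_of_neg {N : ℕ} {z : ℤ} (hz : z < 0) : binAmp N z = 0 := by
  rw [binAmp, if_neg (not_le.2 hz)]

theorem binAmp_of_lt {N : ℕ} {z : ℤ} (hz : N < z) : binAmp N z = 0 := by
  lift z to ℕ using by omega
  rw [binAmp_natCast, Nat.choose_eq_zero_of_lt (by omega)]
  simp

theorem sum_binAmp_sq (N : ℕ) : ∑ w ∈ Finset.range (N + 1), binAmp N w ^ 2 = 1 := by
  simp only [binAmp_natCast_sq]
  rw [← Finset.sum_div, ← Nat.cast_sum, Nat.sum_range_choose]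
  push_cast
  exact div_self (by positivity)

/-- The variance of the binomial distribution, read off from the Bernstein polynomials at 1/2. -/
theorem sum_choose_mul_sq (m : ℕ) :
    ∑ u ∈ Finset.range (m + 1), (m.choose u : ℝ) * ((m : ℝ) - 2 * u) ^ 2 = (m : ℝ) * 2 ^ m := by
  have h := congrArg (Polynomial.eval (1 / 2 : ℝ)) (bernsteinPolynomial.variance ℝ m)
  simp only [Polynomial.eval_finsetSum, Polynomial.eval_mul, Polynomial.eval_pow,
    Polynomial.eval_sub, Polynomial.eval_natCast, nsmul_eq_mul,
    Polynomial.eval_X, Polynomial.eval_one, bernsteinPolynomial] at h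
  have h2 : ∀ u ∈ Finset.range (m + 1), (m.choose u : ℝ) * ((m : ℝ) - 2 * u) ^ 2 =
      4 * 2 ^ m * ((m * (1 / 2) - u) ^ 2 *
        ((m.choose u : ℝ) * (1 / 2) ^ u * (1 - 1 / 2) ^ (m - u))) := by
    intro u hu
    have hle : u ≤ m := by simpa [Nat.lt_succ_iff] using hu
    have hp : (1 / 2 : ℝ) ^ u * (1 - 1 / 2) ^ (m - u) = (2 ^ m)⁻¹ := by
      rw [show (1 - 1 / 2 : ℝ) = 1 / 2 by norm_num, ← pow_add, Nat.add_sub_cancel' hle]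
      simp
    rw [mul_assoc (m.choose u : ℝ), hp]
    field_simp
    ring
  rw [Finset.sum_congr rfl h2, ← Finset.mul_sum, h]
  ring

/-- Two neighbouring amplitudes a, b satisfy a² = C(N + 1 - u) and b² = C u with C = binom(N + 1, u)
/ (2^N (N + 1)). From (a - b)²(a + b)² = (a² - b²)² and (a + b)² ≥ a² + b² follows (a - b)² ≤ C(N +
1 - 2u)² / (N + 1), and the sum over u is a binomial variance. -/
theorem sum_sq_binAmp_sub (N : ℕ) :
    ∑ u ∈ Finset.range (N + 2), (binAmp N u - binAmp N ((u : ℤ) - 1)) ^ 2 ≤ 2 / (N + 1) := by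
  have hterm : ∀ u ∈ Finset.range (N + 2), (binAmp N u - binAmp N ((u : ℤ) - 1)) ^ 2 ≤
      (((N + 1).choose u : ℝ) * (((N + 1 : ℕ) : ℝ) - 2 * u) ^ 2) / (2 ^ N * (N + 1) ^ 2) := by
    intro u hu
    have hu' : u ≤ N + 1 := by simpa [Nat.lt_succ_iff] using hu
    have key : ∀ a b C : ℝ, 0 ≤ a → 0 ≤ b → 0 < C → a ^ 2 = C * (N + 1 - u) → b ^ 2 = C * u →
        (a - b) ^ 2 ≤ C * ((N + 1) - 2 * u) ^ 2 / (N + 1) := by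
      intro a b C ha hb hC h1 h2
      have hs : a ^ 2 + b ^ 2 = C * (N + 1) := by rw [h1, h2]; ring
      have hd : (a - b) * (a + b) = C * ((N + 1) - 2 * u) := by
        have : (a - b) * (a + b) = a ^ 2 - b ^ 2 := by ring
        rw [this, h1, h2]; ring
      have hN : (0 : ℝ) < N + 1 := by positivity
      rw [le_div_iff₀ hN]
      have h3 : C * ((a - b) ^ 2 * (N + 1)) ≤ C * (C * ((N + 1) - 2 * u) ^ 2) := by
        calc C * ((a - b) ^ 2 * (N + 1)) = (a - b) ^ 2 * (a ^ 2 + b ^ 2) := by rw [hs]; ring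
          _ ≤ (a - b) ^ 2 * (a + b) ^ 2 := by
            gcongr
            nlinarith [mul_nonneg ha hb]
          _ = (C * ((N + 1) - 2 * u)) ^ 2 := by rw [← hd]; ring
          _ = _ := by ring
      exact le_of_mul_le_mul_left h3 hC
    have hC : (0 : ℝ) < ((N + 1).choose u : ℝ) / (2 ^ N * (N + 1)) := by
      have := Nat.choose_pos hu'
      positivity
    have hN : (0 : ℝ) < N + 1 := by positivity
    have hnn : ∀ z, 0 ≤ binAmp N z := fun z => by
      unfold binAmp; split_ifs
      · exact Real.sqrt_nonneg _
      · exact le_rfl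
    refine (key (binAmp N u) (binAmp N ((u : ℤ) - 1)) _ (hnn _) (hnn _) hC ?_ ?_).trans
      (le_of_eq ?_)
    · rw [binAmp_natCast_sq]
      have h := Nat.choose_mul_succ_eq N u
      have h' : (N.choose u : ℝ) * (N + 1) = (N + 1).choose u * (N + 1 - u) := by
        have := congrArg (Nat.cast (R := ℝ)) h
        push_cast [Nat.cast_sub hu'] at this
        simpa using this
      field_simp
      linarith
    · rcases u with _ | u
      · simp [binAmp]
      · have : (((u + 1 : ℕ) : ℤ) - 1) = (u : ℤ) := by push_cast; ring
        rw [this, binAmp_natCast_sq]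
        have h := Nat.add_one_mul_choose_eq N u
        have h' : ((N : ℝ) + 1) * N.choose u = (N + 1).choose (u + 1) * (u + 1) := by
          exact_mod_cast h
        push_cast
        field_simp
        linarith
    · push_cast
      field_simp
  refine (Finset.sum_le_sum hterm).trans (le_of_eq ?_)
  rw [← Finset.sum_div, sum_choose_mul_sq]
  push_cast
  field_simp
  ring

/-- Summation of a function with support in `[lo, lo + m)` over a reflected window. -/
theorem sum_window {f : ℤ → ℝ} {lo : ℤ} {m D : ℕ} (hf : ∀ z, z < lo ∨ lo + m ≤ z → f z = 0)
    {A : ℤ} (h1 : lo + m ≤ A + 1) (h2 : A < lo + D) :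
    ∑ δ : Fin D, f (A - δ) = ∑ w ∈ Finset.range m, f (lo + w) := by
  rw [Fin.sum_univ_eq_sum_range (fun δ => f (A - δ))]
  symm
  refine Finset.sum_of_injOn (fun w : ℕ => (A - lo - w).toNat) ?_ ?_ ?_ ?_
  · intro a ha b hb hab
    simp only [Finset.coe_range, Set.mem_Iio] at ha hb
    simp only at hab
    omega
  · intro a ha
    simp only [Finset.coe_range, Set.mem_Iio] at ha ⊢
    omega
  · intro δ hδ hnot
    refine hf _ ?_
    by_contra! hcon
    apply hnot
    refine ⟨(A - δ - lo).toNat, ?_, ?_⟩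
    · simp only [Finset.coe_range, Set.mem_Iio]
      omega
    · simp only
      omega
  · intro w hw
    simp only [Finset.mem_range] at hw
    congr 1
    omega

/-- A common shift of both factors does not change their overlap as long as the support of the first
factor stays inside the window of length D. -/
theorem sum_binAmp_mul_shift (N : ℕ) {D : ℕ} {a b s : ℕ} (hD : N + a + s < D) :
    ∑ δ : Fin D, binAmp N ((a + s + N : ℤ) - δ) * binAmp N ((b + s + N : ℤ) - δ) =
      ∑ δ : Fin D, binAmp N ((a + N : ℤ) - δ) * binAmp N ((b + N : ℤ) - δ) := by
  have hf : ∀ z : ℤ, z < 0 ∨ 0 + ((N + 1 : ℕ) : ℤ) ≤ z →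
      binAmp N z * binAmp N (z + (b - a)) = 0 := by
    rintro z (hz | hz)
    · rw [binAmp_of_neg hz, zero_mul]
    · rw [binAmp_of_lt (by omega), zero_mul]
  have e1 := sum_window (D := D) hf (A := a + s + N) (by omega) (by omega)
  have e2 := sum_window (D := D) hf (A := a + N) (by omega) (by omega)
  have r1 : ∀ δ : Fin D, (a + s + N - δ + (b - a) : ℤ) = b + s + N - δ := fun δ => by ring
  have r2 : ∀ δ : Fin D, (a + N - δ + (b - a) : ℤ) = b + N - δ := fun δ => by ring
  simp only [r1] at e1
  simp only [r2] at e2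
  rw [e1, e2]

theorem sum_binAmp_sq_window (N : ℕ) {D : ℕ} {a : ℕ} (hD : N + a < D) :
    ∑ δ : Fin D, binAmp N ((a + N : ℤ) - δ) ^ 2 = 1 := by
  have hf : ∀ z : ℤ, z < 0 ∨ 0 + ((N + 1 : ℕ) : ℤ) ≤ z → binAmp N z ^ 2 = 0 := by
    rintro z (hz | hz)
    · rw [binAmp_of_neg hz]; simp
    · rw [binAmp_of_lt (by omega)]; simp
  rw [sum_window hf (by omega) (by omega), ← sum_binAmp_sq N]
  simp

theorem sum_binAmp_step_window (N : ℕ) {D : ℕ} {a : ℕ} (hD : N + a + 1 < D) :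
    ∑ δ : Fin D, (binAmp N ((a + 1 + N : ℤ) - δ) - binAmp N ((a + N : ℤ) - δ)) ^ 2 ≤
      2 / (N + 1) := by
  have hf : ∀ z : ℤ, z < 0 ∨ 0 + ((N + 2 : ℕ) : ℤ) ≤ z →
      (binAmp N z - binAmp N (z - 1)) ^ 2 = 0 := by
    rintro z (hz | hz)
    · rw [binAmp_of_neg hz, binAmp_of_neg (by omega)]; simp
    · rw [binAmp_of_lt (by omega), binAmp_of_lt (by omega)]; simp
  have e := sum_window (D := D) hf (A := a + 1 + N) (by omega) (by omega)
  have r : ∀ δ : Fin D, (a + 1 + N - δ - 1 : ℤ) = a + N - δ := fun δ => by ring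
  simp only [r, zero_add] at e
  rw [e]
  exact sum_sq_binAmp_sub N

/-- A shift by s is a telescoping sum of s unit shifts; Cauchy-Schwarz contributes one factor s and
the number of terms the other. -/
theorem sum_binAmp_shift_window (N : ℕ) {D : ℕ} {a : ℕ} (s : ℕ) (hD : N + a + s < D) :
    ∑ δ : Fin D, (binAmp N ((a + s + N : ℤ) - δ) - binAmp N ((a + N : ℤ) - δ)) ^ 2 ≤
      s ^ 2 * (2 / (N + 1)) := by
  have tele : ∀ δ : Fin D, (binAmp N ((a + s + N : ℤ) - δ) - binAmp N ((a + N : ℤ) - δ)) ^ 2 ≤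
      s * ∑ i ∈ Finset.range s, (binAmp N (((a + i : ℕ) + 1 + N : ℤ) - δ) -
        binAmp N (((a + i : ℕ) + N : ℤ) - δ)) ^ 2 := by
    intro δ
    have ht := Finset.sum_range_sub (fun i : ℕ => binAmp N ((a + i + N : ℤ) - δ)) s
    simp only [Nat.cast_zero, add_zero] at ht
    rw [← ht]
    have hc := sq_sum_le_card_mul_sum_sq (s := Finset.range s)
      (f := fun i => binAmp N ((a + ((i + 1 : ℕ) : ℤ) + N : ℤ) - δ) -
        binAmp N ((a + (i : ℤ) + N : ℤ) - δ))
    rw [Finset.card_range] at hc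
    refine hc.trans (le_of_eq ?_)
    congr 1
  refine (Finset.sum_le_sum fun δ _ => tele δ).trans ?_
  rw [← Finset.mul_sum, Finset.sum_comm]
  have hb : ∀ i ∈ Finset.range s, ∑ δ : Fin D, (binAmp N (((a + i : ℕ) + 1 + N : ℤ) - δ) -
      binAmp N (((a + i : ℕ) + N : ℤ) - δ)) ^ 2 ≤ 2 / (N + 1) := by
    intro i hi
    exact sum_binAmp_step_window N (by have := Finset.mem_range.1 hi; omega)
  have := Finset.sum_le_sum hb
  rw [Finset.sum_const, Finset.card_range, nsmul_eq_mul] at this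
  calc _ ≤ (s : ℝ) * (s * (2 / (N + 1))) := by gcongr
    _ = _ := by ring

end Binomial

/-! ### Storing input copies and handing out prepared copies. -/

section Protocol

/-- The amplitude `1 / √2` of the plus state. -/
def plusAmp : ℝ := 1 / √2

theorem plusAmp_mul_self : plusAmp * plusAmp = 1 / 2 := by
  rw [plusAmp, div_mul_div_comm, Real.mul_self_sqrt (by norm_num)]
  norm_num

theorem plusAmp_sq : plusAmp ^ 2 = 1 / 2 := by rw [sq, plusAmp_mul_self]

theorem plusAmp_pos : 0 < plusAmp := by unfold plusAmp; positivity

theorem plusState_eq_realPure : plusState = realPure fun _ : Fin 2 => plusAmp := by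
  ext i j
  fin_cases i <;> fin_cases j <;>
    simp [plusState, plusVec, realPure, vecMulVec_apply, plusAmp]

theorem copies_plusState (n : ℕ) :
    copies n plusState = realPure fun _ : Fin n → Fin 2 => plusAmp ^ n := by
  ext f g
  rw [plusState_eq_realPure]
  simp [copies, realPure, mul_pow]

theorem sum_plusAmp_pow_sq (n : ℕ) : ∑ _x : Fin n → Fin 2, (plusAmp ^ n) ^ 2 = 1 := by
  rw [Finset.sum_const, ← pow_mul, mul_comm, pow_mul, plusAmp_sq]
  simp

theorem qubitHamiltonian_eq (E₀ E₁ : ℝ) :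
    qubitHamiltonian E₀ E₁ = energyMatrix fun s : Fin 2 => E₀ + (E₁ - E₀) * (s : ℕ) := by
  rw [qubitHamiltonian, energyMatrix]
  congr 1
  funext i
  fin_cases i <;> simp

theorem copiesHamiltonian_qubit (n : ℕ) (E₀ E₁ : ℝ) :
    copiesHamiltonian n (qubitHamiltonian E₀ E₁) =
      energyMatrix fun f : Fin n → Fin 2 => n * E₀ + (E₁ - E₀) * weight f := by
  ext f g
  rw [qubitHamiltonian_eq]
  simp only [copiesHamiltonian, of_apply, energyMatrix, diagonal_apply]
  by_cases h : f = g
  · subst h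
    simp [weight, Finset.sum_add_distrib, Finset.mul_sum]
  · rw [if_neg h]
    refine Finset.sum_eq_zero fun k _ => ?_
    split_ifs with h1 h2
    · exact absurd (funext fun j => if hj : j = k then hj ▸ h2 else h1 j hj) h
    · rfl
    · rfl

theorem sum_update_add {m : ℕ} {α : Type*} (f : α → ℕ) (x : Fin m → α) (k : Fin m) (s : α) :
    ∑ i, f (Function.update x k s i) + f (x k) = ∑ i, f (x i) + f s := by
  rw [← Finset.add_sum_erase _ _ (Finset.mem_univ k),
    ← Finset.add_sum_erase _ (fun i => f (x i)) (Finset.mem_univ k), Function.update_self]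
  have : ∑ i ∈ Finset.univ.erase k, f (Function.update x k s i) =
      ∑ i ∈ Finset.univ.erase k, f (x i) :=
    Finset.sum_congr rfl fun i hi => by rw [Function.update_of_ne (Finset.ne_of_mem_erase hi)]
  rw [this]
  ring

variable {N M n : ℕ}

/-- Total weight of a family of bit strings. -/
def totalWeight (c : Fin M → Fin n → Fin 2) : ℕ := ∑ j, weight (c j)

theorem totalWeight_le (c : Fin M → Fin n → Fin 2) : totalWeight c ≤ M * n := by
  have : totalWeight c ≤ ∑ _j : Fin M, n := Finset.sum_le_sum fun j _ => weight_le (c j)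
  simpa using this

theorem weight_update (x : Fin N → Fin 2) (k : Fin N) (s : Fin 2) :
    weight (Function.update x k s) + (x k : ℕ) = weight x + s :=
  sum_update_add (fun a : Fin 2 => (a : ℕ)) x k s

theorem totalWeight_update (c : Fin M → Fin n → Fin 2) (j : Fin M) (s : Fin n → Fin 2) :
    totalWeight (Function.update c j s) + weight (c j) = totalWeight c + weight s :=
  sum_update_add weight c j s

theorem weight_zero : weight (0 : Fin n → Fin 2) = 0 := by simp [weight]

theorem totalWeight_zero : totalWeight (0 : Fin M → Fin n → Fin 2) = 0 := by
  simp [totalWeight, weight]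

/-- Basis states of the catalyst: a register for `N` input copies and one for `M` outputs. -/
abbrev Register (N M n : ℕ) : Type := (Fin N → Fin 2) × (Fin M → Fin n → Fin 2)

/-- Energies of the basis states of the catalyst. -/
def registerEnergy (Δ : ℝ) (b : Register N M n) : ℝ :=
  Δ * (weight b.1 + totalWeight b.2)

/-- All entries from position `j` on vanish. -/
def EmptyFrom {m : ℕ} {α : Type*} [Zero α] (j : ℕ) (x : Fin m → α) : Prop :=
  ∀ i : Fin m, j ≤ i → x i = 0

instance {m : ℕ} {α : Type*} [Zero α] [DecidableEq α] (j : ℕ) (x : Fin m → α) :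
    Decidable (EmptyFrom j x) :=
  inferInstanceAs (Decidable (∀ i : Fin m, j ≤ i → x i = 0))

/-- The first `k` input slots are in the plus state, all other slots are empty. -/
def collectAmp (k : ℕ) (b : Register N M n) (_ : Unit) : ℝ :=
  if b.2 = 0 ∧ EmptyFrom k b.1 then plusAmp ^ k else 0

/-- The first `j` output slots are filled with imperfect outputs, all other slots are empty. -/
def emitAmp (D j : ℕ) (b : Register N M n) (δ : Fin D) : ℝ :=
  if b.1 = 0 ∧ EmptyFrom j b.2 then
    plusAmp ^ (n * j) * binAmp N ((totalWeight b.2 + N : ℤ) - δ) else 0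

theorem emptyFrom_iff {m : ℕ} {α : Type*} [Zero α] (x : Fin m → α) (k : Fin m) :
    EmptyFrom (k : ℕ) x ↔ x k = 0 ∧ EmptyFrom ((k : ℕ) + 1) x := by
  constructor
  · exact fun h => ⟨h k le_rfl, fun i hi => h i (by omega)⟩
  · rintro ⟨h0, h⟩ i hi
    rcases hi.eq_or_lt with hik | hik
    · rwa [← Fin.ext hik]
    · exact h i hik

theorem emptyFrom_succ_update {m : ℕ} {α : Type*} [Zero α] (x : Fin m → α) (k : Fin m) (s : α) :
    EmptyFrom ((k : ℕ) + 1) (Function.update x k s) ↔ EmptyFrom ((k : ℕ) + 1) x := by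
  refine forall_congr' fun i => imp_congr_right fun hi => ?_
  rw [Function.update_of_ne (by rintro rfl; omega)]

theorem emptyFrom_update {m : ℕ} {α : Type*} [Zero α] (x : Fin m → α) (k : Fin m) (s : α) :
    EmptyFrom (k : ℕ) (Function.update x k s) ↔ s = 0 ∧ EmptyFrom ((k : ℕ) + 1) x := by
  rw [emptyFrom_iff, emptyFrom_succ_update, Function.update_self]

/-- The incoming qubit is swapped into slot k, the old content of the slot goes to the environment,
and the ground state of the slots is handed out. No closeness to the target is claimed, hence the
error 2. -/
theorem collectStep (E₀ E₁ : ℝ) (k : Fin N)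
    (hT : IsState (gram (collectAmp (N := N) (M := M) (n := n) k))) :
    CatalysisStep (fun s : Fin 2 => E₀ + (E₁ - E₀) * (s : ℕ))
      (fun f : Fin n → Fin 2 => n * E₀ + (E₁ - E₀) * weight f)
      (registerEnergy (N := N) (M := M) (n := n) (E₁ - E₀))
      (realPure fun _ => plusAmp) (realPure fun _ => plusAmp ^ n)
      (gram (collectAmp k)) (gram (collectAmp (k + 1))) 2 := by
  let F : Fin 2 × Register N M n → ((Fin n → Fin 2) × Register N M n) × Fin 2 := fun q =>
    ((0, (Function.update q.2.1 k q.1, q.2.2)), q.2.1 k)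
  let G : (Fin n → Fin 2) × Register N M n → Fin 2 → Fin 2 × Register N M n := fun p e =>
    (p.2.1 k, (Function.update p.2.1 k e, p.2.2))
  have hFG : ∀ q p e, F q = (p, e) ↔ p.1 = 0 ∧ q = G p e := by
    rintro ⟨s, x, c⟩ ⟨s', x', c'⟩ e
    simp only [F, G, Prod.mk.injEq]
    constructor
    · rintro ⟨⟨rfl, rfl, rfl⟩, rfl⟩
      simp
    · rintro ⟨rfl, rfl, rfl, rfl⟩
      simp
  refine CatalysisStep.of_kraus (K := pointKraus F)
    (V := fun p y => if p.1 = 0 then plusAmp * collectAmp k (G p y.1).2 y.2 else 0)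
    (pointKraus_complete (injective_of_iff hFG)) ?_ (by simp [plusAmp_sq]) hT
    (isState_realPure (sum_plusAmp_pow_sq n)) ?_ ?_
  · intro e
    -- The discarded bit e carries the energy difference; E₀ - n E₀ accounts for the offset between
    -- one qubit and n qubits.
    refine ⟨E₀ - n * E₀ + (E₁ - E₀) * (e : ℕ), fun p q hpq => ?_⟩
    have hF : F q = (p, e) := by
      by_contra h
      exact hpq (if_neg h)
    simp only [F, Prod.ext_iff] at hF
    obtain ⟨⟨h1, h2, h3⟩, h4⟩ := hF
    have hw := congrArg (Nat.cast (R := ℝ)) (weight_update q.2.1 k q.1)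
    push_cast at hw
    simp only [registerEnergy]
    rw [← h1, ← h2, ← h3, ← h4, weight_zero]
    push_cast
    linear_combination (E₁ - E₀) * hw
  · intro p e r
    rw [sum_pointKraus_mul hFG]
  · rintro ⟨x, c⟩ ⟨x', c'⟩
    have hval : ∀ (x : Fin N → Fin 2) (c : Fin M → Fin n → Fin 2) (e : Fin 2)
        (u : Unit), collectAmp (k : ℕ) (Function.update x k e, c) u =
          if c = 0 ∧ e = 0 ∧ EmptyFrom ((k : ℕ) + 1) x then plusAmp ^ (k : ℕ) else 0 := by
      intro x c e u
      simp only [collectAmp, emptyFrom_update]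
    simp only [G, Fintype.sum_prod_type, Finset.univ_unique, Finset.sum_singleton,
      Fin.sum_univ_two, hval]
    simp only [collectAmp, Fin.isValue, one_ne_zero, false_and, and_false, if_false, true_and, mul_zero]
    rw [Finset.sum_eq_single (0 : Fin n → Fin 2) (fun b _ hb => by simp [hb]) (by simp)]
    simp only [if_true, mul_zero, add_zero, ite_self]
    split_ifs <;> simp [pow_succ]
    ring

/-- Output group j is handed out and its slot cleared, while the incoming qubit is discarded. What
remains is exactly `emitAmp D j`. The handed-out string s is correlated with the rest only through a
shift of the binomial amplitudes by `weight s` ≤ n, so the distance from a product is controlled by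
n and N alone and not by M. -/
theorem emitStep (E₀ E₁ : ℝ) (j : Fin M) {D : ℕ} (hD : N + M * n + n < D)
    (hT : IsState (gram (emitAmp (N := N) (M := M) (n := n) D (j + 1)))) {x : ℝ} (hx : 0 < x) :
    CatalysisStep (fun s : Fin 2 => E₀ + (E₁ - E₀) * (s : ℕ))
      (fun f : Fin n → Fin 2 => n * E₀ + (E₁ - E₀) * weight f)
      (registerEnergy (N := N) (M := M) (n := n) (E₁ - E₀))
      (realPure fun _ => plusAmp) (realPure fun _ => plusAmp ^ n)
      (gram (emitAmp D (j + 1))) (gram (emitAmp D j))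
      ((x ^ 2 * (n ^ 2 * (2 / (N + 1))) + 4 * (x⁻¹) ^ 2) / 2) := by
  let F : Fin 2 × Register N M n → ((Fin n → Fin 2) × Register N M n) × Fin 2 := fun q =>
    ((q.2.2 j, (q.2.1, Function.update q.2.2 j 0)), q.1)
  let G : (Fin n → Fin 2) × Register N M n → Fin 2 → Fin 2 × Register N M n := fun p e =>
    (e, (p.2.1, Function.update p.2.2 j p.1))
  have hFG : ∀ q p e, F q = (p, e) ↔ p.2.2 j = 0 ∧ q = G p e := by
    rintro ⟨s, x, c⟩ ⟨s', x', c'⟩ e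
    simp only [F, G, Prod.mk.injEq]
    constructor
    · rintro ⟨⟨rfl, rfl, rfl⟩, rfl⟩
      simp
    · rintro ⟨h0, rfl, rfl, rfl⟩
      refine ⟨⟨by simp, rfl, ?_⟩, rfl⟩
      rw [Function.update_idem, ← h0, Function.update_eq_self]
  have hval : ∀ (s : Fin n → Fin 2) (b : Register N M n) (δ : Fin D),
      (if b.2 j = 0 then plusAmp * emitAmp D (j + 1) (b.1, Function.update b.2 j s) δ else 0) =
        if b.1 = 0 ∧ EmptyFrom (j : ℕ) b.2 then
          plusAmp * (plusAmp ^ n * (plusAmp ^ (n * j) *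
            binAmp N ((totalWeight b.2 + weight s + N : ℤ) - δ))) else 0 := by
    rintro s ⟨x, c⟩ δ
    simp only [emitAmp, emptyFrom_succ_update, emptyFrom_iff c j]
    by_cases h0 : c j = 0
    · have hw := totalWeight_update c j s
      rw [h0, weight_zero, add_zero] at hw
      simp only [h0, if_true, true_and, hw]
      split_ifs
      · push_cast
        ring
      · simp
    · simp [h0]
  have hwt : ∀ c : Fin M → Fin n → Fin 2, ∀ s : Fin n → Fin 2,
      N + totalWeight c + weight s < D := fun c s => by
    have := totalWeight_le c
    have := weight_le s
    omega
  let V : (Fin n → Fin 2) × Register N M n → Fin 2 × Fin D → ℝ := fun p y =>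
    if p.2.2 j = 0 then plusAmp * emitAmp D (j + 1) (G p y.1).2 y.2 else 0
  have hK := pointKraus_complete (injective_of_iff hFG)
  have hw : ∀ e, ∃ w : ℝ, ∀ p q, pointKraus F e p q ≠ 0 →
      (n * E₀ + (E₁ - E₀) * weight p.1) + registerEnergy (E₁ - E₀) p.2 + w =
        (E₀ + (E₁ - E₀) * ((q.1 : ℕ) : ℝ)) + registerEnergy (E₁ - E₀) q.2 := by
    intro e
    refine ⟨E₀ - n * E₀ + (E₁ - E₀) * (e : ℕ), fun p q hpq => ?_⟩
    have hF : F q = (p, e) := by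
      by_contra h
      exact hpq (if_neg h)
    simp only [F, Prod.ext_iff] at hF
    obtain ⟨⟨h1, h2, h3⟩, h4⟩ := hF
    have hw := congrArg (Nat.cast (R := ℝ)) (totalWeight_update q.2.2 j 0)
    rw [weight_zero] at hw
    push_cast at hw
    simp only [registerEnergy]
    rw [← h1, ← h2, ← h3, ← h4]
    linear_combination (E₁ - E₀) * hw
  have hV : ∀ p e r, V p (e, r) =
      ∑ q, pointKraus F e p q * (plusAmp * emitAmp D (j + 1) q.2 r) := by
    intro p e r
    rw [sum_pointKraus_mul hFG]
  have hψ : ∑ _s : Fin 2, plusAmp ^ 2 = 1 := by simp [plusAmp_sq]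
  have hσ := isState_realPure (sum_plusAmp_pow_sq n)
  have hm : ∀ b b', ∑ s, ∑ y, V (s, b) y * V (s, b') y =
      ∑ δ, emitAmp D j b δ * emitAmp D j b' δ := by
    rintro ⟨x, c⟩ ⟨x', c'⟩
    simp only [V, G, Fintype.sum_prod_type, Fin.sum_univ_two]
    simp only [hval _ (x, c), hval _ (x', c')]
    by_cases h1 : x = 0 ∧ EmptyFrom (j : ℕ) c
    · by_cases h2 : x' = 0 ∧ EmptyFrom (j : ℕ) c'
      · simp only [emitAmp, if_pos h1, if_pos h2]
        -- For fixed s both amplitudes are shifted by the same `weight s`, so the overlaps, and with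
        -- them the reduced state, do not feel the shift.
        have hs : ∀ s : Fin n → Fin 2,
            ∑ δ : Fin D, plusAmp * (plusAmp ^ n * (plusAmp ^ (n * (j : ℕ)) *
              binAmp N ((totalWeight c + weight s + N : ℤ) - δ))) *
              (plusAmp * (plusAmp ^ n * (plusAmp ^ (n * (j : ℕ)) *
              binAmp N ((totalWeight c' + weight s + N : ℤ) - δ)))) =
            (plusAmp ^ n) ^ 2 * (1 / 2 * ∑ δ : Fin D, plusAmp ^ (n * (j : ℕ)) *
              binAmp N ((totalWeight c + N : ℤ) - δ) * (plusAmp ^ (n * (j : ℕ)) *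
              binAmp N ((totalWeight c' + N : ℤ) - δ))) := by
          intro s
          have h := sum_binAmp_mul_shift N (b := totalWeight c') (hwt c s)
          have e1 : ∀ A B : Fin D → ℝ, ∑ δ, plusAmp ^ (n * (j : ℕ)) * A δ *
              (plusAmp ^ (n * (j : ℕ)) * B δ) = (plusAmp ^ (n * (j : ℕ))) ^ 2 * ∑ δ, A δ * B δ := by
            intro A B
            rw [Finset.mul_sum]
            exact Finset.sum_congr rfl fun δ _ => by ring
          rw [e1, ← h, Finset.mul_sum, Finset.mul_sum, Finset.mul_sum, ← plusAmp_mul_self]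
          exact Finset.sum_congr rfl fun δ _ => by ring
        simp only [hs]
        rw [← Finset.sum_congr rfl fun s _ => mul_add _ _ _, ← Finset.sum_mul,
          sum_plusAmp_pow_sq]
        ring
      · simp only [emitAmp, if_neg h2, mul_zero, Finset.sum_const_zero, add_zero]
    · simp only [emitAmp, if_neg h1, zero_mul, Finset.sum_const_zero, add_zero]
  have hT' := (CatalysisStep.of_kraus (h := fun s : Fin 2 => E₀ + (E₁ - E₀) * (s : ℕ))
    (h' := fun f : Fin n → Fin 2 => n * E₀ + (E₁ - E₀) * weight f)
    (k := registerEnergy (E₁ - E₀)) hK hw hψ hT hσ hV hm).isState (isState_realPure hψ) hT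
  refine CatalysisStep.of_kraus_of_close hK hw hψ hT hσ hV hm
    -- W ignores the shift by `weight s` and is therefore a product of the target with the remaining
    -- memory; the factor `plusAmp` belongs to the discarded input qubit.
    (W := fun p y => plusAmp * (plusAmp ^ n * emitAmp D j p.2 y.2)) ?_ hx ?_
  · ext ⟨s, b⟩ ⟨s', b'⟩
    simp only [gram, realPure, kroneckerMap_apply, of_apply, Fintype.sum_prod_type,
      Fin.sum_univ_two]
    rw [← Complex.ofReal_mul, Finset.mul_sum, ← Finset.sum_add_distrib]
    congr 1
    refine Finset.sum_congr rfl fun δ _ => ?_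
    linear_combination (2 * plusAmp ^ n * plusAmp ^ n * emitAmp D j b δ * emitAmp D j b' δ) *
      plusAmp_mul_self
  · have hTr : ∑ b : Register N M n, ∑ δ : Fin D, emitAmp D j b δ ^ 2 = 1 := by
      have h1 := hT'.2
      rw [trace_gram] at h1
      exact_mod_cast h1
    simp only [V, G, hval]
    have hb : ∀ p : (Fin n → Fin 2) × Register N M n,
        ∑ y : Fin 2 × Fin D, ((if p.2.1 = 0 ∧ EmptyFrom (j : ℕ) p.2.2 then
          plusAmp * (plusAmp ^ n * (plusAmp ^ (n * (j : ℕ)) *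
            binAmp N ((totalWeight p.2.2 + weight p.1 + N : ℤ) - y.2))) else 0) -
          plusAmp * (plusAmp ^ n * emitAmp D j p.2 y.2)) ^ 2 ≤
        (plusAmp ^ n) ^ 2 * ((∑ δ : Fin D, emitAmp D j p.2 δ ^ 2) * (n ^ 2 * (2 / (N + 1)))) := by
      rintro ⟨s, x, c⟩
      by_cases h1 : x = 0 ∧ EmptyFrom (j : ℕ) c
      · simp only [emitAmp, if_pos h1, Fintype.sum_prod_type, Fin.sum_univ_two, mul_pow,
          ← Finset.mul_sum]
        rw [sum_binAmp_sq_window N (by have := hwt c s; omega)]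
        have h := sum_binAmp_shift_window N (weight s) (hwt c s)
        have hs2 : ((weight s : ℝ)) ^ 2 * (2 / (N + 1)) ≤ n ^ 2 * (2 / (N + 1)) := by
          have : (weight s : ℝ) ≤ n := by exact_mod_cast weight_le s
          gcongr
        have e1 : ∀ δ : Fin D, (plusAmp * (plusAmp ^ n * (plusAmp ^ (n * (j : ℕ)) *
            binAmp N ((totalWeight c + weight s + N : ℤ) - δ))) -
            plusAmp * (plusAmp ^ n * (plusAmp ^ (n * (j : ℕ)) *
            binAmp N ((totalWeight c + N : ℤ) - δ)))) ^ 2 =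
            (1 / 2) * ((plusAmp ^ n) ^ 2 * (plusAmp ^ (n * (j : ℕ))) ^ 2) *
            (binAmp N ((totalWeight c + weight s + N : ℤ) - δ) -
            binAmp N ((totalWeight c + N : ℤ) - δ)) ^ 2 := by
          intro δ
          rw [← plusAmp_mul_self]
          ring
        simp only [e1, ← Finset.mul_sum]
        have hnn : 0 ≤ (plusAmp ^ n) ^ 2 * (plusAmp ^ (n * (j : ℕ))) ^ 2 := by positivity
        have := mul_le_mul_of_nonneg_left (h.trans hs2) hnn
        linarith
      · simp [emitAmp, if_neg h1]
    refine (Finset.sum_le_sum fun p _ => hb p).trans (le_of_eq ?_)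
    rw [Fintype.sum_prod_type]
    have e2 : ∀ s : Fin n → Fin 2, ∑ b : Register N M n, (plusAmp ^ n) ^ 2 *
        ((∑ δ : Fin D, emitAmp D j b δ ^ 2) * ((n : ℝ) ^ 2 * (2 / (N + 1)))) =
        (plusAmp ^ n) ^ 2 * ((n : ℝ) ^ 2 * (2 / (N + 1))) := by
      intro s
      rw [← Finset.mul_sum, ← Finset.sum_mul, hTr, one_mul]
    refine (Finset.sum_congr rfl fun s _ => e2 s).trans ?_
    rw [← Finset.sum_mul, sum_plusAmp_pow_sq, one_mul]

end Protocol

/-! ### Preparing the output groups from the stored reference. -/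

section Preparation

variable {N M n : ℕ}

/-- The projection onto the symmetric vectors, i.e. those that are constant on bit strings of equal
weight. -/
def weightProj (y x : Fin N → Fin 2) : ℝ :=
  if weight y = weight x then ((N.choose (weight x) : ℝ))⁻¹ else 0

theorem choose_weight_pos (x : Fin N → Fin 2) : (0 : ℝ) < N.choose (weight x) := by
  exact_mod_cast Nat.choose_pos (weight_le x)

theorem sum_weight_eq (w : ℕ) (a : ℝ) :
    ∑ x : Fin N → Fin 2, (if weight x = w then a else 0) = N.choose w * a := by
  rw [← card_weight_eq N w]
  push_cast
  rw [Finset.sum_mul]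
  exact Finset.sum_congr rfl fun x _ => by split_ifs <;> simp

theorem weightProj_comm (y x : Fin N → Fin 2) : weightProj y x = weightProj x y := by
  unfold weightProj
  by_cases h : weight y = weight x
  · simp [h]
  · simp [h, Ne.symm h]

theorem sum_weightProj (y : Fin N → Fin 2) : ∑ x, weightProj y x = 1 := by
  simp only [weightProj_comm y]
  simp only [weightProj]
  rw [sum_weight_eq, mul_inv_cancel₀ (choose_weight_pos y).ne']

theorem sum_weightProj_mul (x x' : Fin N → Fin 2) :
    ∑ y, weightProj y x * weightProj y x' = weightProj x x' := by
  have h : ∀ y, weightProj y x * weightProj y x' = if weight y = weight x then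
      ((N.choose (weight x) : ℝ))⁻¹ * weightProj x x' else 0 := by
    intro y
    by_cases hy : weight y = weight x
    · simp [weightProj, hy]
    · simp [weightProj, hy]
  simp only [h]
  rw [sum_weight_eq, mul_inv_cancel_left₀ (choose_weight_pos x).ne']

/-- Kraus operators that turn `N` input qubits into a reference for `M` outputs: the first family
acts on the symmetric subspace, the second one on its complement. -/
def prepKraus (D : ℕ) : Fin D ⊕ (Fin N → Fin 2) → (Fin M → Fin n → Fin 2) → (Fin N → Fin 2) → ℝ
  | Sum.inl δ, c, x =>
    if totalWeight c + N = weight x + δ then plusAmp ^ (n * M) / √(N.choose (weight x)) else 0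
  | Sum.inr y, c, x => if c = 0 then (if y = x then 1 else 0) - weightProj y x else 0

theorem sum_plusAmp_pow_sq_total :
    ∑ _c : Fin M → Fin n → Fin 2, (plusAmp ^ (n * M)) ^ 2 = 1 := by
  rw [Finset.sum_const, ← pow_mul, mul_comm, pow_mul, plusAmp_sq]
  simp [pow_mul]

/-- The first family sums to the symmetric projection P: given c and x, exactly one δ conserves the
total weight, and the window is long enough to contain it. The second family contributes (1 - P)² =
1 - P. -/
theorem prepKraus_complete {D : ℕ} (hD : N + M * n < D) (x x' : Fin N → Fin 2) :
    ∑ e, ∑ c : Fin M → Fin n → Fin 2, prepKraus D e c x * prepKraus D e c x' =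
      if x = x' then 1 else 0 := by
  rw [Fintype.sum_sum_type]
  have h1 : ∑ δ : Fin D, ∑ c : Fin M → Fin n → Fin 2,
      prepKraus D (Sum.inl δ) c x * prepKraus D (Sum.inl δ) c x' = weightProj x x' := by
    rw [Finset.sum_comm]
    have hc : ∀ c : Fin M → Fin n → Fin 2,
        ∑ δ : Fin D, prepKraus D (Sum.inl δ) c x * prepKraus D (Sum.inl δ) c x' =
          (plusAmp ^ (n * M)) ^ 2 * weightProj x x' := by
      intro c
      have hx := weight_le x
      have hcw := totalWeight_le c
      rw [Finset.sum_eq_single (⟨totalWeight c + N - weight x, by omega⟩ : Fin D)]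
      · simp only [prepKraus, weightProj]
        rw [if_pos (by omega)]
        by_cases h : weight x = weight x'
        · rw [if_pos (by omega), if_pos h, h, div_mul_div_comm,
            Real.mul_self_sqrt (choose_weight_pos x').le, ← sq, div_eq_mul_inv]
        · rw [if_neg (by omega), if_neg h]
          simp
      · intro δ _ hδ
        simp only [prepKraus]
        rw [if_neg, zero_mul]
        intro heq
        exact hδ (Fin.ext (by simp only; omega))
      · simp
    simp only [hc]
    rw [← Finset.sum_mul, sum_plusAmp_pow_sq_total, one_mul]
  have h2 : ∑ y : Fin N → Fin 2, ∑ c : Fin M → Fin n → Fin 2,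
      prepKraus D (Sum.inr y) c x * prepKraus D (Sum.inr y) c x' =
      (if x = x' then 1 else 0) - weightProj x x' := by
    have hy : ∀ y : Fin N → Fin 2, ∑ c : Fin M → Fin n → Fin 2,
        prepKraus D (Sum.inr y) c x * prepKraus D (Sum.inr y) c x' =
        (if y = x then (if x = x' then 1 else 0) - weightProj x x' else 0) -
          (if y = x' then weightProj x' x else 0) + weightProj y x * weightProj y x' := by
      intro y
      rw [Finset.sum_eq_single 0 (fun c _ hc => by simp [prepKraus, hc]) (by simp)]
      simp only [prepKraus, if_true]
      by_cases hx : y = x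
      · subst hx
        by_cases hx' : y = x'
        · subst hx'; simp; ring
        · simp [hx']; ring
      · by_cases hx' : y = x'
        · subst hx'
          simp only [hx, if_false, if_true]
          ring
        · simp [hx, hx']
    simp only [hy, Finset.sum_add_distrib, Finset.sum_sub_distrib, sum_weightProj_mul]
    simp [weightProj_comm x' x]
  rw [h1, h2]
  ring

/-- Only strings x of weight w = `totalWeight c` + N - δ contribute. There are binom(N, w) of them,
each with amplitude 2^(-N/2) / √binom(N, w), up to the common factor, which gives the binomial
amplitude at w. -/
theorem sum_prepKraus_inl {D : ℕ} (δ : Fin D) (c : Fin M → Fin n → Fin 2) :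
    ∑ x : Fin N → Fin 2, prepKraus D (Sum.inl δ) c x * plusAmp ^ N =
      plusAmp ^ (n * M) * binAmp N ((totalWeight c + N : ℤ) - δ) := by
  by_cases hδ : (δ : ℕ) ≤ totalWeight c + N
  · obtain ⟨w, hw⟩ := Nat.exists_eq_add_of_le hδ
    have hz : ((totalWeight c + N : ℤ) - δ) = (w : ℤ) := by omega
    have hx : ∀ x : Fin N → Fin 2, prepKraus D (Sum.inl δ) c x * plusAmp ^ N =
        if weight x = w then plusAmp ^ (n * M) / √(N.choose w) * plusAmp ^ N else 0 := by
      intro x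
      simp only [prepKraus]
      by_cases h : weight x = w
      · rw [if_pos (by omega), if_pos h, h]
      · rw [if_neg (by omega), if_neg h, zero_mul]
    simp only [hx]
    rw [sum_weight_eq, hz, binAmp_natCast]
    have hs : √((N.choose w : ℝ) / 2 ^ N) = √(N.choose w) * plusAmp ^ N := by
      have : (N.choose w : ℝ) / 2 ^ N = (√(N.choose w) * plusAmp ^ N) ^ 2 := by
        rw [mul_pow, Real.sq_sqrt (by positivity), ← pow_mul, mul_comm N, pow_mul, plusAmp_sq]
        simp [div_eq_mul_inv]
      rw [this, Real.sqrt_sq (mul_nonneg (Real.sqrt_nonneg _) (pow_nonneg plusAmp_pos.le _))]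
    rw [hs]
    have hdiv : (N.choose w : ℝ) * (√(N.choose w))⁻¹ = √(N.choose w) := by
      rw [← div_eq_mul_inv, Real.div_sqrt]
    rw [div_eq_mul_inv]
    linear_combination plusAmp ^ (n * M) * plusAmp ^ N * hdiv
  · rw [binAmp_of_neg (by omega), mul_zero]
    refine Finset.sum_eq_zero fun x _ => ?_
    simp only [prepKraus]
    rw [if_neg (by omega), zero_mul]

/-- The N-fold plus state is symmetric, so the completing operators never act on it. -/
theorem sum_prepKraus_inr {D : ℕ} (y : Fin N → Fin 2) (c : Fin M → Fin n → Fin 2) :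
    ∑ x : Fin N → Fin 2, prepKraus D (Sum.inr y) c x * plusAmp ^ N = 0 := by
  rw [← Finset.sum_mul]
  simp only [prepKraus]
  split_ifs
  · rw [Finset.sum_sub_distrib, sum_weightProj]
    simp
  · simp

theorem prepareStep (E₀ E₁ : ℝ) {D : ℕ} (hD : N + M * n < D)
    (hT : IsState (gram (collectAmp (N := N) (M := M) (n := n) N))) :
    CatalysisStep (fun s : Fin 2 => E₀ + (E₁ - E₀) * (s : ℕ))
      (fun f : Fin n → Fin 2 => n * E₀ + (E₁ - E₀) * weight f)
      (registerEnergy (N := N) (M := M) (n := n) (E₁ - E₀))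
      (realPure fun _ => plusAmp) (realPure fun _ => plusAmp ^ n)
      (gram (collectAmp N)) (gram (emitAmp D M)) 2 := by
  -- The environment records the incoming qubit and the old output slots along with the index of
  -- `prepKraus`; the handed-out system and the input slots are reset to zero.
  let K : (Fin 2 × (Fin M → Fin n → Fin 2)) × (Fin D ⊕ (Fin N → Fin 2)) →
      (Fin n → Fin 2) × Register N M n → Fin 2 × Register N M n → ℝ := fun e p q =>
    if p.1 = 0 ∧ p.2.1 = 0 ∧ q.1 = e.1.1 ∧ q.2.2 = e.1.2 then prepKraus D e.2 p.2.2 q.2.1 else 0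
  let V : (Fin n → Fin 2) × Register N M n →
      ((Fin 2 × (Fin M → Fin n → Fin 2)) × (Fin D ⊕ (Fin N → Fin 2))) × Unit → ℝ := fun p y =>
    if p.1 = 0 ∧ p.2.1 = 0 ∧ y.1.1.2 = 0 then
      plusAmp * ∑ x : Fin N → Fin 2, prepKraus D y.1.2 p.2.2 x * plusAmp ^ N else 0
  have hempty : ∀ x : Fin N → Fin 2, EmptyFrom N x := fun x i hi => by omega
  have hempty' : ∀ c : Fin M → Fin n → Fin 2, EmptyFrom M c := fun c i hi => by omega
  refine CatalysisStep.of_kraus (K := K) (V := V) ?_ ?_ (by simp [plusAmp_sq]) hT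
    (isState_realPure (sum_plusAmp_pow_sq n)) ?_ ?_
  · rintro ⟨s, x, c⟩ ⟨s', x', c'⟩
    have hp : ∀ e : (Fin 2 × (Fin M → Fin n → Fin 2)) × (Fin D ⊕ (Fin N → Fin 2)),
        ∑ p, K e p (s, x, c) * K e p (s', x', c') =
        if s = e.1.1 ∧ c = e.1.2 ∧ s' = e.1.1 ∧ c' = e.1.2 then
          ∑ a : Fin M → Fin n → Fin 2, prepKraus D e.2 a x * prepKraus D e.2 a x' else 0 := by
      intro e
      rw [Fintype.sum_prod_type,
        Finset.sum_eq_single (0 : Fin n → Fin 2) (fun b _ hb => by simp [K, hb]) (by simp),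
        Fintype.sum_prod_type,
        Finset.sum_eq_single (0 : Fin N → Fin 2) (fun b _ hb => by simp [K, hb]) (by simp)]
      by_cases h1 : s = e.1.1 ∧ c = e.1.2
      · by_cases h2 : s' = e.1.1 ∧ c' = e.1.2
        · simp only [K, true_and, if_pos h1, if_pos h2]
          rw [if_pos ⟨h1.1, h1.2, h2.1, h2.2⟩]
        · simp only [K, true_and, if_neg h2, mul_zero, Finset.sum_const_zero]
          rw [if_neg fun h => h2 ⟨h.2.2.1, h.2.2.2⟩]
      · simp only [K, true_and, if_neg h1, zero_mul, Finset.sum_const_zero]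
        rw [if_neg fun h => h1 ⟨h.1, h.2.1⟩]
    simp only [hp]
    rw [Fintype.sum_prod_type]
    have he : ∀ a : Fin 2 × (Fin M → Fin n → Fin 2), ∑ y : Fin D ⊕ (Fin N → Fin 2),
        (if s = a.1 ∧ c = a.2 ∧ s' = a.1 ∧ c' = a.2 then
          ∑ z : Fin M → Fin n → Fin 2, prepKraus D y z x * prepKraus D y z x' else 0) =
        if a = (s, c) then (if (s, x, c) = (s', x', c') then 1 else 0) else 0 := by
      rintro ⟨a1, a2⟩
      by_cases h : (a1, a2) = (s, c)
      · obtain ⟨rfl, rfl⟩ := Prod.mk.inj h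
        by_cases h2 : s' = a1 ∧ c' = a2
        · obtain ⟨rfl, rfl⟩ := h2
          simp [prepKraus_complete hD]
        · rw [if_pos rfl, if_neg (fun h => h2 (by simp only [Prod.mk.injEq] at h; exact ⟨h.1.symm, h.2.2.symm⟩))]
          refine Finset.sum_eq_zero fun y _ => if_neg fun h => h2 ⟨h.2.2.1, h.2.2.2⟩
      · rw [if_neg h]
        refine Finset.sum_eq_zero fun y _ => if_neg fun h' => h ?_
        exact Prod.ext h'.1.symm h'.2.1.symm
    simp only [he]
    simp
  · rintro ⟨⟨s, c⟩, δ | y⟩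
    · refine ⟨E₀ - n * E₀ + (E₁ - E₀) * ((s : ℕ) + totalWeight c + N - (δ : ℕ)), fun p q hpq => ?_⟩
      have hcond : p.1 = 0 ∧ p.2.1 = 0 ∧ q.1 = s ∧ q.2.2 = c := by
        by_contra h; exact hpq (if_neg h)
      have hne : prepKraus D (Sum.inl δ) p.2.2 q.2.1 ≠ 0 := by
        intro h; apply hpq; simp only [K]; rw [if_pos hcond, h]
      have hw : totalWeight p.2.2 + N = weight q.2.1 + δ := by
        by_contra h; exact hne (if_neg h)
      obtain ⟨h1, h2, rfl, rfl⟩ := hcond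
      have hw' := congrArg (Nat.cast (R := ℝ)) hw
      push_cast at hw'
      simp only [registerEnergy]
      rw [h1, h2, weight_zero, weight_zero]
      push_cast
      linear_combination (E₁ - E₀) * hw'
    · refine ⟨E₀ - n * E₀ + (E₁ - E₀) * ((s : ℕ) + totalWeight c + weight y), fun p q hpq => ?_⟩
      have hcond : p.1 = 0 ∧ p.2.1 = 0 ∧ q.1 = s ∧ q.2.2 = c := by
        by_contra h; exact hpq (if_neg h)
      have hne : prepKraus D (Sum.inr y) p.2.2 q.2.1 ≠ 0 := by
        intro h; apply hpq; simp only [K]; rw [if_pos hcond, h]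
      have hc0 : p.2.2 = 0 := by
        by_contra h; exact hne (if_neg h)
      -- 1 - P couples only strings of equal weight, so recording y fixes the energy that is
      -- discarded.
      have hw : weight y = weight q.2.1 := by
        by_contra h
        apply hne
        have hy : y ≠ q.2.1 := by rintro rfl; exact h rfl
        simp [prepKraus, weightProj, h, hy]
      obtain ⟨h1, h2, rfl, rfl⟩ := hcond
      simp only [registerEnergy]
      rw [h1, h2, hc0, hw, weight_zero, weight_zero, totalWeight_zero]
      push_cast
      ring
  · rintro p ⟨⟨s, c⟩, e⟩ r
    rw [Fintype.sum_prod_type, Finset.sum_eq_single s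
      (fun b _ hb => Finset.sum_eq_zero fun y _ => by simp [K, hb]) (by simp),
      Fintype.sum_prod_type_right, Finset.sum_eq_single c
      (fun b _ hb => Finset.sum_eq_zero fun y _ => by simp [K, hb]) (by simp)]
    simp only [K, V, collectAmp, hempty, and_true]
    by_cases h1 : p.1 = 0 ∧ p.2.1 = 0
    · by_cases h2 : c = 0
      · simp only [h1, h2, and_self, if_true, Finset.mul_sum]
        exact Finset.sum_congr rfl fun x _ => by ring
      · simp [h2]
    · rw [if_neg fun h => h1 ⟨h.1, h.2.1⟩]
      simp only [if_neg h1, zero_mul, Finset.sum_const_zero]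
  · rintro ⟨x, c⟩ ⟨x', c'⟩
    rw [Finset.sum_eq_single (0 : Fin n → Fin 2) (fun b _ hb => by simp [V, hb]) (by simp),
      Fintype.sum_prod_type, Fintype.sum_prod_type, Fintype.sum_prod_type, Fin.sum_univ_two]
    have hin : ∀ s : Fin 2, ∑ d : Fin M → Fin n → Fin 2, ∑ e : Fin D ⊕ (Fin N → Fin 2),
        ∑ u : Unit, V (0, x, c) (((s, d), e), u) * V (0, x', c') (((s, d), e), u) =
        1 / 2 * ∑ δ : Fin D, emitAmp D M (x, c) δ * emitAmp D M (x', c') δ := by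
      intro s
      rw [Finset.sum_eq_single (0 : Fin M → Fin n → Fin 2) (fun b _ hb => by simp [V, hb]) (by simp),
        Fintype.sum_sum_type]
      simp only [V, sum_prepKraus_inl, sum_prepKraus_inr, emitAmp, hempty', and_true, true_and,
        mul_zero, ite_self, Finset.sum_const_zero, add_zero, Finset.univ_unique,
        Finset.sum_singleton]
      rw [Finset.mul_sum]
      refine Finset.sum_congr rfl fun δ _ => ?_
      rw [← plusAmp_mul_self]
      split_ifs <;> ring
    rw [hin]
    ring

end Preparation

/-! ### Closing the chain and choosing its parameters. -/

section Amplification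

theorem CatalysisStep.mono {S S' β : Type*} [Fintype S] [DecidableEq S] [Fintype S']
    [DecidableEq S'] [Fintype β] [DecidableEq β] {h : S → ℝ} {h' : S' → ℝ} {k : β → ℝ}
    {ρ : Matrix S S ℂ} {σ : Matrix S' S' ℂ} {τ τ' : Matrix β β ℂ} {η η' : ℝ}
    (hs : CatalysisStep h h' k ρ σ τ τ' η) (hη : η ≤ η') :
    CatalysisStep h h' k ρ σ τ τ' η' := by
  obtain ⟨Φ, hΦ, hred, P, Q, hP, hQ, hPQ, herr⟩ := hs
  exact ⟨Φ, hΦ, hred, P, Q, hP, hQ, hPQ, herr.trans hη⟩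

theorem exists_catalyticConversion_of_sequence {S S' β : Type*} [Fintype S] [DecidableEq S]
    [Fintype S'] [DecidableEq S'] [Fintype β] [DecidableEq β] {h : S → ℝ} {h' : S' → ℝ}
    {k : β → ℝ} {ρ : Matrix S S ℂ} {σ : Matrix S' S' ℂ} {m : ℕ} {τ : ℕ → Matrix β β ℂ}
    {η : ℕ → ℝ} {ε : ℝ} (hρ : IsState ρ) (h0 : IsState (τ 0)) (hm : τ (m + 1) = τ 0)
    (hstep : ∀ i < m + 1, IsState (τ i) → CatalysisStep h h' k ρ σ (τ i) (τ (i + 1)) (η i))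
    (hε : ∑ i ∈ Finset.range (m + 1), η i < ε * (m + 1)) :
    ∃ (d : ℕ) (K τt : Matrix (Fin d) (Fin d) ℂ)
      (Φ : Matrix (S × Fin d) (S × Fin d) ℂ →ₗ[ℂ] Matrix (S' × Fin d) (S' × Fin d) ℂ),
      CatalyticConversion (energyMatrix h) (energyMatrix h') ρ σ ε K τt Φ := by
  have hτ : ∀ i ≤ m + 1, IsState (τ i) := by
    intro i hi
    induction i with
    | zero => exact h0
    | succ i ih => exact (hstep i (by omega) (ih (by omega))).isState hρ (ih (by omega))
  have hnxt : ∀ i : Fin (m + 1), τ (finRotate (m + 1) i) = τ (i + 1) := by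
    intro i
    by_cases hi : i = Fin.last m
    · subst hi
      rw [finRotate_last, Fin.val_last, hm]
      rfl
    · rw [coe_finRotate_of_ne_last hi]
  obtain ⟨τt, Φ, hc⟩ := exists_catalyticConversion_of_cycle (finRotate (m + 1))
    (τ := fun i : Fin (m + 1) => τ i) (η := fun i => η i) (ε := ε)
    (fun i => hτ i i.isLt.le)
    (fun i => by
      simp only [hnxt]
      exact hstep i i.isLt (hτ i i.isLt.le))
    (by rw [Fin.sum_univ_eq_sum_range, Fintype.card_fin]; exact_mod_cast hε)
  exact ⟨_, hc.reindex (Fintype.equivFin (Fin (m + 1) × β)).symm⟩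

variable {N M n : ℕ}

theorem emptyFrom_zero_iff {m : ℕ} {α : Type*} [Zero α] (x : Fin m → α) :
    EmptyFrom 0 x ↔ x = 0 :=
  ⟨fun h => funext fun i => h i (Nat.zero_le _), fun h i _ => by rw [h]; rfl⟩

theorem gram_collectAmp_zero :
    gram (collectAmp (N := N) (M := M) (n := n) 0) =
      Matrix.of fun b b' => if b = (0, 0) ∧ b' = (0, 0) then 1 else 0 := by
  ext ⟨x, c⟩ ⟨x', c'⟩
  simp only [gram, collectAmp, of_apply, emptyFrom_zero_iff, Prod.mk.injEq]
  by_cases h1 : c = 0 <;> by_cases h2 : x = 0 <;> by_cases h3 : c' = 0 <;>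
    by_cases h4 : x' = 0 <;> simp [h1, h2, h3, h4]

theorem isState_gram_collectAmp_zero :
    IsState (gram (collectAmp (N := N) (M := M) (n := n) 0)) := by
  refine ⟨gram_posSemidef _, ?_⟩
  rw [gram_collectAmp_zero]
  simp [Matrix.trace]

/-- After the last emission only the all-zero register survives, with total weight Σ `binAmp`² = 1,
so the chain closes at its starting state. -/
theorem gram_emitAmp_zero {D : ℕ} (hD : N < D) :
    gram (emitAmp (N := N) (M := M) (n := n) D 0) = gram (collectAmp 0) := by
  rw [gram_collectAmp_zero]
  ext ⟨x, c⟩ ⟨x', c'⟩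
  simp only [gram, emitAmp, of_apply, emptyFrom_zero_iff, Prod.mk.injEq]
  have h := sum_binAmp_sq_window N (D := D) (a := 0) (by omega)
  by_cases h1 : x = 0 ∧ c = 0
  · by_cases h2 : x' = 0 ∧ c' = 0
    · simp only [h1, h2, and_self, if_true, totalWeight_zero, mul_zero, pow_zero, one_mul, ← sq, h]
      simp
    · simp [h2]
  · simp [h1]

theorem approxCatalytic_plusState (E₀ E₁ : ℝ) (n : ℕ) :
    ApproxCatalytic (qubitHamiltonian E₀ E₁) (copiesHamiltonian n (qubitHamiltonian E₀ E₁))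
      plusState (copies n plusState) := by
  intro ε hε
  rw [copiesHamiltonian_qubit, qubitHamiltonian_eq, copies_plusState, plusState_eq_realPure]
  -- With x² = 8/ε, each of the two contributions to the error of an emission is at most ε/4 for
  -- such N. Then M is large enough for the N + 1 steps of error 2 to cost less than ε/2 per step on
  -- average.
  obtain ⟨N, hN⟩ := exists_nat_gt (32 * n ^ 2 / ε ^ 2 : ℝ)
  obtain ⟨M, hM⟩ := exists_nat_gt (4 * (N + 1) / ε : ℝ)
  have hx : 0 < √(8 / ε) := Real.sqrt_pos.2 (by positivity)
  set x := √(8 / ε) with hxdef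
  have hx2 : x ^ 2 = 8 / ε := Real.sq_sqrt (by positivity)
  let D := N + M * n + n + 1
  -- Times 0 to N count the stored inputs; time N + 1 has all M groups prepared, and each later time
  -- has one group fewer, down to none at N + M + 1.
  let τ : ℕ → Matrix (Register N M n) (Register N M n) ℂ := fun i =>
    if i ≤ N then gram (collectAmp i) else gram (emitAmp D (M - (i - (N + 1))))
  have herr : (x ^ 2 * (n ^ 2 * (2 / (N + 1))) + 4 * (x⁻¹) ^ 2) / 2 ≤ ε / 2 := by
    rw [inv_pow, hx2]
    rw [div_lt_iff₀ (by positivity)] at hN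
    have h1 : 8 / ε * (n ^ 2 * (2 / ((N : ℝ) + 1))) ≤ ε / 2 := by
      have : 8 / ε * (n ^ 2 * (2 / ((N : ℝ) + 1))) = (16 * n ^ 2) / (ε * (N + 1)) := by
        field_simp
        ring
      rw [this, div_le_iff₀ (by positivity)]
      nlinarith [sq_nonneg ε]
    have h2 : 4 * (8 / ε)⁻¹ = ε / 2 := by
      field_simp
      norm_num
    linarith
  refine exists_catalyticConversion_of_sequence (m := N + M) (τ := τ)
    (k := registerEnergy (E₁ - E₀))
    (η := fun i => if i ≤ N then 2 else ε / 2) (isState_realPure (by simp [plusAmp_sq])) ?_ ?_ ?_ ?_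
  · simp only [τ, Nat.zero_le, if_true]
    exact isState_gram_collectAmp_zero
  · simp only [τ, Nat.zero_le, if_true]
    rw [if_neg (by omega), show M - (N + M + 1 - (N + 1)) = 0 by omega]
    exact gram_emitAmp_zero (by omega)
  · intro i hi hT
    rcases lt_trichotomy i N with h | rfl | h
    · simp only [τ, h.le, Nat.succ_le_of_lt h, if_true] at hT ⊢
      exact collectStep E₀ E₁ ⟨i, h⟩ hT
    · simp only [τ, le_refl, if_true] at hT ⊢
      rw [if_neg (by omega), show M - (i + 1 - (i + 1)) = M by omega]
      exact prepareStep E₀ E₁ (by omega) hT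
    · obtain ⟨j, hj, hj1, hj2⟩ : ∃ j, j < M ∧ M - (i - (N + 1)) = j + 1 ∧
          M - (i + 1 - (N + 1)) = j := ⟨M - (i - N), by omega, by omega, by omega⟩
      simp only [τ] at hT ⊢
      rw [if_neg (by omega), hj1] at hT
      rw [if_neg (by omega), if_neg (by omega), if_neg (by omega), hj1, hj2]
      exact (emitStep E₀ E₁ ⟨j, hj⟩ (by omega) hT hx).mono herr
  · have hsum : ∑ i ∈ Finset.range (N + M + 1), (if i ≤ N then 2 else ε / 2) =
        2 * (N + 1) + M * (ε / 2) := by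
      rw [show N + M + 1 = (N + 1) + M by ring, Finset.sum_range_add,
        Finset.sum_congr rfl fun i hi => if_pos (Nat.lt_succ_iff.1 (Finset.mem_range.1 hi)),
        Finset.sum_congr rfl fun i _ => if_neg (show ¬ N + 1 + i ≤ N by omega)]
      simp
      ring
    rw [hsum]
    rw [div_lt_iff₀ hε] at hM
    push_cast
    nlinarith [Nat.cast_nonneg (α := ℝ) N]

end Amplification

/-! ### Fisher information of pure states and of copies of the plus state. -/

section PureState

variable {S : Type*} [Fintype S] [DecidableEq S]

theorem realPure_mul_realPure {ψ : S → ℝ} (hψ : ∑ s, ψ s ^ 2 = 1) :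
    realPure ψ * realPure ψ = realPure ψ := by
  ext i j
  simp only [mul_apply, realPure, of_apply]
  rw [← mul_one (ψ i * ψ j), ← hψ, Finset.mul_sum]
  push_cast
  exact Finset.sum_congr rfl fun k _ => by ring

/-- Differentiating ρ² = ρ along the orbit gives ρρ' + ρ'ρ = ρ', so 2ρ' solves the SLD equation. -/
theorem isSLD_two_smul_orbitDeriv {ρ H : Matrix S S ℂ} (hρ : ρ.IsHermitian) (hH : H.IsHermitian)
    (h2 : ρ * ρ = ρ) : IsSLD ρ H ((2 : ℂ) • orbitDeriv H ρ) := by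
  constructor
  · simp only [orbitDeriv, IsHermitian, conjTranspose_smul, conjTranspose_sub, conjTranspose_mul,
      hρ.eq, hH.eq]
    rw [← neg_sub (H * ρ)]
    simp only [RCLike.star_def, map_neg, Complex.conj_I, neg_neg, map_ofNat, smul_neg, neg_smul]
  · simp only [orbitDeriv, Matrix.mul_smul, Matrix.smul_mul, ← smul_add]
    congr 2
    rw [Matrix.mul_sub, Matrix.sub_mul, ← Matrix.mul_assoc ρ ρ, Matrix.mul_assoc H, h2,
      Matrix.mul_assoc ρ H ρ]
    abel

/-- The quantum Fisher information of a pure state is four times the variance of the energy. -/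
theorem qfi_realPure {ψ : S → ℝ} (hψ : ∑ s, ψ s ^ 2 = 1) (h : S → ℝ) {m : ℝ}
    (hm : ∑ s, ψ s ^ 2 * (h s - m) = 0) :
    qfi (realPure ψ) (energyMatrix h) = 4 * ∑ s, ψ s ^ 2 * (h s - m) ^ 2 := by
  have hst := isState_realPure hψ
  have hL := (isSLD_two_smul_orbitDeriv hst.1.1 (isHermitian_energyMatrix h)
    (realPure_mul_realPure hψ)).trace_eq_qfi hst.1 (isHermitian_energyMatrix h)
  have hLij : ∀ i j, ((2 : ℂ) • orbitDeriv (energyMatrix h) (realPure ψ)) i j =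
      -(2 * Complex.I) * (((h i - h j) * (ψ i * ψ j) : ℝ) : ℂ) := by
    intro i j
    simp only [orbitDeriv, energyMatrix, Matrix.smul_apply, Matrix.sub_apply, diagonal_mul,
      mul_diagonal, realPure, of_apply, smul_eq_mul]
    push_cast
    ring
  -- For the SLD L the trace is ‖L ψ‖², and the k-th component of L ψ is, up to a phase, 2 ψ k times
  -- the mean of h - h k; by `hmean` that mean is m - h k.
  have htr : (realPure ψ * ((2 : ℂ) • orbitDeriv (energyMatrix h) (realPure ψ) *
      ((2 : ℂ) • orbitDeriv (energyMatrix h) (realPure ψ)))).trace =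
      ((4 * ∑ k, ψ k ^ 2 * ((∑ j, ψ j ^ 2 * (h j - h k)) * ∑ i, ψ i ^ 2 * (h i - h k)) : ℝ) : ℂ) := by
    simp only [Matrix.trace, diag_apply, mul_apply, hLij, Finset.mul_sum, Finset.sum_mul]
    push_cast
    rw [Finset.sum_congr rfl fun i _ => Finset.sum_comm, Finset.sum_comm]
    refine Finset.sum_congr rfl fun k _ => Finset.sum_congr rfl fun i _ =>
      Finset.sum_congr rfl fun j _ => ?_
    simp only [realPure, of_apply]
    push_cast
    linear_combination (4 * (ψ i * ψ j * ψ k : ℂ) ^ 2 * (h j - h k) * (h k - h i)) * Complex.I_sq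
  have hmean : ∀ k, ∑ j, ψ j ^ 2 * (h j - h k) = m - h k := by
    intro k
    have : ∀ j, ψ j ^ 2 * (h j - h k) = ψ j ^ 2 * (h j - m) + ψ j ^ 2 * (m - h k) := fun j => by ring
    simp only [this, Finset.sum_add_distrib, hm, ← Finset.sum_mul, hψ]
    ring
  rw [htr] at hL
  simp only [hmean] at hL
  rw [← Complex.ofReal_inj, ← hL]
  congr 2
  exact Finset.sum_congr rfl fun k _ => by ring

theorem sum_weight_centered (n : ℕ) : ∑ x : Fin n → Fin 2, ((n : ℝ) - 2 * weight x) = 0 := by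
  induction n with
  | zero => simp [weight]
  | succ n ih =>
    rw [sum_pi_succ, Fin.sum_univ_two, ← Finset.sum_add_distrib]
    simp only [weight_cons]
    refine Eq.trans ?_ ((congrArg (2 * ·) ih).trans (mul_zero 2))
    rw [Finset.mul_sum]
    refine Finset.sum_congr rfl fun x _ => ?_
    push_cast
    simp
    ring

theorem sum_weight_centered_sq (n : ℕ) :
    ∑ x : Fin n → Fin 2, ((n : ℝ) - 2 * weight x) ^ 2 = (n : ℝ) * 2 ^ n := by
  induction n with
  | zero => simp [weight]
  | succ n ih =>
    rw [sum_pi_succ, Fin.sum_univ_two, ← Finset.sum_add_distrib]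
    simp only [weight_cons]
    have : ∀ x : Fin n → Fin 2, (((n + 1 : ℕ) : ℝ) - 2 * (((0 : Fin 2) : ℕ) + weight x : ℕ)) ^ 2 +
        (((n + 1 : ℕ) : ℝ) - 2 * (((1 : Fin 2) : ℕ) + weight x : ℕ)) ^ 2 =
        2 * ((n : ℝ) - 2 * weight x) ^ 2 + 2 := by
      intro x
      push_cast
      simp
      ring
    simp only [this, Finset.sum_add_distrib, ← Finset.mul_sum, ih]
    simp
    ring

theorem qfi_copies_plusState (E₀ E₁ : ℝ) (n : ℕ) :
    qfi (copies n plusState) (copiesHamiltonian n (qubitHamiltonian E₀ E₁)) =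
      n * (E₁ - E₀) ^ 2 := by
  rw [copies_plusState, copiesHamiltonian_qubit,
    qfi_realPure (sum_plusAmp_pow_sq n) _ (m := n * E₀ + (E₁ - E₀) * (n / 2))]
  · have : ∀ x : Fin n → Fin 2, (n * E₀ + (E₁ - E₀) * weight x -
        (n * E₀ + (E₁ - E₀) * (n / 2))) ^ 2 =
        (E₁ - E₀) ^ 2 / 4 * ((n : ℝ) - 2 * weight x) ^ 2 := fun x => by ring
    simp only [this]
    rw [← Finset.mul_sum, ← Finset.mul_sum, sum_weight_centered_sq, ← pow_mul, mul_comm n 2,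
      pow_mul, plusAmp_sq]
    have : (1 / 2 : ℝ) ^ n * 2 ^ n = 1 := by rw [← mul_pow]; norm_num
    linear_combination ((E₁ - E₀) ^ 2 * n) * this
  · have : ∀ x : Fin n → Fin 2, (plusAmp ^ n) ^ 2 * (n * E₀ + (E₁ - E₀) * weight x -
        (n * E₀ + (E₁ - E₀) * (n / 2))) =
        -((plusAmp ^ n) ^ 2 * (E₁ - E₀) / 2) * ((n : ℝ) - 2 * weight x) := fun x => by ring
    simp only [this]
    rw [← Finset.mul_sum, sum_weight_centered, mul_zero]

theorem qfi_plusState (E₀ E₁ : ℝ) :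
    qfi plusState (qubitHamiltonian E₀ E₁) = (E₁ - E₀) ^ 2 := by
  rw [plusState_eq_realPure, qubitHamiltonian_eq,
    qfi_realPure (by simp [plusAmp_sq]) _ (m := (E₀ + E₁) / 2)]
  · simp only [Fin.sum_univ_two, plusAmp_sq]
    simp
    ring
  · simp only [Fin.sum_univ_two, plusAmp_sq]
    simp
    ring

theorem qfi_plusState_lt_copies {E₀ E₁ : ℝ} (hE : E₀ ≠ E₁) {n : ℕ} (hn : 2 ≤ n) :
    qfi plusState (qubitHamiltonian E₀ E₁) <
      qfi (copies n plusState) (copiesHamiltonian n (qubitHamiltonian E₀ E₁)) := by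
  rw [qfi_plusState, qfi_copies_plusState]
  have h1 : 0 < (E₁ - E₀) ^ 2 := sq_pos_of_ne_zero (sub_ne_zero.2 hE.symm)
  have h2 : (2 : ℝ) ≤ n := by exact_mod_cast hn
  nlinarith

theorem isHermitian_qubitHamiltonian (E₀ E₁ : ℝ) : (qubitHamiltonian E₀ E₁).IsHermitian := by
  rw [qubitHamiltonian_eq]
  exact isHermitian_energyMatrix _

theorem isHermitian_copiesHamiltonian_qubit (n : ℕ) (E₀ E₁ : ℝ) :
    (copiesHamiltonian n (qubitHamiltonian E₀ E₁)).IsHermitian := by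
  rw [copiesHamiltonian_qubit]
  exact isHermitian_energyMatrix _

theorem isState_copies_plusState (n : ℕ) : IsState (copies n plusState) := by
  rw [copies_plusState]
  exact isState_realPure (sum_plusAmp_pow_sq n)

theorem isState_plusState : IsState plusState := by
  rw [plusState_eq_realPure]
  exact isState_realPure (by simp [plusAmp_sq])

end PureState

end Asymmetry

end

theorem mainTheorem3 :
    -- bounded approximate catalysis does not increase the quantum Fisher information
    (∀ (S S' : Type*) [Fintype S] [DecidableEq S] [Fintype S'] [DecidableEq S']
      (H ρ : Matrix S S ℂ) (H' σ : Matrix S' S' ℂ),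
      H.IsHermitian → H'.IsHermitian → Asymmetry.IsState ρ → Asymmetry.IsState σ →
      Asymmetry.BoundedApproxCatalytic H H' ρ σ →
      Asymmetry.qfi ρ H ≥ Asymmetry.qfi σ H') ∧
    -- increasing the quantum Fisher information requires unbounded catalyst Hamiltonians
    (∀ (S S' : Type*) [Fintype S] [DecidableEq S] [Fintype S'] [DecidableEq S']
      (H ρ : Matrix S S ℂ) (H' σ : Matrix S' S' ℂ),
      H.IsHermitian → H'.IsHermitian → Asymmetry.IsState ρ → Asymmetry.IsState σ →
      Asymmetry.qfi ρ H < Asymmetry.qfi σ H' →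
      Asymmetry.RequiresUnboundedCatalyst H H' ρ σ) ∧
    -- one copy of the plus state can be amplified to any number `n ≥ 2` of copies by
    -- approximate catalysis, but only with unbounded catalyst Hamiltonians
    (∀ (E₀ E₁ : ℝ) (n : ℕ), E₀ ≠ E₁ → 2 ≤ n →
      Asymmetry.ApproxCatalytic (Asymmetry.qubitHamiltonian E₀ E₁)
        (Asymmetry.copiesHamiltonian n (Asymmetry.qubitHamiltonian E₀ E₁))
        Asymmetry.plusState (Asymmetry.copies n Asymmetry.plusState) ∧
      Asymmetry.qfi Asymmetry.plusState (Asymmetry.qubitHamiltonian E₀ E₁) <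
        Asymmetry.qfi (Asymmetry.copies n Asymmetry.plusState)
          (Asymmetry.copiesHamiltonian n (Asymmetry.qubitHamiltonian E₀ E₁)) ∧
      Asymmetry.RequiresUnboundedCatalyst (Asymmetry.qubitHamiltonian E₀ E₁)
        (Asymmetry.copiesHamiltonian n (Asymmetry.qubitHamiltonian E₀ E₁))
        Asymmetry.plusState (Asymmetry.copies n Asymmetry.plusState)) :=
  ⟨fun _ _ _ _ _ _ _ _ _ _ hH hH' hρ hσ h => h.qfi_le hH hH' hρ hσ,
    fun _ _ _ _ _ _ _ _ _ _ hH hH' hρ hσ h =>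
      Asymmetry.requiresUnboundedCatalyst_of_qfi_lt hH hH' hρ hσ h,
    fun E₀ E₁ n hE hn => ⟨Asymmetry.approxCatalytic_plusState E₀ E₁ n,
      Asymmetry.qfi_plusState_lt_copies hE hn,
      Asymmetry.requiresUnboundedCatalyst_of_qfi_lt (Asymmetry.isHermitian_qubitHamiltonian E₀ E₁)
        (Asymmetry.isHermitian_copiesHamiltonian_qubit n E₀ E₁) Asymmetry.isState_plusState
        (Asymmetry.isState_copies_plusState n) (Asymmetry.qfi_plusState_lt_copies hE hn)⟩⟩
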